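/- Let $(V^n,\bar g)$, $n\ge 4$, be a smooth Riemannian manifold (without boundary) whose scalar curvature satisfies $S\ge-\kappa$ for a constant $\kappa>0$. Let $\Sigma^{n-1}$ be a compact two-sided stable minimal hypersurface in $V$: that is, $\Sigma$ is a smooth compact $(n-1)$-manifold without boundary with an immersion $\iota:\Sigma\to V$ (for instance an embedding) which admits a smooth unit normal field $N$ along $\iota$, the mean curvature $H=\operatorname{div}_\Sigma N$ vanishes identically, and $A''(0)\ge 0$ for every smooth variation $F_t:\Sigma\to V$, $|t|<\varepsilon$, $F_0=\iota$, where $A(t)$ is the area of $F_t$. For a Riemannian metric $g$ on $\Sigma$ let $$\lambda[g]=\inf_{\tilde g\in[g]}\frac{\int_\Sigma S_{\tilde g}\,d\mu_{\tilde g}}{\left(\int_\Sigma d\mu_{\tilde g}\right)^{\frac{n-3}{n-1}}}$$ be its Yamabe constant, where $[g]$ is the set of metrics $ug$ with $u\in C^\infty(\Sigma)$, $u>0$, and $S_{\tilde g}$, $\mu_{\tilde g}$ are the scalar curvature and the volume measure of $\tilde g$. Let $\sigma(\Sigma)=\sup_g\lambda[g]$, the supremum over all smooth Riemannian metrics on $\Sigma$.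 If $\sigma(\Sigma)\le 0$, then $$\operatorname{vol}(\Sigma)\ \ge\ \left(\frac{|\lambda[g]|}{\kappa}\right)^{\frac{n-1}{2}}\ \ge\ \left(\frac{|\sigma(\Sigma)|}{\kappa}\right)^{\frac{n-1}{2}},$$ where $g=\iota^*\bar g$ is the induced metric on $\Sigma$ and $\operatorname{vol}(\Sigma)$ is its volume in this metric. -/

import Mathlib

open MeasureTheory Set Bundle
open scoped Manifold ContDiff ENNReal

/- This category-theoretic instance would otherwise be found before the standard charted space
structures on normed spaces and products. -/
attribute [-instance] TopCat.of.chartedSpace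

noncomputable section

namespace YamabeArea

/-- The model space `ℝ^d` with its Euclidean norm; its `volume` is Lebesgue measure. -/
abbrev E (d : ℕ) : Type := EuclideanSpace ℝ (Fin d)

/-! ### Local Riemannian geometry: a matrix field `G` on an open set of `ℝ^d` -/

/-- The partial derivative `∂_i f (y)`. -/
def pd {d : ℕ} (i : Fin d) (f : E d → ℝ) (y : E d) : ℝ :=
  fderiv ℝ f y (EuclideanSpace.single i 1)

/-- Christoffel symbols
`Γ^k_{ij} = ½ ∑_l G^{kl} (∂_i G_{jl} + ∂_j G_{il} - ∂_l G_{ij})`. -/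
def christoffel {d : ℕ} (G : E d → Matrix (Fin d) (Fin d) ℝ) (k i j : Fin d) (y : E d) : ℝ :=
  (1 / 2) * ∑ l, (G y)⁻¹ k l *
    (pd i (fun z => G z j l) y + pd j (fun z => G z i l) y - pd l (fun z => G z i j) y)

/-- Ricci curvature
`R_{ij} = ∑_k (∂_k Γ^k_{ij} - ∂_j Γ^k_{ik}) + ∑_{k,l} (Γ^k_{kl} Γ^l_{ij} - Γ^k_{jl} Γ^l_{ik})`
(positive on round spheres). -/
def ricciCoord {d : ℕ} (G : E d → Matrix (Fin d) (Fin d) ℝ) (i j : Fin d) (y : E d) : ℝ :=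
  ∑ k, (pd k (christoffel G k i j) y - pd j (christoffel G k i k) y)
    + ∑ k, ∑ l, (christoffel G k k l y * christoffel G l i j y
        - christoffel G k j l y * christoffel G l i k y)

/-- Scalar curvature `∑_{i,j} G^{ij} R_{ij}`. -/
def scalarCoord {d : ℕ} (G : E d → Matrix (Fin d) (Fin d) ℝ) (y : E d) : ℝ :=
  ∑ i, ∑ j, (G y)⁻¹ i j * ricciCoord G i j y

/-! ### Manifolds -/

section OneManifold

variable {d : ℕ} {M : Type*} [TopologicalSpace M] [ChartedSpace (E d) M]

/-- The `i`-th coordinate vector field of the preferred chart at `p`, at the point with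
coordinates `y`. -/
def coordVec (p : M) (y : E d) (i : Fin d) :
    TangentSpace (𝓡 d) ((extChartAt (𝓡 d) p).symm y) :=
  mfderiv (𝓡 d) (𝓡 d) (extChartAt (𝓡 d) p).symm y (EuclideanSpace.single i (1 : ℝ) : E d)

/-- The matrix `h_{ij}` of a field `h` of bilinear forms on the tangent spaces, in the coordinates
of the preferred chart at `p`. -/
def gram (h : ∀ x : M, TangentSpace (𝓡 d) x → TangentSpace (𝓡 d) x → ℝ)
    (p : M) (y : E d) : Matrix (Fin d) (Fin d) ℝ :=
  Matrix.of fun i j => h ((extChartAt (𝓡 d) p).symm y) (coordVec p y i) (coordVec p y j)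

/-- The measure with density `√det h_{ij}` in the preferred chart at `p`, carried by the domain
of that chart (and zero outside of it). -/
def chartMeasure [MeasurableSpace M]
    (h : ∀ x : M, TangentSpace (𝓡 d) x → TangentSpace (𝓡 d) x → ℝ) (p : M) :
    Measure M :=
  Measure.map (extChartAt (𝓡 d) p).symm
    ((volume.restrict (extChartAt (𝓡 d) p).target).withDensity
      fun y => ENNReal.ofReal (Real.sqrt (gram h p y).det))

/-- The measure `√det h_{ij} dx¹ … dx^d` on `M`. By the change of variables formula the chart
measures agree on overlaps of charts, so that their least upper bound is the measure on `M` that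
restricts to each of them. For a Riemannian metric `h` this is the Riemannian volume measure. -/
def volumeMeasure [MeasurableSpace M]
    (h : ∀ x : M, TangentSpace (𝓡 d) x → TangentSpace (𝓡 d) x → ℝ) : Measure M :=
  ⨆ p : M, chartMeasure h p

variable [IsManifold (𝓡 d) ∞ M]

variable (d M) in
/-- Smooth Riemannian metrics on `M`. -/
abbrev RMetric : Type _ :=
  ContMDiffRiemannianMetric (𝓡 d) ∞ (E d) (fun x : M => TangentSpace (𝓡 d) x)

/-- The bilinear forms `⟨u, v⟩` of a metric. -/
def form (g : RMetric d M) (x : M) (u v : TangentSpace (𝓡 d) x) : ℝ :=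
  g.inner x u v

/-- The scalar curvature of `g` at `x`. -/
def scalarCurvature (g : RMetric d M) (x : M) : ℝ :=
  scalarCoord (gram (form g) x) (extChartAt (𝓡 d) x x)

/-- `g'` lies in the conformal class `[g]`. -/
def IsConformal (g g' : RMetric d M) : Prop :=
  ∃ u : M → ℝ, ContMDiff (𝓡 d) 𝓘(ℝ, ℝ) ∞ u ∧ (∀ x, 0 < u x) ∧
    ∀ x, g'.inner x = u x • g.inner x

variable [MeasurableSpace M]

/-- The volume-normalized total scalar curvature `∫ S dμ / (∫ dμ)^((d-2)/d)`. -/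
def normalizedTotalScalar (g : RMetric d M) : ℝ :=
  (∫ x, scalarCurvature g x ∂(volumeMeasure (form g))) /
    (∫ _x, (1 : ℝ) ∂(volumeMeasure (form g))) ^ (((d : ℝ) - 2) / d)

/-- The Yamabe constant `λ[g]`: the infimum of the volume-normalized total scalar curvature over
the conformal class of `g`, taken in the extended reals. -/
def yamabeConstant (g : RMetric d M) : EReal :=
  ⨅ g' : {g' : RMetric d M // IsConformal g g'}, ((normalizedTotalScalar g'.1 : ℝ) : EReal)

variable (d M) in
/-- The `σ`-constant (Yamabe invariant) of `M`: the supremum of the Yamabe constants of all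
Riemannian metrics on `M`, taken in the extended reals. -/
def sigmaConstant : EReal :=
  ⨆ g : RMetric d M, yamabeConstant g

end OneManifold

/-! ### Hypersurfaces -/

section Hypersurface

variable {n m : ℕ}
  {V : Type*} [TopologicalSpace V] [ChartedSpace (E n) V] [IsManifold (𝓡 n) ∞ V]
  {S : Type*} [TopologicalSpace S] [ChartedSpace (E m) S]

/-- The pull-back `f^* g` of the metric `g` under `f : S → V`. -/
def pullbackForm (g : RMetric n V) (f : S → V) (x : S) (u v : TangentSpace (𝓡 m) x) : ℝ :=
  form g (f x) (mfderiv (𝓡 m) (𝓡 n) f x u) (mfderiv (𝓡 m) (𝓡 n) f x v)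

/-- The area of the map `f : S → V`. -/
def area [MeasurableSpace S] (g : RMetric n V) (f : S → V) : ℝ :=
  (volumeMeasure (pullbackForm (m := m) g f)).real univ

/-- `F t`, `|t| < ε`, is a smooth variation of `ι : S → V`. -/
structure IsVariation (ι : S → V) (ε : ℝ) (F : ℝ → S → V) : Prop where
  pos : 0 < ε
  smooth : ContMDiffOn (𝓘(ℝ, ℝ).prod (𝓡 m)) (𝓡 n) ∞ (fun q : ℝ × S => F q.1 q.2)
    (Ioo (-ε) ε ×ˢ univ)
  zero : F 0 = ι

/-- Stability: `A''(0) ≥ 0` for every variation of `ι`, where `A(t)` is the area at time `t`. -/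
def IsStable [MeasurableSpace S] (g : RMetric n V) (ι : S → V) : Prop :=
  ∀ (ε : ℝ) (F : ℝ → S → V), IsVariation (n := n) (m := m) ι ε F →
    0 ≤ iteratedDeriv 2 (fun t => area (m := m) g (F t)) 0

/-- `N` is a smooth unit normal vector field along `ι`; a hypersurface that has one is
two-sided. -/
structure IsUnitNormal (g : RMetric n V) (ι : S → V)
    (N : ∀ x : S, TangentSpace (𝓡 n) (ι x)) : Prop where
  smooth : ContMDiff (𝓡 m) (𝓡 n).tangent ∞ (fun x => (⟨ι x, N x⟩ : TangentBundle (𝓡 n) V))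
  unit : ∀ x, form g (ι x) (N x) (N x) = 1
  normal : ∀ x (v : TangentSpace (𝓡 m) x), form g (ι x) (mfderiv (𝓡 m) (𝓡 n) ι x v) (N x) = 0

/-- Near `x`: the `k`-th coordinate of `ι`, as a function of the coordinates of `S`. The charts
are the preferred ones at `x` and at `ι x`. -/
def coordMap (ι : S → V) (x : S) (k : Fin n) (y : E m) : ℝ :=
  extChartAt (𝓡 n) (ι x) (ι ((extChartAt (𝓡 m) x).symm y)) k

/-- Near `x`: the `k`-th component of `N` in the preferred chart at `ι x`, as a function of the
coordinates of `S`. -/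
def coordNormal (ι : S → V) (N : ∀ x : S, TangentSpace (𝓡 n) (ι x)) (x : S)
    (k : Fin n) (y : E m) : ℝ :=
  let z := (extChartAt (𝓡 m) x).symm y
  let w : E n := mfderiv (𝓡 n) (𝓡 n) (extChartAt (𝓡 n) (ι x)) (ι z) (N z)
  w k

/-- The `k`-th component at `x` of `∇_{e_a} N`, where `e_a` is the `a`-th coordinate vector of
`S` and `∇` is the Levi-Civita connection of `g` pulled back by `ι`:
`∂_a N^k + ∑_{i,j} Γ^k_{ij} ∂_a ι^i N^j`. -/
def covDerivNormal (g : RMetric n V) (ι : S → V) (N : ∀ x : S, TangentSpace (𝓡 n) (ι x))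
    (x : S) (a : Fin m) (k : Fin n) : ℝ :=
  let y := extChartAt (𝓡 m) x x
  pd a (coordNormal ι N x k) y + ∑ i, ∑ j,
    christoffel (gram (form g) (ι x)) k i j (extChartAt (𝓡 n) (ι x) (ι x)) *
      pd a (coordMap ι x i) y * coordNormal ι N x j y

/-- The second fundamental form `B(e_a, e_b) = ⟨∇_{e_a} N, e_b⟩` at `x`. -/
def secondFundForm (g : RMetric n V) (ι : S → V) (N : ∀ x : S, TangentSpace (𝓡 n) (ι x))
    (x : S) (a b : Fin m) : ℝ :=
  ∑ k, ∑ l, gram (form g) (ι x) (extChartAt (𝓡 n) (ι x) (ι x)) k l *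
    covDerivNormal g ι N x a k * pd b (coordMap ι x l) (extChartAt (𝓡 m) x x)

/-- The mean curvature `H = div_S N`, the trace of `B` with respect to the induced metric. -/
def meanCurvature (g : RMetric n V) (ι : S → V) (N : ∀ x : S, TangentSpace (𝓡 n) (ι x))
    (x : S) : ℝ :=
  ∑ a : Fin m, ∑ b : Fin m,
    (gram (pullbackForm (m := m) g ι) x (extChartAt (𝓡 m) x x))⁻¹ a b *
      secondFundForm g ι N x a b

/-- `ι : (S, gS) → (V, g)` is a smooth isometric immersion, i.e. `S` is an immersed submanifold
with induced metric `gS`. (It is an immersion, as `ι^* g = gS` is positive definite.) -/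
structure IsIsometricImmersion [IsManifold (𝓡 m) ∞ S]
    (g : RMetric n V) (gS : RMetric m S) (ι : S → V) : Prop where
  smooth : ContMDiff (𝓡 m) (𝓡 n) ∞ ι
  isometric : ∀ x u v, form gS x u v = pullbackForm g ι x u v

end Hypersurface

end YamabeArea

end

/-! Write m = n - 1 for the dimension of Σ, B for its second fundamental form and c = 4(m-1)/(m-2).
The classical argument runs as follows. Stability says that ∫ |∇φ|² ≥ ∫ (Ric(N,N) + |B|²) φ². The
traced Gauss equation with H = 0 turns 2 Ric(N,N) + |B|² into S_V - S_Σ ≥ -κ - S_Σ, and c ≥ 2, so ∫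
(c |∇φ|² + S_Σ φ²) ≥ -κ ∫ φ². The left side is the total scalar curvature of the conformal metric
φ^{4/(m-2)} g, and Hölder bounds ∫ φ² by the volume of that metric to the power (m-2)/m times
vol(Σ)^{2/m}. Hence λ[g] ≥ -κ vol(Σ)^{2/m}. Since λ[g] ≤ σ(Σ) ≤ 0, this is a bound for |λ[g]|, and
|σ(Σ)| ≤ |λ[g]|.

Passing from |∇φ|² to -φ Δφ would need integration by parts on Σ. Here a choice of variation
replaces it: the velocity is φN, and the acceleration is the tangential field dual to the form
-(c/2) φ dφ. On a minimal hypersurface the acceleration enters the second derivative of the area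
density only through the divergence of its tangential part. So the pointwise formula
`second_variation` with α = -c/2 contains -φ Δφ with the coefficient of the conformal Laplacian, and
what is left of the gradient term, (2 - c)|∇φ|² after doubling, is nonpositive. Together with
`gauss_traced` this gives `second_variation_le`; with `scalar_conformal_pow` it becomes
`second_deriv_density_le`, an inequality at every point between twice the second derivative of the
density and φ^{2m/(m-2)} S_{g'} + κ φ², where g' is the conformal metric. Integration and stability
yield `integral_scalarCurvature_ge`, and then Hölder yields `yamabeConstant_ge`.

The rest supports this. Tensor calculus is done in coordinates, with covariant derivatives of vector
fields along maps (`covD`), so that hypersurfaces, curves and variations are treated alike.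
`exists_jetVariation` builds the variation by corrections in one chart at a time, following a
partition of unity. `volumeMeasure_restrict` and `iteratedDeriv_two_area` reduce the area and its
second time derivative to densities in charts. -/

set_option linter.unusedSectionVars false

noncomputable section

namespace YamabeArea

/-! ### Directional derivatives of scalar functions -/

section Directional

variable {X : Type*} [NormedAddCommGroup X] [NormedSpace ℝ X] {n : ℕ}

/-- The directional derivative `∂_v f (z)`. -/
def dd (v : X) (f : X → ℝ) (z : X) : ℝ := fderiv ℝ f z v

theorem pd_eq_dd {d : ℕ} (i : Fin d) (f : E d → ℝ) (y : E d) :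
    pd i f y = dd (EuclideanSpace.single i 1) f y := rfl

theorem dd_congr {f h : X → ℝ} {z : X} (hfh : f =ᶠ[nhds z] h) (v : X) : dd v f z = dd v h z := by
  rw [dd, dd, hfh.fderiv_eq]

theorem dd_const (v : X) (c : ℝ) (z : X) : dd v (fun _ => c) z = 0 := by
  simp [dd]

theorem dd_add {f h : X → ℝ} {z : X} (hf : DifferentiableAt ℝ f z) (hh : DifferentiableAt ℝ h z)
    (v : X) : dd v (fun x => f x + h x) z = dd v f z + dd v h z := by
  simp only [dd]; rw [fderiv_fun_add hf hh]; rfl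

theorem dd_sub {f h : X → ℝ} {z : X} (hf : DifferentiableAt ℝ f z) (hh : DifferentiableAt ℝ h z)
    (v : X) : dd v (fun x => f x - h x) z = dd v f z - dd v h z := by
  simp only [dd]; rw [fderiv_fun_sub hf hh]; rfl

theorem dd_mul {f h : X → ℝ} {z : X} (hf : DifferentiableAt ℝ f z) (hh : DifferentiableAt ℝ h z)
    (v : X) : dd v (fun x => f x * h x) z = dd v f z * h z + f z * dd v h z := by
  simp only [dd]; rw [fderiv_fun_mul hf hh]; simp; ring

theorem dd_const_mul {f : X → ℝ} {z : X} (hf : DifferentiableAt ℝ f z) (c : ℝ)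
    (v : X) : dd v (fun x => c * f x) z = c * dd v f z := by
  rw [dd_mul (differentiableAt_const c) hf, dd_const]; ring

theorem dd_sum {κ : Type*} (s : Finset κ) {f : κ → X → ℝ} {z : X}
    (hf : ∀ i ∈ s, DifferentiableAt ℝ (f i) z) (v : X) :
    dd v (fun x => ∑ i ∈ s, f i x) z = ∑ i ∈ s, dd v (f i) z := by
  simp only [dd]; rw [fderiv_fun_sum hf]; simp

theorem contDiffAt_dd {f : X → ℝ} {z : X} (hf : ContDiffAt ℝ ∞ f z) (v : X) :
    ContDiffAt ℝ ∞ (dd v f) z :=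
  (hf.fderiv_right (m := ∞) (by simp)).clm_apply contDiffAt_const

theorem diffAt {f : X → ℝ} {z : X} (hf : ContDiffAt ℝ ∞ f z) : DifferentiableAt ℝ f z :=
  hf.differentiableAt (by simp)

theorem dd_comm {f : X → ℝ} {z : X} (hf : ContDiffAt ℝ ∞ f z) (v w : X) :
    dd v (dd w f) z = dd w (dd v f) z := by
  have h2 : IsSymmSndFDerivAt ℝ f z := hf.isSymmSndFDerivAt (by
    simp only [minSmoothness_of_isRCLikeNormedField]
    exact WithTop.coe_le_coe.2 (le_top : (2 : ℕ∞) ≤ ⊤))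
  have hd : DifferentiableAt ℝ (fderiv ℝ f) z :=
    (hf.fderiv_right (m := ∞) (by simp)).differentiableAt (by simp)
  have key : ∀ a b : X, dd a (dd b f) z = fderiv ℝ (fderiv ℝ f) z a b := by
    intro a b
    simp only [dd]
    have : (fun x => fderiv ℝ f x b) = fun x => (fderiv ℝ f x) ((fun _ => b) x) := rfl
    change fderiv ℝ (fun x => fderiv ℝ f x b) z a = _
    rw [fderiv_clm_apply hd (differentiableAt_const b)]
    simp
  rw [key, key]; exact h2 v w

theorem coord_contDiffAt {F : X → E n} {z : X} (hF : ContDiffAt ℝ ∞ F z) (i : Fin n) :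
    ContDiffAt ℝ ∞ (fun x => F x i) z :=
  (contDiffAt_piLp 2).1 hF i

theorem euclidean_eq_sum (w : E n) : w = ∑ i, w i • (EuclideanSpace.single i (1 : ℝ) : E n) := by
  ext j; simp [Finset.sum_apply, Pi.single_apply]

theorem dd_coord {F : X → E n} {z : X} (hF : DifferentiableAt ℝ F z) (v : X) (i : Fin n) :
    dd v (fun x => F x i) z = (fderiv ℝ F z v) i := by
  have h := (EuclideanSpace.proj (𝕜 := ℝ) i).hasFDerivAt.comp z hF.hasFDerivAt
  have h2 : HasFDerivAt (fun x => F x i) ((EuclideanSpace.proj (𝕜 := ℝ) i).comp (fderiv ℝ F z)) z := h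
  rw [dd, h2.fderiv]; rfl

/-- Chain rule. -/
theorem dd_comp {f : E n → ℝ} {F : X → E n} {z : X} (hf : DifferentiableAt ℝ f (F z))
    (hF : DifferentiableAt ℝ F z) (v : X) :
    dd v (fun x => f (F x)) z = ∑ i, pd i f (F z) * dd v (fun x => F x i) z := by
  have h : dd v (fun x => f (F x)) z = fderiv ℝ f (F z) (fderiv ℝ F z v) := by
    have := (hf.hasFDerivAt.comp z hF.hasFDerivAt).fderiv
    simp only [dd]
    change fderiv ℝ (f ∘ F) z v = _
    rw [this]; rfl
  rw [h]
  conv_lhs => rw [euclidean_eq_sum (fderiv ℝ F z v)]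
  simp only [map_sum, map_smul, smul_eq_mul, pd]
  refine Finset.sum_congr rfl fun i _ => ?_
  rw [dd_coord hF, mul_comm]

end Directional

/-! ### Smooth matrix fields -/

section MatrixField

variable {X : Type*} [NormedAddCommGroup X] [NormedSpace ℝ X] {n : ℕ}

theorem contDiffAt_det {k : ℕ∞ω} {ι : Type*} [Fintype ι] [DecidableEq ι] {A : X → Matrix ι ι ℝ} {z : X}
    (hA : ∀ i j, ContDiffAt ℝ k (fun x => A x i j) z) :
    ContDiffAt ℝ k (fun x => (A x).det) z := by
  simp only [Matrix.det_apply]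
  refine ContDiffAt.sum fun σ _ => ?_
  refine ContDiffAt.const_smul _ ?_
  exact contDiffAt_prod fun i _ => hA _ _

/-- Cramer's rule: an entry of the adjugate is the determinant of the matrix with one row replaced
by a constant vector. -/
theorem contDiffAt_inv {k : ℕ∞ω} {ι : Type*} [Fintype ι] [DecidableEq ι] {A : X → Matrix ι ι ℝ} {z : X}
    (hA : ∀ i j, ContDiffAt ℝ k (fun x => A x i j) z) (hu : (A z).det ≠ 0) (i j : ι) :
    ContDiffAt ℝ k (fun x => (A x)⁻¹ i j) z := by
  have : (fun x => (A x)⁻¹ i j) = fun x => ((A x).det)⁻¹ * ((A x).adjugate i j) := by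
    funext x; rw [Matrix.inv_def]; simp [Matrix.smul_apply]
  rw [this]
  refine ((contDiffAt_det hA).inv hu).mul ?_
  simp only [Matrix.adjugate_apply]
  refine contDiffAt_det fun a b => ?_
  by_cases h : a = j
  · subst h; simp [contDiffAt_const]
  · simpa [Matrix.updateRow_ne h] using hA a b

/-- A symmetric matrix field which is smooth and invertible at the point `p`. -/
structure MetricAt (G : E n → Matrix (Fin n) (Fin n) ℝ) (p : E n) : Prop where
  smooth : ∀ i j, ContDiffAt ℝ ∞ (fun z => G z i j) p
  symm : ∀ z i j, G z i j = G z j i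
  det : (G p).det ≠ 0

variable {G : E n → Matrix (Fin n) (Fin n) ℝ} {p : E n}

theorem MetricAt.mul_inv (hG : MetricAt G p) : G p * (G p)⁻¹ = 1 :=
  Matrix.mul_nonsing_inv _ (isUnit_iff_ne_zero.2 hG.det)

theorem MetricAt.inv_mul (hG : MetricAt G p) : (G p)⁻¹ * G p = 1 :=
  Matrix.nonsing_inv_mul _ (isUnit_iff_ne_zero.2 hG.det)

theorem MetricAt.inv_symm (hG : MetricAt G p) (i j : Fin n) : (G p)⁻¹ i j = (G p)⁻¹ j i := by
  have h : (G p).transpose = G p := by ext a b; exact hG.symm p b a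
  have := congrFun (congrFun (Matrix.transpose_nonsing_inv (G p)) j) i
  rw [h] at this
  simpa using this

theorem MetricAt.contDiffAt_christoffel (hG : MetricAt G p) (k i j : Fin n) :
    ContDiffAt ℝ ∞ (christoffel G k i j) p := by
  have : christoffel G k i j = fun y => (1 / 2) * ∑ l, (G y)⁻¹ k l *
    (dd (EuclideanSpace.single i 1) (fun z => G z j l) y
      + dd (EuclideanSpace.single j 1) (fun z => G z i l) y
      - dd (EuclideanSpace.single l 1) (fun z => G z i j) y) := rfl
  rw [this]
  refine contDiffAt_const.mul (ContDiffAt.sum fun l _ => ?_)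
  refine (contDiffAt_inv hG.smooth hG.det k l).mul ?_
  exact ((contDiffAt_dd (hG.smooth _ _) _).add (contDiffAt_dd (hG.smooth _ _) _)).sub
    (contDiffAt_dd (hG.smooth _ _) _)

theorem christoffel_symm (hG : ∀ z i j, G z i j = G z j i) (k i j : Fin n) (y : E n) :
    christoffel G k i j y = christoffel G k j i y := by
  have h : (fun z => G z i j) = fun z => G z j i := by funext z; exact hG z i j
  simp only [christoffel, h]
  congr 1
  exact Finset.sum_congr rfl fun l _ => by ring

theorem christoffel_congr {G' : E n → Matrix (Fin n) (Fin n) ℝ} (h : G =ᶠ[nhds p] G')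
    (k i j : Fin n) : christoffel G k i j p = christoffel G' k i j p := by
  have h' : ∀ a b, (fun z => G z a b) =ᶠ[nhds p] fun z => G' z a b := fun a b => by
    filter_upwards [h] with z hz using by rw [hz]
  simp only [christoffel, pd_eq_dd, dd_congr (h' _ _), h.self_of_nhds]

/-- Lowering the index of the Christoffel symbols. -/
theorem MetricAt.lower (hG : MetricAt G p) (l i j : Fin n) :
    ∑ k, G p l k * christoffel G k i j p
      = (1 / 2) * (pd i (fun z => G z j l) p + pd j (fun z => G z i l) p
        - pd l (fun z => G z i j) p) := by
  set c : Fin n → ℝ := fun s => pd i (fun z => G z j s) p + pd j (fun z => G z i s) p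
        - pd s (fun z => G z i j) p with hc
  have h1 : ∀ k, christoffel G k i j p = (1 / 2) * ((G p)⁻¹.mulVec c) k := fun k => rfl
  have h2 : (G p).mulVec ((G p)⁻¹.mulVec c) = c := by
    rw [Matrix.mulVec_mulVec, hG.mul_inv, Matrix.one_mulVec]
  have h3 := congrFun h2 l
  simp only [h1]
  rw [show (∑ k, G p l k * (1 / 2 * ((G p)⁻¹.mulVec c) k))
    = (1 / 2) * ((G p).mulVec ((G p)⁻¹.mulVec c)) l from by
      simp only [Matrix.mulVec, dotProduct, Finset.mul_sum]
      exact Finset.sum_congr rfl fun k _ => Finset.sum_congr rfl fun s _ => by ring]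
  rw [h3]

/-- In the sum of the two lowered Christoffel symbols four of the six metric derivatives cancel in
pairs and the other two agree. -/
theorem MetricAt.compat (hG : MetricAt G p) (i k l : Fin n) :
    pd i (fun z => G z k l) p
      = ∑ s, G p s l * christoffel G s i k p + ∑ s, G p k s * christoffel G s i l p := by
  have h1 : ∑ s, G p s l * christoffel G s i k p = ∑ s, G p l s * christoffel G s i k p :=
    Finset.sum_congr rfl fun s _ => by rw [hG.symm]
  have hs : ∀ a b, (fun z => G z a b) = fun z => G z b a := fun a b => by
    funext z; exact hG.symm z a b
  rw [h1, hG.lower, hG.lower, hs l k, hs i l, hs i k]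
  ring

end MatrixField

/-! ### Covariant derivatives along maps -/

section Cov

variable {X : Type*} [NormedAddCommGroup X] [NormedSpace ℝ X] {n : ℕ}

/-- The bilinear form with matrix `A`. -/
def ip (A : Matrix (Fin n) (Fin n) ℝ) (u w : Fin n → ℝ) : ℝ := ∑ k, ∑ l, A k l * u k * w l

/-- The components of the derivative `∂_v F`. -/
def dvec (v : X) (F : X → E n) (z : X) : Fin n → ℝ := fun i => dd v (fun x => F x i) z

/-- `Γ(v, u)`. -/
def chr (G : E n → Matrix (Fin n) (Fin n) ℝ) (p : E n) (v u : Fin n → ℝ) : Fin n → ℝ :=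
  fun k => ∑ i, ∑ j, christoffel G k i j p * v i * u j

/-- The covariant derivative `D_v U` of a vector field `U` along the map `F`. -/
def covD (G : E n → Matrix (Fin n) (Fin n) ℝ) (F : X → E n) (v : X) (U : X → Fin n → ℝ) (z : X) :
    Fin n → ℝ :=
  fun k => dd v (fun x => U x k) z + chr G (F z) (dvec v F z) (U z) k

/-- The components `R^k_{lij}` of the curvature. -/
def riem (G : E n → Matrix (Fin n) (Fin n) ℝ) (p : E n) (k l i j : Fin n) : ℝ :=
  pd i (christoffel G k j l) p - pd j (christoffel G k i l) p
    + ∑ s, (christoffel G k i s p * christoffel G s j l p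
      - christoffel G k j s p * christoffel G s i l p)

/-- `R(v, w)u`. -/
def riemV (G : E n → Matrix (Fin n) (Fin n) ℝ) (p : E n) (v w u : Fin n → ℝ) : Fin n → ℝ :=
  fun k => ∑ l, ∑ i, ∑ j, riem G p k l i j * u l * v i * w j

theorem ip_add_left (A : Matrix (Fin n) (Fin n) ℝ) (u u' w : Fin n → ℝ) :
    ip A (u + u') w = ip A u w + ip A u' w := by
  simp only [ip, ← Finset.sum_add_distrib, Pi.add_apply]
  exact Finset.sum_congr rfl fun k _ => Finset.sum_congr rfl fun l _ => by ring

theorem ip_smul_left (A : Matrix (Fin n) (Fin n) ℝ) (c : ℝ) (u w : Fin n → ℝ) :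
    ip A (c • u) w = c * ip A u w := by
  simp only [ip, Finset.mul_sum, Pi.smul_apply, smul_eq_mul]
  exact Finset.sum_congr rfl fun k _ => Finset.sum_congr rfl fun l _ => by ring

theorem ip_comm {A : Matrix (Fin n) (Fin n) ℝ} (hA : ∀ i j, A i j = A j i) (u w : Fin n → ℝ) :
    ip A u w = ip A w u := by
  simp only [ip]
  rw [Finset.sum_comm]
  exact Finset.sum_congr rfl fun k _ => Finset.sum_congr rfl fun l _ => by rw [hA]; ring

theorem ip_add_right (A : Matrix (Fin n) (Fin n) ℝ) (u w w' : Fin n → ℝ) :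
    ip A u (w + w') = ip A u w + ip A u w' := by
  simp only [ip, ← Finset.sum_add_distrib, Pi.add_apply]
  exact Finset.sum_congr rfl fun k _ => Finset.sum_congr rfl fun l _ => by ring

theorem ip_smul_right (A : Matrix (Fin n) (Fin n) ℝ) (c : ℝ) (u w : Fin n → ℝ) :
    ip A u (c • w) = c * ip A u w := by
  simp only [ip, Finset.mul_sum, Pi.smul_apply, smul_eq_mul]
  exact Finset.sum_congr rfl fun k _ => Finset.sum_congr rfl fun l _ => by ring

/-- `ip` as a bilinear map. -/
def ipL (A : Matrix (Fin n) (Fin n) ℝ) : (Fin n → ℝ) →ₗ[ℝ] (Fin n → ℝ) →ₗ[ℝ] ℝ :=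
  LinearMap.mk₂ ℝ (ip A) (ip_add_left A) (ip_smul_left A) (ip_add_right A) (ip_smul_right A)

theorem ipL_apply (A : Matrix (Fin n) (Fin n) ℝ) (u w : Fin n → ℝ) : ipL A u w = ip A u w := rfl

theorem ip_sum_left {κ : Type*} (s : Finset κ) (A : Matrix (Fin n) (Fin n) ℝ)
    (u : κ → Fin n → ℝ) (w : Fin n → ℝ) : ip A (∑ a ∈ s, u a) w = ∑ a ∈ s, ip A (u a) w := by
  simp only [← ipL_apply, map_sum, LinearMap.sum_apply]

theorem ip_sum_right {κ : Type*} (s : Finset κ) (A : Matrix (Fin n) (Fin n) ℝ)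
    (u : κ → Fin n → ℝ) (w : Fin n → ℝ) : ip A w (∑ a ∈ s, u a) = ∑ a ∈ s, ip A w (u a) := by
  simp only [← ipL_apply, map_sum]

theorem ip_eq_mulVec (A : Matrix (Fin n) (Fin n) ℝ) (u w : Fin n → ℝ) :
    ip A u w = u ⬝ᵥ A.mulVec w := by
  simp only [ip, Matrix.mulVec, dotProduct, Finset.mul_sum]
  exact Finset.sum_congr rfl fun k _ => Finset.sum_congr rfl fun l _ => by ring

theorem ip_single_right (A : Matrix (Fin n) (Fin n) ℝ) (u : Fin n → ℝ) (l : Fin n) :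
    ip A u (Pi.single l 1) = ∑ k, A k l * u k := by
  simp [ip, Pi.single_apply]

theorem chr_add_right (G : E n → Matrix (Fin n) (Fin n) ℝ) (p : E n) (v u u' : Fin n → ℝ) :
    chr G p v (u + u') = chr G p v u + chr G p v u' := by
  funext k
  simp only [chr, Pi.add_apply, ← Finset.sum_add_distrib, mul_add]

theorem chr_add_left (G : E n → Matrix (Fin n) (Fin n) ℝ) (p : E n) (v v' u : Fin n → ℝ) :
    chr G p (v + v') u = chr G p v u + chr G p v' u := by
  funext k
  simp only [chr, Pi.add_apply, ← Finset.sum_add_distrib, mul_add, add_mul]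

theorem chr_smul_right (G : E n → Matrix (Fin n) (Fin n) ℝ) (p : E n) (c : ℝ) (v u : Fin n → ℝ) :
    chr G p v (c • u) = c • chr G p v u := by
  funext k
  simp only [chr, Pi.smul_apply, smul_eq_mul, Finset.mul_sum]
  exact Finset.sum_congr rfl fun i _ => Finset.sum_congr rfl fun j _ => by ring

theorem chr_symm {G : E n → Matrix (Fin n) (Fin n) ℝ} (hG : ∀ z i j, G z i j = G z j i) (p : E n)
    (v u : Fin n → ℝ) : chr G p v u = chr G p u v := by
  funext k
  simp only [chr]
  rw [Finset.sum_comm]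
  exact Finset.sum_congr rfl fun i _ => Finset.sum_congr rfl fun j _ => by
    rw [christoffel_symm hG]; ring

theorem chr_smul_left {G : E n → Matrix (Fin n) (Fin n) ℝ} (p : E n) (c : ℝ) (v u : Fin n → ℝ) :
    chr G p (c • v) u = c • chr G p v u := by
  funext k
  simp only [chr, Pi.smul_apply, smul_eq_mul, Finset.mul_sum]
  exact Finset.sum_congr rfl fun i _ => Finset.sum_congr rfl fun j _ => by ring

variable {G : E n → Matrix (Fin n) (Fin n) ℝ} {F : X → E n} {z : X}

theorem covD_congr {U W : X → Fin n → ℝ} (h : U =ᶠ[nhds z] W) (v : X) :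
    covD G F v U z = covD G F v W z := by
  funext k
  have : (fun x => U x k) =ᶠ[nhds z] fun x => W x k := h.fun_comp (fun a => a k)
  simp only [covD, dd_congr this, h.self_of_nhds]

/-- The Levi-Civita connection is metric. -/
theorem dd_ip (hG : MetricAt G (F z)) (hF : ContDiffAt ℝ ∞ F z) {U W : X → Fin n → ℝ}
    (hU : ∀ k, ContDiffAt ℝ ∞ (fun x => U x k) z) (hW : ∀ k, ContDiffAt ℝ ∞ (fun x => W x k) z)
    (v : X) :
    dd v (fun x => ip (G (F x)) (U x) (W x)) z
      = ip (G (F z)) (covD G F v U z) (W z) + ip (G (F z)) (U z) (covD G F v W z) := by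
  have hGF : ∀ k l, ContDiffAt ℝ ∞ (fun x => G (F x) k l) z := fun k l =>
    (hG.smooth k l).comp z hF
  have e1 : dd v (fun x => ip (G (F x)) (U x) (W x)) z
      = ∑ k, ∑ l, (dd v (fun x => G (F x) k l) z * U z k * W z l
        + G (F z) k l * dd v (fun x => U x k) z * W z l
        + G (F z) k l * U z k * dd v (fun x => W x l) z) := by
    simp only [ip]
    rw [dd_sum _ fun k _ => diffAt (ContDiffAt.sum fun l _ => ((hGF k l).mul (hU k)).mul (hW l))]
    refine Finset.sum_congr rfl fun k _ => ?_
    rw [dd_sum _ fun l _ => diffAt (((hGF k l).mul (hU k)).mul (hW l))]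
    refine Finset.sum_congr rfl fun l _ => ?_
    rw [dd_mul (diffAt ((hGF k l).mul (hU k))) (diffAt (hW l)), dd_mul (diffAt (hGF k l)) (diffAt (hU k))]
    ring
  -- By the chain rule and metric compatibility, the derivative of the coefficients splits into two
  -- Christoffel sums; `e3` and `e4` recognise them as the connection terms of the two covariant
  -- derivatives.
  have e2 : ∀ k l, dd v (fun x => G (F x) k l) z
      = ∑ i, (∑ s, G (F z) s l * christoffel G s i k (F z)
          + ∑ s, G (F z) k s * christoffel G s i l (F z)) * dvec v F z i := fun k l => by
    rw [dd_comp (f := fun p => G p k l) (diffAt (hG.smooth k l)) (hF.differentiableAt (by simp))]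
    exact Finset.sum_congr rfl fun i _ => by rw [hG.compat]; rfl
  have e3 : ip (G (F z)) (chr G (F z) (dvec v F z) (U z)) (W z)
      = ∑ k, ∑ l, (∑ i, (∑ s, G (F z) s l * christoffel G s i k (F z)) * dvec v F z i)
          * U z k * W z l := by
    simp only [ip, chr, Finset.mul_sum, Finset.sum_mul]
    rw [Finset.sum_comm]
    conv_rhs => rw [Finset.sum_comm]
    refine Finset.sum_congr rfl fun l _ => ?_
    rw [Finset.sum_comm]
    conv_rhs => rw [Finset.sum_comm]
    refine Finset.sum_congr rfl fun i _ => ?_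
    rw [Finset.sum_comm]
    refine Finset.sum_congr rfl fun k _ => ?_
    exact Finset.sum_congr rfl fun s _ => by ring
  have e4 : ip (G (F z)) (U z) (chr G (F z) (dvec v F z) (W z))
      = ∑ k, ∑ l, (∑ i, (∑ s, G (F z) k s * christoffel G s i l (F z)) * dvec v F z i)
          * U z k * W z l := by
    simp only [ip, chr, Finset.mul_sum, Finset.sum_mul]
    refine Finset.sum_congr rfl fun k _ => ?_
    rw [Finset.sum_comm]
    conv_rhs => rw [Finset.sum_comm]
    refine Finset.sum_congr rfl fun i _ => ?_
    rw [Finset.sum_comm]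
    refine Finset.sum_congr rfl fun l _ => ?_
    exact Finset.sum_congr rfl fun s _ => by ring
  have e5 : covD G F v U z = (fun k => dd v (fun x => U x k) z) + chr G (F z) (dvec v F z) (U z) := rfl
  have e6 : covD G F v W z = (fun k => dd v (fun x => W x k) z) + chr G (F z) (dvec v F z) (W z) := rfl
  rw [e5, e6, ip_add_left, ip_add_right, e3, e4, e1]
  simp only [e2, ip, ← Finset.sum_add_distrib]
  refine Finset.sum_congr rfl fun k _ => Finset.sum_congr rfl fun l _ => ?_
  simp only [add_mul, Finset.sum_add_distrib]
  ring

theorem contDiffAt_dvec (hF : ContDiffAt ℝ ∞ F z) (v : X) (k : Fin n) :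
    ContDiffAt ℝ ∞ (fun x => dvec v F x k) z :=
  contDiffAt_dd (coord_contDiffAt hF k) v

theorem contDiffAt_chr (hG : MetricAt G (F z)) (hF : ContDiffAt ℝ ∞ F z) {U W : X → Fin n → ℝ}
    (hU : ∀ k, ContDiffAt ℝ ∞ (fun x => U x k) z) (hW : ∀ k, ContDiffAt ℝ ∞ (fun x => W x k) z)
    (k : Fin n) : ContDiffAt ℝ ∞ (fun x => chr G (F x) (U x) (W x) k) z :=
  ContDiffAt.sum fun i _ => ContDiffAt.sum fun j _ =>
    ((ContDiffAt.comp (g := christoffel G k i j) z (hG.contDiffAt_christoffel k i j) hF).mul (hU i)).mul (hW j)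

theorem contDiffAt_covD (hG : MetricAt G (F z)) (hF : ContDiffAt ℝ ∞ F z) {U : X → Fin n → ℝ}
    (hU : ∀ k, ContDiffAt ℝ ∞ (fun x => U x k) z) (v : X) (k : Fin n) :
    ContDiffAt ℝ ∞ (fun x => covD G F v U x k) z :=
  (contDiffAt_dd (hU k) v).add (contDiffAt_chr hG hF (contDiffAt_dvec hF v) hU k)

theorem contDiffAt_ip (hG : MetricAt G (F z)) (hF : ContDiffAt ℝ ∞ F z) {U W : X → Fin n → ℝ}
    (hU : ∀ k, ContDiffAt ℝ ∞ (fun x => U x k) z) (hW : ∀ k, ContDiffAt ℝ ∞ (fun x => W x k) z) :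
    ContDiffAt ℝ ∞ (fun x => ip (G (F x)) (U x) (W x)) z :=
  ContDiffAt.sum fun i _ => ContDiffAt.sum fun j _ =>
    ((ContDiffAt.comp (g := fun p => G p i j) z (hG.smooth i j) hF).mul (hU i)).mul (hW j)

/-- The Levi-Civita connection is torsion free. -/
theorem covD_dvec_comm (hG : ∀ z i j, G z i j = G z j i) (hF : ContDiffAt ℝ ∞ F z) (v w : X) :
    covD G F v (dvec w F) z = covD G F w (dvec v F) z := by
  funext k
  simp only [covD]
  rw [chr_symm hG]
  congr 1
  exact dd_comm (coord_contDiffAt hF k) v w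

/-- The curvature is the commutator of covariant derivatives. -/
theorem covD_covD (hG : MetricAt G (F z)) (hF : ContDiffAt ℝ ∞ F z) {U : X → Fin n → ℝ}
    (hU : ∀ k, ContDiffAt ℝ ∞ (fun x => U x k) z) (v w : X) :
    covD G F v (covD G F w U) z - covD G F w (covD G F v U) z
      = riemV G (F z) (dvec v F z) (dvec w F z) (U z) := by
  -- All terms but the last sum are symmetric in v and w: second derivatives of U and F commute, and
  -- the two mixed terms change places. Only the last sum survives antisymmetrization, as the
  -- curvature.
  have key : ∀ (v w : X) (k : Fin n), covD G F v (covD G F w U) z k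
      = dd v (dd w (fun x => U x k)) z
        + (∑ i, ∑ j, christoffel G k i j (F z) * dd v (fun x => dvec w F x i) z * U z j)
        + (chr G (F z) (dvec w F z) (fun j => dd v (fun x => U x j) z) k
          + chr G (F z) (dvec v F z) (fun j => dd w (fun x => U x j) z) k)
        + ∑ l, ∑ i, ∑ j, (pd i (christoffel G k j l) (F z)
          + ∑ s, christoffel G k i s (F z) * christoffel G s j l (F z))
            * U z l * dvec v F z i * dvec w F z j := by
    intro v w k
    have hc : ∀ i j, ContDiffAt ℝ ∞ (fun x => christoffel G k i j (F x)) z := fun i j =>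
      ContDiffAt.comp (g := christoffel G k i j) z (hG.contDiffAt_christoffel k i j) hF
    have h1 : dd v (fun x => covD G F w U x k) z = dd v (dd w (fun x => U x k)) z
        + ∑ i, ∑ j, ((∑ s, pd s (christoffel G k i j) (F z) * dvec v F z s) * dvec w F z i * U z j
          + christoffel G k i j (F z) * dd v (fun x => dvec w F x i) z * U z j
          + christoffel G k i j (F z) * dvec w F z i * dd v (fun x => U x j) z) := by
      simp only [covD]
      rw [dd_add (diffAt (contDiffAt_dd (hU k) w))
        (diffAt (contDiffAt_chr hG hF (contDiffAt_dvec hF w) hU k))]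
      congr 1
      simp only [chr]
      rw [dd_sum _ fun i _ => diffAt (ContDiffAt.sum fun j _ =>
        ((hc i j).mul (contDiffAt_dvec hF w i)).mul (hU j))]
      refine Finset.sum_congr rfl fun i _ => ?_
      rw [dd_sum _ fun j _ => diffAt (((hc i j).mul (contDiffAt_dvec hF w i)).mul (hU j))]
      refine Finset.sum_congr rfl fun j _ => ?_
      rw [dd_mul (diffAt ((hc i j).mul (contDiffAt_dvec hF w i))) (diffAt (hU j)),
        dd_mul (diffAt (hc i j)) (diffAt (contDiffAt_dvec hF w i)),
        dd_comp (diffAt (hG.contDiffAt_christoffel k i j)) (hF.differentiableAt (by simp))]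
      simp only [dvec]
      ring
    have h2 : covD G F w U z = (fun j => dd w (fun x => U x j) z)
      + chr G (F z) (dvec w F z) (U z) := rfl
    have h3 : covD G F v (covD G F w U) z k = dd v (fun x => covD G F w U x k) z
      + chr G (F z) (dvec v F z) (covD G F w U z) k := rfl
    have h4 : chr G (F z) (dvec v F z) (chr G (F z) (dvec w F z) (U z)) k
        = ∑ l, ∑ i, ∑ j, (∑ s, christoffel G k i s (F z) * christoffel G s j l (F z))
            * U z l * dvec v F z i * dvec w F z j := by
      simp only [chr, Finset.mul_sum, Finset.sum_mul]
      rw [Finset.sum_comm (γ := Fin n)]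
      rw [Finset.sum_comm]
      conv_rhs => rw [Finset.sum_comm]
      refine Finset.sum_congr rfl fun i _ => ?_
      rw [Finset.sum_comm]
      conv_lhs => enter [2, j]; rw [Finset.sum_comm]
      rw [Finset.sum_comm]
      refine Finset.sum_congr rfl fun l _ => Finset.sum_congr rfl fun j _ =>
        Finset.sum_congr rfl fun s _ => by ring
    have h5 : ∑ i, ∑ j, (∑ s, pd s (christoffel G k i j) (F z) * dvec v F z s) * dvec w F z i * U z j
        = ∑ l, ∑ i, ∑ j, pd i (christoffel G k j l) (F z) * U z l * dvec v F z i * dvec w F z j := by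
      simp only [Finset.sum_mul]
      rw [Finset.sum_comm]
      refine Finset.sum_congr rfl fun l _ => ?_
      rw [Finset.sum_comm]
      exact Finset.sum_congr rfl fun i _ => Finset.sum_congr rfl fun j _ => by ring
    rw [h3, h1, h2, chr_add_right, Pi.add_apply, h4]
    simp only [Finset.sum_add_distrib, h5, add_mul]
    simp only [chr]
    ring
  funext k
  rw [Pi.sub_apply, key v w k, key w v k, dd_comm (hU k) v w]
  have hs : ∀ i, dd v (fun x => dvec w F x i) z = dd w (fun x => dvec v F x i) z := fun i =>
    dd_comm (coord_contDiffAt hF i) v w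
  simp only [hs, riemV, riem]
  have h6 : ∑ l, ∑ i, ∑ j, (pd i (christoffel G k j l) (F z)
          + ∑ s, christoffel G k i s (F z) * christoffel G s j l (F z))
            * U z l * dvec w F z i * dvec v F z j
      = ∑ l, ∑ i, ∑ j, (pd j (christoffel G k i l) (F z)
          + ∑ s, christoffel G k j s (F z) * christoffel G s i l (F z))
            * U z l * dvec v F z i * dvec w F z j := by
    refine Finset.sum_congr rfl fun l _ => ?_
    rw [Finset.sum_comm]
    exact Finset.sum_congr rfl fun i _ => Finset.sum_congr rfl fun j _ => by ring
  rw [h6]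
  simp only [Finset.sum_sub_distrib, sub_mul, add_mul, Finset.sum_add_distrib]
  ring

end Cov

/-! ### Frames -/

section Frames

variable {n m : ℕ} {A : Matrix (Fin n) (Fin n) ℝ}

theorem sum_comm_pairs {α β : Type*} [Fintype α] [Fintype β] (f : α → α → β → β → ℝ) :
    ∑ a, ∑ b, ∑ i, ∑ j, f a b i j = ∑ i, ∑ j, ∑ a, ∑ b, f a b i j := by
  calc ∑ a, ∑ b, ∑ i, ∑ j, f a b i j = ∑ a, ∑ i, ∑ j, ∑ b, f a b i j :=
        Finset.sum_congr rfl fun a _ => by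
          rw [Finset.sum_comm]; exact Finset.sum_congr rfl fun i _ => Finset.sum_comm
    _ = _ := by
        rw [Finset.sum_comm]; exact Finset.sum_congr rfl fun i _ => Finset.sum_comm

/-- The Gram matrix of a family of vectors. -/
def gramOf {κ : Type*} (A : Matrix (Fin n) (Fin n) ℝ) (T : κ → Fin n → ℝ) : Matrix κ κ ℝ :=
  Matrix.of fun a b => ip A (T a) (T b)

theorem gramOf_eq {κ : Type*} (T : κ → Fin n → ℝ) :
    gramOf A T = Matrix.of T * A * (Matrix.of T).transpose := by
  ext a b
  simp only [gramOf, Matrix.of_apply, ip, Matrix.mul_apply, Matrix.transpose_apply, Finset.sum_mul]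
  rw [Finset.sum_comm]
  exact Finset.sum_congr rfl fun k _ => Finset.sum_congr rfl fun l _ => by ring

/-- For a square array T the relation (T A Tᵀ)⁻¹ (T A Tᵀ) = 1 exhibits an inverse of Tᵀ. The index
type is arbitrary of cardinality n so that a tangential frame can be completed by a normal, with
index type `Fin m ⊕ Unit`. -/
theorem inv_of_gramOf {κ : Type*} [Fintype κ] [DecidableEq κ] (hκ : Fintype.card κ = n)
    (T : κ → Fin n → ℝ) (hT : (gramOf A T).det ≠ 0) :
    A⁻¹ = (Matrix.of T).transpose * (gramOf A T)⁻¹ * Matrix.of T := by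
  have h1 : (gramOf A T)⁻¹ * gramOf A T = 1 :=
    Matrix.nonsing_inv_mul _ (isUnit_iff_ne_zero.2 hT)
  rw [gramOf_eq] at h1
  have h2 : ((gramOf A T)⁻¹ * Matrix.of T * A) * (Matrix.of T).transpose = 1 := by
    rw [← h1, gramOf_eq]; simp only [Matrix.mul_assoc]
  have h3 : (Matrix.of T).transpose * ((gramOf A T)⁻¹ * Matrix.of T * A) = 1 :=
    (Matrix.mul_eq_one_comm_of_card_eq κ (Fin n) ℝ (by simp [hκ])).1 h2
  refine Matrix.inv_eq_left_inv ?_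
  rw [← h3]; simp only [Matrix.mul_assoc]

/-- The Gram matrix of the frame T₁, …, T_m, N is block diagonal, so the inverse metric is the sum
of a tangential part and N ⊗ N. -/
theorem inv_frame_normal (T : Fin m → Fin (m + 1) → ℝ) {A : Matrix (Fin (m + 1)) (Fin (m + 1)) ℝ}
    (hA : ∀ i j, A i j = A j i) (hT : (gramOf A T).det ≠ 0) (N : Fin (m + 1) → ℝ)
    (hN : ip A N N = 1) (hNT : ∀ a, ip A N (T a) = 0) (i j : Fin (m + 1)) :
    ∑ a, ∑ b, (gramOf A T)⁻¹ a b * (T a i * T b j) = A⁻¹ i j - N i * N j := by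
  have hg : gramOf A (Sum.elim T fun _ : Unit => N) = Matrix.fromBlocks (gramOf A T) 0 0 1 := by
    ext (a | a) (b | b)
    · simp [gramOf]
    · simp [gramOf, ip_comm hA, hNT]
    · simp [gramOf, hNT]
    · simp [gramOf, hN]
  have hu : IsUnit (gramOf A T).det := isUnit_iff_ne_zero.2 hT
  have hinv : (Matrix.fromBlocks (gramOf A T) 0 0 (1 : Matrix Unit Unit ℝ))⁻¹
      = Matrix.fromBlocks (gramOf A T)⁻¹ 0 0 1 := by
    refine Matrix.inv_eq_left_inv ?_
    rw [Matrix.fromBlocks_multiply]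
    simp [Matrix.nonsing_inv_mul _ hu]
  have h := inv_of_gramOf (A := A) (by simp) (Sum.elim T fun _ : Unit => N) (by
    rw [hg, Matrix.det_fromBlocks_zero₂₁]; simpa using hT)
  rw [h, hg, hinv]
  simp only [Matrix.mul_apply, Matrix.transpose_apply, Matrix.of_apply, Fintype.sum_sum_type,
    Sum.elim_inl, Sum.elim_inr, Matrix.fromBlocks_apply₁₁, Matrix.fromBlocks_apply₁₂,
    Matrix.fromBlocks_apply₂₁, Matrix.fromBlocks_apply₂₂]
  simp only [Matrix.zero_apply, Matrix.one_apply_eq, mul_zero, Finset.sum_const_zero,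
    add_zero, Finset.univ_unique, Finset.sum_singleton, zero_add, mul_one,
    add_sub_cancel_right, Finset.sum_mul]
  rw [Finset.sum_comm]
  exact Finset.sum_congr rfl fun a _ => Finset.sum_congr rfl fun b _ => by ring

/-- Contraction of a bilinear expression with the inverse Gram matrix of the tangential frame. -/
theorem trace_frame_normal (T : Fin m → Fin (m + 1) → ℝ)
    {A : Matrix (Fin (m + 1)) (Fin (m + 1)) ℝ}
    (hA : ∀ i j, A i j = A j i) (hT : (gramOf A T).det ≠ 0) (N : Fin (m + 1) → ℝ)
    (hN : ip A N N = 1) (hNT : ∀ a, ip A N (T a) = 0)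
    (L : (Fin (m + 1) → ℝ) →ₗ[ℝ] (Fin (m + 1) → ℝ) →ₗ[ℝ] ℝ) :
    ∑ a, ∑ b, (gramOf A T)⁻¹ a b * L (T a) (T b)
      = ∑ i, ∑ j, A⁻¹ i j * L (Pi.single i 1) (Pi.single j 1) - L N N := by
  have hL : ∀ u w, L u w = ∑ i, ∑ j, (u i * w j) * L (Pi.single i 1) (Pi.single j 1) := by
    intro u w
    have hs : ∀ u : Fin (m + 1) → ℝ, u = ∑ i, u i • Pi.single i (1 : ℝ) := fun u => by
      funext j; simp [Finset.sum_apply, Pi.single_apply]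
    conv_lhs => rw [hs u, hs w]
    simp only [map_sum, LinearMap.sum_apply, map_smul, LinearMap.smul_apply, smul_eq_mul]
    simp only [Finset.mul_sum]
    rw [Finset.sum_comm]
    exact Finset.sum_congr rfl fun i _ => Finset.sum_congr rfl fun j _ => by ring
  have h := inv_frame_normal T hA hT N hN hNT
  calc ∑ a, ∑ b, (gramOf A T)⁻¹ a b * L (T a) (T b)
      = ∑ i, ∑ j, (∑ a, ∑ b, (gramOf A T)⁻¹ a b * (T a i * T b j))
          * L (Pi.single i 1) (Pi.single j 1) := by
        simp only [hL (T _) (T _), Finset.mul_sum, Finset.sum_mul]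
        rw [sum_comm_pairs]
        exact Finset.sum_congr rfl fun i _ => Finset.sum_congr rfl fun j _ =>
          Finset.sum_congr rfl fun a _ => Finset.sum_congr rfl fun b _ => by ring
    _ = _ := by
        simp only [h, sub_mul, Finset.sum_sub_distrib]
        rw [hL N N]

/-- The Gram matrix T A Tᵀ can be invertible only if A Tᵀ is, and the hypothesis on v says that v
annihilates A Tᵀ. -/
theorem eq_zero_of_ip_frame (T : Fin n → Fin n → ℝ)
    (hT : (gramOf A T).det ≠ 0) (v : Fin n → ℝ) (hv : ∀ a, ip A v (T a) = 0) : v = 0 := by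
  rw [gramOf_eq] at hT
  have hT' : IsUnit (A * (Matrix.of T).transpose).det := by
    rw [isUnit_iff_ne_zero]
    rw [Matrix.mul_assoc, Matrix.det_mul] at hT
    exact right_ne_zero_of_mul hT
  have h0 : Matrix.vecMul v (A * (Matrix.of T).transpose) = 0 := by
    funext a
    have := hv a
    rw [ip_eq_mulVec] at this
    rw [← Matrix.vecMul_vecMul, Matrix.dotProduct_mulVec] at *
    simpa [Matrix.vecMul, dotProduct] using this
  have := congrArg (fun w => Matrix.vecMul w (A * (Matrix.of T).transpose)⁻¹) h0
  simpa [Matrix.vecMul_vecMul, Matrix.mul_nonsing_inv _ hT'] using this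

end Frames

/-! ### Induced metrics -/

section Induced

variable {X : Type*} [NormedAddCommGroup X] [NormedSpace ℝ X] {n m : ℕ}
  {G : E n → Matrix (Fin n) (Fin n) ℝ}

/-- The `a`-th standard basis vector. -/
abbrev ev {d : ℕ} (a : Fin d) : E d := EuclideanSpace.single a 1

/-- The metric induced by the map `F`. -/
def indMetric (G : E n → Matrix (Fin n) (Fin n) ℝ) (F : E m → E n) (y : E m) :
    Matrix (Fin m) (Fin m) ℝ :=
  gramOf (G (F y)) fun a => dvec (ev a) F y

theorem indMetric_metricAt {F : E m → E n} {y : E m} (hG : MetricAt G (F y))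
    (hF : ContDiffAt ℝ ∞ F y) (hd : (indMetric G F y).det ≠ 0) : MetricAt (indMetric G F) y where
  smooth a b := contDiffAt_ip hG hF (contDiffAt_dvec hF (ev a)) (contDiffAt_dvec hF (ev b))
  symm _ _ _ := ip_comm (hG.symm _) _ _
  det := hd

/-- The Koszul formula. -/
theorem ip_covD_dvec {F : E m → E n} {y : E m} (hG : MetricAt G (F y))
    (hF : ContDiffAt ℝ ∞ F y) (hd : (indMetric G F y).det ≠ 0) (a b c : Fin m) :
    ip (G (F y)) (covD G F (ev a) (dvec (ev b) F) y) (dvec (ev c) F y)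
      = ∑ e, indMetric G F y c e * christoffel (indMetric G F) e a b y := by
  rw [(indMetric_metricAt hG hF hd).lower]
  have h : ∀ a b c : Fin m, pd a (fun z => indMetric G F z b c) y
      = ip (G (F y)) (covD G F (ev a) (dvec (ev b) F) y) (dvec (ev c) F y)
        + ip (G (F y)) (covD G F (ev a) (dvec (ev c) F) y) (dvec (ev b) F y) := by
    intro a b c
    rw [ip_comm (hG.symm _) (covD G F (ev a) (dvec (ev c) F) y)]
    exact dd_ip hG hF (contDiffAt_dvec hF (ev b)) (contDiffAt_dvec hF (ev c)) (ev a)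
  -- Metric compatibility gives six terms. By torsion-freeness four of them cancel and the other two
  -- coincide.
  rw [h, h, h, covD_dvec_comm hG.symm hF (ev c) (ev a), covD_dvec_comm hG.symm hF (ev c) (ev b),
    covD_dvec_comm hG.symm hF (ev b) (ev a)]
  ring

/-- The transformation law of the Christoffel symbols. -/
theorem covD_dvec_eq {τ : E n → E n} {p : E n} (hG : MetricAt G (τ p)) (hτ : ContDiffAt ℝ ∞ τ p)
    (hd : (indMetric G τ p).det ≠ 0) (a b : Fin n) :
    covD G τ (ev a) (dvec (ev b) τ) p
      = ∑ c, christoffel (indMetric G τ) c a b p • dvec (ev c) τ p := by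
  rw [← sub_eq_zero]
  refine eq_zero_of_ip_frame _ hd _ fun c => ?_
  rw [sub_eq_add_neg, ip_add_left, ip_covD_dvec hG hτ hd, ← neg_one_smul ℝ, ip_smul_left,
    ip_sum_left]
  have : ∀ e, ip (G (τ p)) (christoffel (indMetric G τ) e a b p • dvec (ev e) τ p) (dvec (ev c) τ p)
      = indMetric G τ p c e * christoffel (indMetric G τ) e a b p := fun e => by
    rw [ip_smul_left, mul_comm, ip_comm (hG.symm _)]; rfl
  simp only [this]; ring

theorem covD_apply (F : X → E n) (v : X) (U : X → Fin n → ℝ) (x : X) (k : Fin n) :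
    covD G F v U x k = dd v (fun x => U x k) x + chr G (F x) (dvec v F x) (U x) k := rfl

theorem chr_sum_left (p : E n) (u : Fin n → Fin n → ℝ) (w : Fin n → ℝ) :
    chr G p (∑ j, u j) w = ∑ j, chr G p (u j) w :=
  map_sum (⟨⟨fun v => chr G p v w, fun _ _ => chr_add_left _ _ _ _ _⟩,
    fun _ _ => chr_smul_left _ _ _ _⟩ : (Fin n → ℝ) →ₗ[ℝ] (Fin n → ℝ)) u _

theorem chr_sum_right (p : E n) (u : Fin n → Fin n → ℝ) (w : Fin n → ℝ) :
    chr G p w (∑ j, u j) = ∑ j, chr G p w (u j) :=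
  map_sum (⟨⟨fun v => chr G p w v, fun _ _ => chr_add_right _ _ _ _ _⟩,
    fun _ _ => chr_smul_right _ _ _ _ _⟩ : (Fin n → ℝ) →ₗ[ℝ] (Fin n → ℝ)) u _

/-- Covariant derivatives are natural under isometries. -/
theorem covD_comp {τ : E n → E n} {F : X → E n} {x : X} (hG : MetricAt G (τ (F x)))
    (hτ : ContDiffAt ℝ ∞ τ (F x)) (hF : ContDiffAt ℝ ∞ F x)
    (hd : (indMetric G τ (F x)).det ≠ 0) {U : X → Fin n → ℝ}
    (hU : ∀ k, ContDiffAt ℝ ∞ (fun x => U x k) x) (v : X) :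
    covD G (fun x => τ (F x)) v (fun x => ∑ i, U x i • dvec (ev i) τ (F x)) x
      = ∑ i, covD (indMetric G τ) F v U x i • dvec (ev i) τ (F x) := by
  have hdτ : ∀ i k, ContDiffAt ℝ ∞ (fun x => dvec (ev i) τ (F x) k) x := fun i k =>
    ContDiffAt.comp (g := fun p => dvec (ev i) τ p k) x (contDiffAt_dvec hτ (ev i) k) hF
  have h1 : ∀ k, dd v (fun x => (∑ i, U x i • dvec (ev i) τ (F x)) k) x
      = ∑ i, (dd v (fun x => U x i) x * dvec (ev i) τ (F x) k
        + U x i * ∑ j, dd (ev j) (fun p => dvec (ev i) τ p k) (F x) * dvec v F x j) := by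
    intro k
    simp only [Finset.sum_apply, Pi.smul_apply, smul_eq_mul]
    rw [dd_sum _ fun i _ => diffAt ((hU i).mul (hdτ i k))]
    refine Finset.sum_congr rfl fun i _ => ?_
    rw [dd_mul (diffAt (hU i)) (diffAt (hdτ i k)),
      dd_comp (f := fun p => dvec (ev i) τ p k) (diffAt (contDiffAt_dvec hτ (ev i) k))
        (hF.differentiableAt (by simp))]
    rfl
  have h2 : dvec v (fun x => τ (F x)) x = ∑ j, dvec v F x j • dvec (ev j) τ (F x) := by
    funext k
    simp only [dvec]
    rw [dd_comp (f := fun p => τ p k) (diffAt (coord_contDiffAt hτ k))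
      (hF.differentiableAt (by simp))]
    simp only [Finset.sum_apply, Pi.smul_apply, smul_eq_mul]
    exact Finset.sum_congr rfl fun j _ => by rw [mul_comm]; rfl
  -- The covariant derivative of the pushed-forward coordinate frame is given by the transformation
  -- law `covD_dvec_eq`.
  have h3 : ∀ i j k, dd (ev j) (fun p => dvec (ev i) τ p k) (F x)
      + chr G (τ (F x)) (dvec (ev j) τ (F x)) (dvec (ev i) τ (F x)) k
      = ∑ c, christoffel (indMetric G τ) c j i (F x) * dvec (ev c) τ (F x) k := by
    intro i j k
    have := congrFun (covD_dvec_eq hG hτ hd j i) k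
    simp only [Finset.sum_apply, Pi.smul_apply, smul_eq_mul] at this
    exact this
  funext k
  have h4 : chr G (τ (F x)) (dvec v (fun x => τ (F x)) x) (∑ i, U x i • dvec (ev i) τ (F x)) k
      = ∑ i, ∑ j, U x i * (dvec v F x j *
          chr G (τ (F x)) (dvec (ev j) τ (F x)) (dvec (ev i) τ (F x)) k) := by
    rw [h2, chr_sum_right]
    simp only [chr_sum_left, chr_smul_left, chr_smul_right, Finset.sum_apply, Pi.smul_apply, smul_eq_mul,
      Finset.mul_sum]
  rw [covD_apply]
  rw [h1, h4, ← Finset.sum_add_distrib]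
  have h5 : ∀ i, (dd v (fun x => U x i) x * dvec (ev i) τ (F x) k
        + U x i * ∑ j, dd (ev j) (fun p => dvec (ev i) τ p k) (F x) * dvec v F x j)
      + ∑ j, U x i * (dvec v F x j *
          chr G (τ (F x)) (dvec (ev j) τ (F x)) (dvec (ev i) τ (F x)) k)
      = dd v (fun x => U x i) x * dvec (ev i) τ (F x) k
        + ∑ j, ∑ c, christoffel (indMetric G τ) c j i (F x) * dvec v F x j * U x i
          * dvec (ev c) τ (F x) k := by
    intro i
    rw [add_assoc, Finset.mul_sum, ← Finset.sum_add_distrib]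
    congr 1
    refine Finset.sum_congr rfl fun j _ => ?_
    calc _ = (U x i * dvec v F x j) * (dd (ev j) (fun p => dvec (ev i) τ p k) (F x)
      + chr G (τ (F x)) (dvec (ev j) τ (F x)) (dvec (ev i) τ (F x)) k) := by ring
      _ = _ := by
        rw [h3, Finset.mul_sum]
        exact Finset.sum_congr rfl fun c _ => by ring
  rw [Finset.sum_congr rfl fun i _ => h5 i]
  have h6 : ∀ Γ : Fin n → Fin n → Fin n → ℝ, ∀ u w s : Fin n → ℝ,
      ∑ i, ∑ j, ∑ c, Γ c j i * u j * w i * s c = ∑ c, (∑ i, ∑ j, Γ c i j * u i * w j) * s c := by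
    intro Γ u w s
    simp only [Finset.sum_mul]
    rw [Finset.sum_comm]
    conv_rhs => rw [Finset.sum_comm]
    refine Finset.sum_congr rfl fun j _ => ?_
    rw [Finset.sum_comm]
  rw [Finset.sum_add_distrib, h6 (fun c j i => christoffel (indMetric G τ) c j i (F x)) (dvec v F x)
    (U x) (fun c => dvec (ev c) τ (F x) k), ← Finset.sum_add_distrib]
  simp only [Finset.sum_apply, Pi.smul_apply, smul_eq_mul, covD_apply, add_mul]
  rfl

/-- Skew symmetry of the curvature with respect to the metric. -/
theorem ip_riemV {p : E n} (hG : ∀ᶠ q in nhds p, MetricAt G q) (v w u u' : Fin n → ℝ) :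
    ip (G p) (riemV G p v w u) u' = - ip (G p) (riemV G p v w u') u := by
  have hid : ∀ q : E n, ContDiffAt ℝ ∞ (fun x : E n => x) q := fun q => contDiffAt_id
  have hc : ∀ (u : Fin n → ℝ) (q : E n) (k : Fin n), ContDiffAt ℝ ∞ (fun _ : E n => u k) q :=
    fun u q k => contDiffAt_const
  have hdv : ∀ (v : Fin n → ℝ), dvec (WithLp.toLp 2 v : E n) (fun x : E n => x) p = v := by
    intro v; funext i
    simp only [dvec]
    rw [dd_coord (F := fun x : E n => x) differentiableAt_id]
    simp
  set V : E n := WithLp.toLp 2 v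
  set W : E n := WithLp.toLp 2 w
  set I : E n → E n := fun x => x with hI
  have hGp := hG.self_of_nhds
  -- The function ⟨u, u'⟩, with u and u' constant vectors regarded as fields along the identity map,
  -- is differentiated twice. The mixed products are symmetric in V and W, so equality of second
  -- derivatives leaves the two curvature terms with sum zero.
  have key : ∀ V W : E n, dd V (dd W fun x => ip (G (I x)) ((fun _ => u) x) ((fun _ => u') x)) p
      = ip (G p) (covD G I V (covD G I W fun _ => u) p) u'
        + ip (G p) (covD G I W (fun _ => u) p) (covD G I V (fun _ => u') p)
        + (ip (G p) (covD G I V (fun _ => u) p) (covD G I W (fun _ => u') p)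
        + ip (G p) u (covD G I V (covD G I W fun _ => u') p)) := by
    intro V W
    have h1 : dd W (fun x => ip (G (I x)) ((fun _ => u) x) ((fun _ => u') x)) =ᶠ[nhds p] fun x =>
        ip (G (I x)) (covD G I W (fun _ => u) x) ((fun _ => u') x)
          + ip (G (I x)) ((fun _ => u) x) (covD G I W (fun _ => u') x) := by
      filter_upwards [hG] with q hq
      exact dd_ip (F := I) hq (hid q) (hc u q) (hc u' q) W
    have hD : ∀ u : Fin n → ℝ, ∀ k, ContDiffAt ℝ ∞ (fun x => covD G I W (fun _ => u) x k) p :=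
      fun u => contDiffAt_covD (F := I) hGp (hid p) (hc u p) W
    rw [dd_congr h1, dd_add (diffAt (contDiffAt_ip (F := I) hGp (hid p) (hD u) (hc u' p)))
      (diffAt (contDiffAt_ip (F := I) hGp (hid p) (hc u p) (hD u'))),
      dd_ip (F := I) hGp (hid p) (hD u) (hc u' p), dd_ip (F := I) hGp (hid p) (hc u p) (hD u')]
  have hs := dd_comm (contDiffAt_ip (F := I) hGp (hid p) (hc u p) (hc u' p)) V W
  rw [key, key] at hs
  have r1 := covD_covD (F := I) hGp (hid p) (hc u p) V W
  have r2 := covD_covD (F := I) hGp (hid p) (hc u' p) V W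
  rw [hdv, hdv] at r1 r2
  change _ = riemV G p v w u at r1
  change _ = riemV G p v w u' at r2
  rw [← r1, ← r2, sub_eq_add_neg, sub_eq_add_neg, ip_add_left, ip_add_left, ← neg_one_smul ℝ,
    ← neg_one_smul ℝ (covD G I W (covD G I V fun _ => u') p), ip_smul_left, ip_smul_left]
  rw [ip_comm (hGp.symm p) (covD G I V (covD G I W fun _ => u') p) u,
    ip_comm (hGp.symm p) (covD G I W (covD G I V fun _ => u') p) u]
  linarith

end Induced

/-! ### Hypersurfaces in coordinates -/

section Hyper

variable {n m : ℕ}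

theorem riem_swap (G : E n → Matrix (Fin n) (Fin n) ℝ) (p : E n) (k l i j : Fin n) :
    riem G p k l i j = - riem G p k l j i := by
  simp only [riem, Finset.sum_sub_distrib]; ring

theorem riemV_swap (G : E n → Matrix (Fin n) (Fin n) ℝ) (p : E n) (v w u : Fin n → ℝ) :
    riemV G p v w u = - riemV G p w v u := by
  funext k
  simp only [riemV, Pi.neg_apply, ← Finset.sum_neg_distrib]
  refine Finset.sum_congr rfl fun l _ => ?_
  rw [Finset.sum_comm]
  exact Finset.sum_congr rfl fun i _ => Finset.sum_congr rfl fun j _ => by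
    rw [riem_swap]; ring

/-- Links the coordinate formula with the curvature as a commutator; in particular it fixes which
indices of `riem` are contracted, hence the sign. -/
theorem ricciCoord_eq {G : E n → Matrix (Fin n) (Fin n) ℝ} (hG : ∀ z i j, G z i j = G z j i)
    (p : E n) (i j : Fin n) : ricciCoord G i j p = ∑ k, riem G p k i k j := by
  have hs : ∀ k i j, christoffel G k i j = christoffel G k j i := fun k i j =>
    funext fun y => christoffel_symm hG k i j y
  simp only [ricciCoord, riem, Finset.sum_add_distrib]
  congr 1
  · exact Finset.sum_congr rfl fun k _ => by rw [hs k i j, hs k i k]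
  · exact Finset.sum_congr rfl fun k _ => Finset.sum_congr rfl fun l _ => by
      rw [hs l i j, hs l i k]

/-- The Ricci form `Ric(u, w)`. -/
def ric (G : E n → Matrix (Fin n) (Fin n) ℝ) (p : E n) (u w : Fin n → ℝ) : ℝ :=
  ip (Matrix.of fun i j => ricciCoord G i j p) u w

theorem riemV_add (G : E n → Matrix (Fin n) (Fin n) ℝ) (p : E n) (v v' w u : Fin n → ℝ) :
    riemV G p (v + v') w u = riemV G p v w u + riemV G p v' w u := by
  funext k
  simp only [riemV, Pi.add_apply, mul_add, add_mul, Finset.sum_add_distrib]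

theorem riemV_smul (G : E n → Matrix (Fin n) (Fin n) ℝ) (p : E n) (c : ℝ) (v w u : Fin n → ℝ) :
    riemV G p (c • v) w u = c • riemV G p v w u := by
  funext k
  simp only [riemV, Pi.smul_apply, smul_eq_mul, Finset.mul_sum]
  exact Finset.sum_congr rfl fun l _ => Finset.sum_congr rfl fun i _ =>
    Finset.sum_congr rfl fun j _ => by ring

theorem riemV_smul_right (G : E n → Matrix (Fin n) (Fin n) ℝ) (p : E n) (c : ℝ)
    (v w u : Fin n → ℝ) : riemV G p v w (c • u) = c • riemV G p v w u := by
  funext k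
  simp only [riemV, Pi.smul_apply, smul_eq_mul, Finset.mul_sum]
  exact Finset.sum_congr rfl fun l _ => Finset.sum_congr rfl fun i _ =>
    Finset.sum_congr rfl fun j _ => by ring

theorem ip_neg_left (A : Matrix (Fin n) (Fin n) ℝ) (u w : Fin n → ℝ) :
    ip A (-u) w = - ip A u w := by
  rw [← neg_one_smul ℝ, ip_smul_left]; ring

/-- The bilinear form `(x, x') ↦ ⟨R(x, w)u, x'⟩`. -/
def riemL (G : E n → Matrix (Fin n) (Fin n) ℝ) (p : E n) (w u : Fin n → ℝ) :
    (Fin n → ℝ) →ₗ[ℝ] (Fin n → ℝ) →ₗ[ℝ] ℝ :=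
  LinearMap.mk₂ ℝ (fun x x' => ip (G p) (riemV G p x w u) x')
    (fun x y x' => by rw [riemV_add, ip_add_left]) (fun c x x' => by rw [riemV_smul, ip_smul_left]; rfl)
    (fun x y y' => ip_add_right _ _ _ _) (fun c x x' => ip_smul_right _ _ _ _)

/-- Ric(u, w) is the trace of the endomorphism x ↦ R(x, w)u; lowering an index with the metric and
raising it again changes nothing. -/
theorem riemL_trace {G : E n → Matrix (Fin n) (Fin n) ℝ} {p : E n} (hG : MetricAt G p)
    (w u : Fin n → ℝ) :
    ∑ i, ∑ j, (G p)⁻¹ i j * riemL G p w u (Pi.single i 1) (Pi.single j 1) = ric G p u w := by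
  have h1 : ∀ i k, riemV G p (Pi.single i 1) w u k = ∑ l, ∑ j, riem G p k l i j * u l * w j := by
    intro i k
    simp [riemV, Pi.single_apply]
  have h2 : ∀ i, ∑ j, (G p)⁻¹ i j * riemL G p w u (Pi.single i 1) (Pi.single j 1)
      = riemV G p (Pi.single i 1) w u i := by
    intro i
    have h3 : ∀ j, riemL G p w u (Pi.single i 1) (Pi.single j 1)
        = (G p).mulVec (riemV G p (Pi.single i 1) w u) j := by
      intro j
      change ip _ _ _ = _
      rw [ip_single_right]
      exact Finset.sum_congr rfl fun k _ => by rw [hG.symm]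
    have h4 : (G p)⁻¹.mulVec ((G p).mulVec (riemV G p (Pi.single i 1) w u))
        = riemV G p (Pi.single i 1) w u := by
      rw [Matrix.mulVec_mulVec, hG.inv_mul, Matrix.one_mulVec]
    simp only [h3]
    exact congrFun h4 i
  simp only [h2, h1, ric, ip, Matrix.of_apply, ricciCoord_eq hG.symm, Finset.sum_mul]
  rw [Finset.sum_comm]
  exact Finset.sum_congr rfl fun l _ => Finset.sum_comm

variable {G : E (m + 1) → Matrix (Fin (m + 1)) (Fin (m + 1)) ℝ} {F : E m → E (m + 1)}
  {N : E m → Fin (m + 1) → ℝ} {y : E m}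

/-- At the point `y`, the map `F` is a hypersurface immersion with unit normal `N`. -/
structure HyperAt (G : E (m + 1) → Matrix (Fin (m + 1)) (Fin (m + 1)) ℝ) (F : E m → E (m + 1))
    (N : E m → Fin (m + 1) → ℝ) (y : E m) : Prop where
  metric : MetricAt G (F y)
  map : ContDiffAt ℝ ∞ F y
  normal_smooth : ∀ k, ContDiffAt ℝ ∞ (fun y => N y k) y
  unit : ip (G (F y)) (N y) (N y) = 1
  normal : ∀ a, ip (G (F y)) (N y) (dvec (ev a) F y) = 0
  det : (indMetric G F y).det ≠ 0

/-- The second fundamental form `⟨D_a N, F_b⟩`. -/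
def sff (G : E (m + 1) → Matrix (Fin (m + 1)) (Fin (m + 1)) ℝ) (F : E m → E (m + 1))
    (N : E m → Fin (m + 1) → ℝ) (y : E m) (a b : Fin m) : ℝ :=
  ip (G (F y)) (covD G F (ev a) N y) (dvec (ev b) F y)

theorem HyperAt.induced (h : HyperAt G F N y) : MetricAt (indMetric G F) y :=
  indMetric_metricAt h.metric h.map h.det

/-- The device behind all contractions below: a trace over the tangent space is the ambient trace
minus the entry at the normal. -/
theorem HyperAt.trace (h : HyperAt G F N y)
    (L : (Fin (m + 1) → ℝ) →ₗ[ℝ] (Fin (m + 1) → ℝ) →ₗ[ℝ] ℝ) :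
    ∑ a, ∑ b, (indMetric G F y)⁻¹ a b * L (dvec (ev a) F y) (dvec (ev b) F y)
      = ∑ i, ∑ j, (G (F y))⁻¹ i j * L (Pi.single i 1) (Pi.single j 1) - L (N y) (N y) :=
  trace_frame_normal _ (h.metric.symm _) h.det _ h.unit h.normal L

/-- Expansion of a vector in the frame. -/
theorem HyperAt.expand (h : HyperAt G F N y) (v : Fin (m + 1) → ℝ) :
    v = ∑ a, ∑ b, ((indMetric G F y)⁻¹ a b * ip (G (F y)) v (dvec (ev a) F y)) • dvec (ev b) F y
      + ip (G (F y)) v (N y) • N y := by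
  funext k
  -- The form (x, x') ↦ ⟨v, x⟩ x'_k has ambient trace v_k, so the trace identity is the k-th
  -- component of the expansion.
  have ht := h.trace (LinearMap.mk₂ ℝ (fun x x' => ip (G (F y)) v x * x' k)
    (fun x y x' => by rw [ip_add_right]; ring)
    (fun c x x' => by rw [ip_smul_right, smul_eq_mul]; ring)
    (fun x y y' => by rw [Pi.add_apply]; ring)
    (fun c x x' => by rw [Pi.smul_apply, smul_eq_mul, smul_eq_mul]; ring))
  simp only [LinearMap.mk₂_apply] at ht
  have h1 : ∑ i, ∑ j, (G (F y))⁻¹ i j * (ip (G (F y)) v (Pi.single i 1)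
      * (Pi.single j 1 : Fin (m + 1) → ℝ) k) = v k := by
    have h2 : ∀ i, ∑ j, (G (F y))⁻¹ i j * (ip (G (F y)) v (Pi.single i 1)
      * (Pi.single j 1 : Fin (m + 1) → ℝ) k) = (G (F y))⁻¹ k i * (G (F y)).mulVec v i := by
      intro i
      rw [Finset.sum_eq_single k]
      · rw [h.metric.inv_symm, ip_single_right, Pi.single_eq_same, mul_one]
        congr 1
        exact Finset.sum_congr rfl fun j _ => by rw [h.metric.symm]
      · intro j _ hj; rw [Pi.single_eq_of_ne (Ne.symm hj)]; ring
      · simp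
    have h4 : (G (F y))⁻¹.mulVec ((G (F y)).mulVec v) = v := by
      rw [Matrix.mulVec_mulVec, h.metric.inv_mul, Matrix.one_mulVec]
    simp only [h2]
    exact congrFun h4 k
  rw [h1] at ht
  simp only [Pi.add_apply, Finset.sum_apply, Pi.smul_apply, smul_eq_mul]
  simp only [mul_assoc]
  rw [ht]; ring

theorem dd_eq_zero_of_eventually_const {f : E m → ℝ} {c : ℝ} (h : ∀ᶠ z in nhds y, f z = c)
    (v : E m) : dd v f y = 0 := by
  rw [dd_congr (h := fun _ => c) h, dd_const]

/-- Differentiate |N|² = 1. -/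
theorem ip_covD_normal_normal (h : ∀ᶠ z in nhds y, HyperAt G F N z) (v : E m) :
    ip (G (F y)) (covD G F v N y) (N y) = 0 := by
  have h0 := h.self_of_nhds
  have h1 := dd_ip h0.metric h0.map h0.normal_smooth h0.normal_smooth v
  rw [dd_eq_zero_of_eventually_const (c := 1) (h.mono fun z hz => hz.unit),
    ip_comm (h0.metric.symm _) (N y)] at h1
  linarith

/-- Differentiate ⟨N, F_b⟩ = 0. -/
theorem ip_normal_covD (h : ∀ᶠ z in nhds y, HyperAt G F N z) (a b : Fin m) :
    ip (G (F y)) (covD G F (ev a) (dvec (ev b) F) y) (N y) = - sff G F N y a b := by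
  have h0 := h.self_of_nhds
  have h1 := dd_ip h0.metric h0.map h0.normal_smooth (contDiffAt_dvec h0.map (ev b)) (ev a)
  rw [dd_eq_zero_of_eventually_const (c := 0) (h.mono fun z hz => hz.normal b),
    ip_comm (h0.metric.symm _) (N y)] at h1
  rw [sff]; linarith

/-- Both sides are normal components of second derivatives of the immersion, which commute because
the connection is torsion free. -/
theorem sff_symm (h : ∀ᶠ z in nhds y, HyperAt G F N z) (a b : Fin m) :
    sff G F N y a b = sff G F N y b a := by
  have h0 := h.self_of_nhds
  have h1 := ip_normal_covD h a b
  rw [covD_dvec_comm h0.metric.symm h0.map, ip_normal_covD h b a] at h1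
  linarith

/-- The Gauss formula. -/
theorem gauss_formula (h : ∀ᶠ z in nhds y, HyperAt G F N z) (a b : Fin m) :
    covD G F (ev a) (dvec (ev b) F) y
      = ∑ c, christoffel (indMetric G F) c a b y • dvec (ev c) F y - sff G F N y a b • N y := by
  have h0 := h.self_of_nhds
  conv_lhs => rw [h0.expand (covD G F (ev a) (dvec (ev b) F) y)]
  rw [ip_normal_covD h, neg_smul, ← sub_eq_add_neg]
  congr 1
  rw [Finset.sum_comm]
  refine Finset.sum_congr rfl fun c _ => ?_
  rw [← Finset.sum_smul]
  congr 1
  simp only [ip_covD_dvec h0.metric h0.map h0.det]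
  have h4 := congrFun (show (indMetric G F y)⁻¹.mulVec ((indMetric G F y).mulVec
      fun e => christoffel (indMetric G F) e a b y) = _ by
    rw [Matrix.mulVec_mulVec, h0.induced.inv_mul, Matrix.one_mulVec]) c
  rw [← h4]
  exact Finset.sum_congr rfl fun e _ => by rw [h0.induced.inv_symm]; rfl

/-- The Gauss equation. -/
theorem gauss_equation (h : ∀ᶠ z in nhds y, HyperAt G F N z) (a b c d : Fin m) :
    ip (G (F y)) (riemV G (F y) (dvec (ev a) F y) (dvec (ev b) F y) (dvec (ev c) F y))
        (dvec (ev d) F y)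
      = ∑ f, indMetric G F y d f * riem (indMetric G F) y f c a b
        - sff G F N y b c * sff G F N y a d + sff G F N y a c * sff G F N y b d := by
  have h0 := h.self_of_nhds
  have hg := h0.induced
  have hT := fun a => contDiffAt_dvec h0.map (ev a)
  set g := indMetric G F with hgdef
  have h1 : ∀ a b c, ip (G (F y)) (covD G F (ev a) (dvec (ev b) F) y) (covD G F (ev c) (dvec (ev d) F) y)
      = ∑ e, ∑ f, christoffel g e a b y * christoffel g f c d y * g y e f
        + sff G F N y a b * sff G F N y c d := by
    intro a b c
    rw [gauss_formula h a b, gauss_formula h c d, sub_eq_add_neg, sub_eq_add_neg]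
    simp only [← neg_smul, ip_add_left, ip_add_right, ip_smul_left, ip_smul_right, ip_sum_left,
      ip_sum_right, h0.unit, h0.normal, ip_comm (h0.metric.symm _) (dvec _ F y) (N y)]
    simp only [mul_zero, Finset.sum_const_zero, add_zero, zero_add, Finset.mul_sum]
    rw [← hgdef]
    congr 1
    · rw [Finset.sum_comm]
      refine Finset.sum_congr rfl fun e _ => Finset.sum_congr rfl fun f _ => ?_
      have : ip (G (F y)) (dvec (ev e) F y) (dvec (ev f) F y) = g y e f := rfl
      rw [this]; ring
    · ring
  -- Write ⟨D_a D_b F_c, F_d⟩ as ∂_a⟨D_b F_c, F_d⟩ - ⟨D_b F_c, D_a F_d⟩. The first term is intrinsic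
  -- by the Koszul formula; the second is given by the Gauss formula, whose normal parts contribute
  -- the product of second fundamental forms.
  have h2 : ∀ a b, ip (G (F y)) (covD G F (ev a) (covD G F (ev b) (dvec (ev c) F)) y) (dvec (ev d) F y)
      = ∑ e, (g y d e * pd a (christoffel g e b c) y
          + christoffel g e b c y * ∑ s, g y d s * christoffel g s a e y)
        - sff G F N y b c * sff G F N y a d := by
    intro a b
    have h3 := dd_ip h0.metric h0.map (contDiffAt_covD h0.metric h0.map (hT c) (ev b)) (hT d) (ev a)
    have h4 : (fun x => ip (G (F x)) (covD G F (ev b) (dvec (ev c) F) x) (dvec (ev d) F x))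
        =ᶠ[nhds y] fun x => ∑ e, g x d e * christoffel g e b c x := by
      filter_upwards [h] with z hz
      exact ip_covD_dvec hz.metric hz.map hz.det b c d
    rw [dd_congr h4, h1 b c a, dd_sum _ fun e _ => diffAt ((hg.smooth d e).mul
      (hg.contDiffAt_christoffel e b c))] at h3
    have h5 : ∀ e, dd (ev a) (fun x => g x d e * christoffel g e b c x) y
        = (∑ s, christoffel g e b c y * christoffel g s a d y * g y e s)
          + (g y d e * pd a (christoffel g e b c) y
          + christoffel g e b c y * ∑ s, g y d s * christoffel g s a e y) := by
      intro e
      rw [dd_mul (diffAt (hg.smooth d e)) (diffAt (hg.contDiffAt_christoffel e b c)),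
        ← pd_eq_dd, ← pd_eq_dd, hg.compat a d e, add_mul]
      have : ∑ s, christoffel g e b c y * christoffel g s a d y * g y e s
        = (∑ s, g y s e * christoffel g s a d y) * christoffel g e b c y := by
        rw [Finset.sum_mul]
        exact Finset.sum_congr rfl fun s _ => by rw [hg.symm y e s]; ring
      rw [this]; ring
    simp only [h5] at h3
    rw [Finset.sum_add_distrib] at h3
    linarith
  have h6 := covD_covD h0.metric h0.map (hT c) (ev a) (ev b)
  rw [← h6, sub_eq_add_neg, ip_add_left, ip_neg_left, h2, h2]
  -- The intrinsic parts of the two orders of differentiation combine to the curvature of the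
  -- induced metric, with one index lowered.
  have h7 : ∑ f, g y d f * riem g y f c a b
      = ∑ e, (g y d e * pd a (christoffel g e b c) y
          + christoffel g e b c y * ∑ s, g y d s * christoffel g s a e y)
        - ∑ e, (g y d e * pd b (christoffel g e a c) y
          + christoffel g e a c y * ∑ s, g y d s * christoffel g s b e y) := by
    have h8 : ∀ a b : Fin m, ∑ e, christoffel g e b c y * ∑ s, g y d s * christoffel g s a e y
        = ∑ f, g y d f * ∑ s, christoffel g f a s y * christoffel g s b c y := by
      intro a b
      simp only [Finset.mul_sum]
      rw [Finset.sum_comm]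
      exact Finset.sum_congr rfl fun s _ => Finset.sum_congr rfl fun e _ => by ring
    simp only [Finset.sum_add_distrib, h8, riem, Finset.sum_sub_distrib, mul_add, mul_sub]
    ring
  rw [h7]; ring

/-- The squared norm of the second fundamental form. -/
def sffSq (G : E (m + 1) → Matrix (Fin (m + 1)) (Fin (m + 1)) ℝ) (F : E m → E (m + 1))
    (N : E m → Fin (m + 1) → ℝ) (y : E m) : ℝ :=
  ∑ a, ∑ b, (indMetric G F y)⁻¹ a b * ip (G (F y)) (covD G F (ev a) N y) (covD G F (ev b) N y)

/-- The mean curvature. -/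
def meanCurv (G : E (m + 1) → Matrix (Fin (m + 1)) (Fin (m + 1)) ℝ) (F : E m → E (m + 1))
    (N : E m → Fin (m + 1) → ℝ) (y : E m) : ℝ :=
  ∑ a, ∑ b, (indMetric G F y)⁻¹ a b * sff G F N y a b

/-- D_a N is tangential, so its frame expansion has no normal term. This identifies `sffSq`, defined
through the derivatives of N, with the usual |B|². -/
theorem ip_covD_normal (h : ∀ᶠ z in nhds y, HyperAt G F N z) (a b : Fin m) :
    ip (G (F y)) (covD G F (ev a) N y) (covD G F (ev b) N y)
      = ∑ c, ∑ d, (indMetric G F y)⁻¹ c d * sff G F N y a c * sff G F N y b d := by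
  have h0 := h.self_of_nhds
  conv_lhs => rw [h0.expand (covD G F (ev a) N y)]
  rw [ip_covD_normal_normal h, zero_smul, add_zero]
  simp only [ip_sum_left, ip_smul_left]
  exact Finset.sum_congr rfl fun c _ => Finset.sum_congr rfl fun d _ => by
    rw [ip_comm (h0.metric.symm _) (dvec (ev d) F y)]; rfl

/-- The ambient trace is Ricci, and the entry at the normal vanishes by skew symmetry of the
curvature. The minus sign comes from interchanging the first two arguments of R. -/
theorem trace_riem_normal (hG : ∀ᶠ q in nhds (F y), MetricAt G q) (h0 : HyperAt G F N y) :
    ∑ a, ∑ b, (indMetric G F y)⁻¹ a b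
        * ip (G (F y)) (riemV G (F y) (N y) (dvec (ev a) F y) (N y)) (dvec (ev b) F y)
      = - ric G (F y) (N y) (N y) := by
  have h1 := h0.trace (riemL G (F y) (N y) (N y))
  rw [riemL_trace h0.metric] at h1
  have h2 : riemL G (F y) (N y) (N y) (N y) (N y) = 0 := by
    change ip (G (F y)) (riemV G (F y) (N y) (N y) (N y)) (N y) = 0
    have := ip_riemV hG (N y) (N y) (N y) (N y)
    linarith
  rw [h2, sub_zero] at h1
  rw [← h1, ← Finset.sum_neg_distrib]
  refine Finset.sum_congr rfl fun a _ => ?_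
  rw [← Finset.sum_neg_distrib]
  refine Finset.sum_congr rfl fun b _ => ?_
  rw [riemV_swap, ip_neg_left, mul_neg]; rfl

/-- The traced Gauss equation. -/
theorem gauss_traced (hG : ∀ᶠ q in nhds (F y), MetricAt G q)
    (h : ∀ᶠ z in nhds y, HyperAt G F N z) :
    scalarCoord G (F y) = scalarCoord (indMetric G F) y + 2 * ric G (F y) (N y) (N y)
      + sffSq G F N y - meanCurv G F N y ^ 2 := by
  have h0 := h.self_of_nhds
  have hg := h0.induced
  set g := indMetric G F with hgdef
  have hskew := ip_riemV hG
  -- the inner trace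
  have h1 : ∀ b c, ∑ a, ∑ d, (g y)⁻¹ a d * ip (G (F y))
      (riemV G (F y) (dvec (ev a) F y) (dvec (ev b) F y) (dvec (ev c) F y)) (dvec (ev d) F y)
      = ric G (F y) (dvec (ev c) F y) (dvec (ev b) F y)
        - ip (G (F y)) (riemV G (F y) (N y) (dvec (ev b) F y) (dvec (ev c) F y)) (N y) := by
    intro b c
    have := h0.trace (riemL G (F y) (dvec (ev b) F y) (dvec (ev c) F y))
    rw [riemL_trace h0.metric] at this
    exact this
  -- The same inner trace, now from the Gauss equation. Equating the two expressions and tracing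
  -- once more over b and c gives the claim.
  have h2 : ∀ b c, ∑ a, ∑ d, (g y)⁻¹ a d * ip (G (F y))
      (riemV G (F y) (dvec (ev a) F y) (dvec (ev b) F y) (dvec (ev c) F y)) (dvec (ev d) F y)
      = ricciCoord g c b y - sff G F N y b c * meanCurv G F N y
        + ∑ a, ∑ d, (g y)⁻¹ a d * sff G F N y a c * sff G F N y b d := by
    intro b c
    have e1 : ∑ a, ∑ d, (g y)⁻¹ a d * ∑ f, g y d f * riem g y f c a b = ricciCoord g c b y := by
      rw [ricciCoord_eq hg.symm]
      refine Finset.sum_congr rfl fun a _ => ?_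
      have h4 := congrFun (show (g y)⁻¹.mulVec ((g y).mulVec fun f => riem g y f c a b) = _ by
        rw [Matrix.mulVec_mulVec, hg.inv_mul, Matrix.one_mulVec]) a
      exact h4
    rw [← e1, meanCurv, Finset.mul_sum, ← Finset.sum_sub_distrib, ← Finset.sum_add_distrib]
    refine Finset.sum_congr rfl fun a _ => ?_
    rw [Finset.mul_sum, ← Finset.sum_sub_distrib, ← Finset.sum_add_distrib]
    refine Finset.sum_congr rfl fun d _ => ?_
    rw [gauss_equation h]; ring
  -- the outer trace
  have h3 : ∑ c, ∑ b, (g y)⁻¹ c b * ric G (F y) (dvec (ev c) F y) (dvec (ev b) F y)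
      = scalarCoord G (F y) - ric G (F y) (N y) (N y) := by
    have := h0.trace (ipL (Matrix.of fun i j => ricciCoord G i j (F y)))
    simp only [ipL_apply] at this
    rw [show scalarCoord G (F y) = ∑ i, ∑ j, (G (F y))⁻¹ i j *
      ip (Matrix.of fun i j => ricciCoord G i j (F y)) (Pi.single i 1) (Pi.single j 1) from by
        simp only [ip_single_right]
        simp [scalarCoord, Pi.single_apply]]
    exact this
  -- This trace accounts for one of the two copies of Ric(N, N); the other comes from `h3`, where
  -- the ambient trace is cut down to the tangent space.
  have h4 : ∑ c, ∑ b, (g y)⁻¹ c b *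
      ip (G (F y)) (riemV G (F y) (N y) (dvec (ev b) F y) (dvec (ev c) F y)) (N y)
      = ric G (F y) (N y) (N y) := by
    rw [← neg_eq_iff_eq_neg.2 (trace_riem_normal hG h0), ← Finset.sum_neg_distrib, Finset.sum_comm]
    refine Finset.sum_congr rfl fun b _ => ?_
    rw [← Finset.sum_neg_distrib]
    refine Finset.sum_congr rfl fun c _ => ?_
    rw [hskew, hg.inv_symm]; ring
  have h5 : ∑ c, ∑ b, (g y)⁻¹ c b * ∑ a, ∑ d, (g y)⁻¹ a d * sff G F N y a c * sff G F N y b d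
      = sffSq G F N y := by
    rw [sffSq]
    refine Finset.sum_congr rfl fun c _ => Finset.sum_congr rfl fun b _ => ?_
    rw [ip_covD_normal h]
    congr 1
    exact Finset.sum_congr rfl fun a _ => Finset.sum_congr rfl fun d _ => by
      rw [sff_symm h a c]
  have h6 : ∑ c, ∑ b, (g y)⁻¹ c b * (sff G F N y b c * meanCurv G F N y)
      = meanCurv G F N y ^ 2 := by
    rw [pow_two]
    conv_rhs => enter [1]; rw [meanCurv]
    rw [Finset.sum_mul]
    refine Finset.sum_congr rfl fun c _ => ?_
    rw [Finset.sum_mul]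
    exact Finset.sum_congr rfl fun b _ => by rw [sff_symm h b c]; ring
  have h7 : ∑ c, ∑ b, (g y)⁻¹ c b * ricciCoord g c b y = scalarCoord g y := rfl
  have h8 : ∑ c, ∑ b, (g y)⁻¹ c b * (ric G (F y) (dvec (ev c) F y) (dvec (ev b) F y)
        - ip (G (F y)) (riemV G (F y) (N y) (dvec (ev b) F y) (dvec (ev c) F y)) (N y))
      = ∑ c, ∑ b, (g y)⁻¹ c b * (ricciCoord g c b y - sff G F N y b c * meanCurv G F N y
        + ∑ a, ∑ d, (g y)⁻¹ a d * sff G F N y a c * sff G F N y b d) :=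
    Finset.sum_congr rfl fun c _ => Finset.sum_congr rfl fun b _ => by rw [← h1, h2]
  simp only [mul_sub, mul_add, Finset.sum_sub_distrib, Finset.sum_add_distrib] at h8
  rw [h3, h4, h5, h6, h7] at h8
  linarith

end Hyper

/-! ### Derivatives of determinants -/

section Det

variable {ι : Type*} [Fintype ι] [DecidableEq ι]

/-- As a polynomial in s the determinant is 1 + s tr K plus a multiple of s². -/
theorem hasDerivAt_det_one_add (K : Matrix ι ι ℝ) :
    HasDerivAt (fun s : ℝ => (1 + s • K).det) K.trace 0 := by
  set q := (1 + (Polynomial.X : Polynomial ℝ) • K.map Polynomial.C).det.divX.divX with hq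
  have h : (fun s : ℝ => (1 + s • K).det) = fun s => 1 + K.trace * s + q.eval s * s ^ 2 := by
    funext s; rw [Matrix.det_one_add_smul]
  rw [h]
  have h1 := ((hasDerivAt_const (0 : ℝ) (1 : ℝ)).add ((hasDerivAt_id (0 : ℝ)).const_mul K.trace)).add
    ((q.hasDerivAt 0).mul ((hasDerivAt_id (0 : ℝ)).pow 2))
  refine h1.congr_deriv ?_
  simp

/-- Jacobi's formula. By the chain rule it suffices to differentiate the determinant along the
straight line with the same velocity. -/
theorem hasDerivAt_det {A : ℝ → Matrix ι ι ℝ} {A' : Matrix ι ι ℝ} {t : ℝ}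
    (hA : ∀ i j, HasDerivAt (fun t => A t i j) (A' i j) t) (hu : (A t).det ≠ 0) :
    HasDerivAt (fun t => (A t).det) ((A t).det * ((A t)⁻¹ * A').trace) t := by
  let D : (ι → ι → ℝ) → ℝ := fun M => (Matrix.of M).det
  have hD : Differentiable ℝ D := by
    intro M
    have : ContDiffAt ℝ 1 D M := contDiffAt_det (A := fun M : ι → ι → ℝ => Matrix.of M) fun i j => by
      have h1 : ContDiff ℝ 1 fun M : ι → ι → ℝ => M i j := contDiff_apply_apply ℝ ℝ i j
      exact h1.contDiffAt
    exact this.differentiableAt (by simp)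
  have hcurve : HasDerivAt (fun t => (fun i j => A t i j : ι → ι → ℝ)) (fun i j => A' i j) t :=
    hasDerivAt_pi.2 fun i => hasDerivAt_pi.2 fun j => hA i j
  have h1 := (hD (fun i j => A t i j)).hasFDerivAt.comp_hasDerivAt t hcurve
  have hline : HasDerivAt (fun s : ℝ => ((fun i j => A t i j) + s • fun i j => A' i j : ι → ι → ℝ))
      (fun i j => A' i j) 0 := by
    simpa using ((hasDerivAt_id (0 : ℝ)).smul_const (fun i j => A' i j : ι → ι → ℝ)).const_add
      (fun i j => A t i j)
  have hD' : HasFDerivAt D (fderiv ℝ D (fun i j => A t i j))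
      ((fun i j => A t i j) + (0 : ℝ) • fun i j => A' i j : ι → ι → ℝ) := by
    simpa using (hD (fun i j => A t i j)).hasFDerivAt
  have h2 := hD'.comp_hasDerivAt (0 : ℝ) hline
  -- On the line, A + sA' = A(1 + sA⁻¹A'), which reduces to the derivative at the identity.
  have h3 : (D ∘ fun s : ℝ => ((fun i j => A t i j) + s • fun i j => A' i j : ι → ι → ℝ))
      = fun s => (A t).det * (1 + s • ((A t)⁻¹ * A')).det := by
    funext s
    rw [← Matrix.det_mul, mul_add, mul_one, Matrix.mul_smul, ← mul_assoc,
      Matrix.mul_nonsing_inv _ (isUnit_iff_ne_zero.2 hu), one_mul]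
    rfl
  rw [h3] at h2
  have h4 := h2.unique ((hasDerivAt_det_one_add ((A t)⁻¹ * A')).const_mul (A t).det)
  rw [h4] at h1
  exact h1

/-- Second derivative of the square root of the normalised determinant, when its first derivative
vanishes. -/
theorem deriv_deriv_sqrt_det {A : ℝ → Matrix ι ι ℝ}
    (hA : ∀ i j, ContDiffAt ℝ ∞ (fun t => A t i j) 0) (hpos : 0 < (A 0).det)
    {P Q : Matrix ι ι ℝ} (hP : ∀ i j, deriv (fun t => A t i j) 0 = P i j)
    (hQ : ∀ i j, deriv (deriv (fun t => A t i j)) 0 = Q i j)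
    (h0 : ((A 0)⁻¹ * P).trace = 0) :
    deriv (deriv fun t => Real.sqrt ((A t).det / (A 0).det)) 0
      = (1 / 2) * (((A 0)⁻¹ * Q).trace - ((A 0)⁻¹ * P * (A 0)⁻¹ * P).trace) := by
  set A1 : ℝ → Matrix ι ι ℝ := fun t => Matrix.of fun i j => deriv (fun t => A t i j) t with hA1
  have hev : ∀ᶠ t in nhds (0 : ℝ), ∀ i j, HasDerivAt (fun t => A t i j) (A1 t i j) t := by
    rw [Filter.eventually_all]; intro i
    rw [Filter.eventually_all]; intro j
    have h1 : ContDiffAt ℝ 1 (fun t => A t i j) 0 := (hA i j).of_le (WithTop.coe_le_coe.2 le_top)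
    filter_upwards [h1.eventually (by simp)] with t ht
    exact (ht.differentiableAt (by simp)).hasDerivAt
  have hdet : ContDiffAt ℝ ∞ (fun t => (A t).det) 0 := contDiffAt_det hA
  have hevp : ∀ᶠ t in nhds (0 : ℝ), 0 < (A t).det :=
    hdet.continuousAt.eventually_const_lt hpos
  set T : ℝ → ℝ := fun t => ((A t)⁻¹ * A1 t).trace with hT
  set ρ : ℝ → ℝ := fun t => Real.sqrt ((A t).det / (A 0).det) with hρ
  have hρ0 : ρ 0 = 1 := by simp [hρ, hpos.ne']
  -- The logarithmic derivative of the density ρ is T/2 with T = tr(A⁻¹A'). Since ρ(0) = 1 and T(0)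
  -- = 0, the second derivative of ρ at 0 is T'(0)/2.
  have hder : ∀ᶠ t in nhds (0 : ℝ), HasDerivAt ρ (ρ t * (1 / 2) * T t) t := by
    filter_upwards [hev, hevp] with t ht htp
    have h1 := (hasDerivAt_det ht htp.ne').div_const (A 0).det
    have hq : 0 < (A t).det / (A 0).det := div_pos htp hpos
    have h2 := h1.sqrt hq.ne'
    convert h2 using 1
    have h3 : (A t).det * T t / (A 0).det = ρ t * ρ t * T t := by
      rw [hρ]; dsimp only; rw [Real.mul_self_sqrt hq.le]; ring
    have h4 : ρ t ≠ 0 := (Real.sqrt_pos.2 hq).ne'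
    change _ = (A t).det * T t / (A 0).det / (2 * ρ t)
    rw [h3]; field_simp
  have hA1' : ∀ i j, HasDerivAt (fun t => A1 t i j) (Q i j) 0 := by
    intro i j
    rw [← hQ i j]
    have h1 : ContDiffAt ℝ ∞ (deriv fun t => A t i j) 0 := by
      have := contDiffAt_dd (hA i j) 1
      exact this
    exact (h1.differentiableAt (by simp)).hasDerivAt
  set B' : Matrix ι ι ℝ := Matrix.of fun i j => deriv (fun t => (A t)⁻¹ i j) 0 with hB'
  have hB : ∀ i j, HasDerivAt (fun t => (A t)⁻¹ i j) (B' i j) 0 := fun i j =>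
    ((contDiffAt_inv hA hpos.ne' i j).differentiableAt (by simp)).hasDerivAt
  have hA10 : A1 0 = P := by ext i j; exact hP i j
  have hu : IsUnit (A 0).det := isUnit_iff_ne_zero.2 hpos.ne'
  -- The derivative of the inverse comes from differentiating A⁻¹A = 1.
  have hBeq : B' = - ((A 0)⁻¹ * P * (A 0)⁻¹) := by
    have h1 : B' * A 0 + (A 0)⁻¹ * P = 0 := by
      ext i k
      have h2 : HasDerivAt (fun t => ∑ j, (A t)⁻¹ i j * A t j k)
          (∑ j, (B' i j * A 0 j k + (A 0)⁻¹ i j * A1 0 j k)) 0 :=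
        HasDerivAt.fun_sum fun j _ => (hB i j).mul (hev.self_of_nhds j k)
      have h3 : (fun t => ∑ j, (A t)⁻¹ i j * A t j k) =ᶠ[nhds 0] fun _ => (1 : Matrix ι ι ℝ) i k := by
        filter_upwards [hevp] with t ht
        have := congrFun (congrFun (Matrix.nonsing_inv_mul (A t) (isUnit_iff_ne_zero.2 ht.ne')) i) k
        rw [← this, Matrix.mul_apply]
      have h4 := (h2.congr_of_eventuallyEq h3.symm).unique (hasDerivAt_const _ _)
      rw [hA10, Finset.sum_add_distrib] at h4
      simpa [Matrix.add_apply, Matrix.mul_apply] using h4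
    have h5 : B' * A 0 = - ((A 0)⁻¹ * P) := eq_neg_of_add_eq_zero_left h1
    calc B' = B' * A 0 * (A 0)⁻¹ := by rw [mul_assoc, Matrix.mul_nonsing_inv _ hu, mul_one]
      _ = _ := by rw [h5, neg_mul]
  have hT' : HasDerivAt T (((A 0)⁻¹ * Q).trace - ((A 0)⁻¹ * P * (A 0)⁻¹ * P).trace) 0 := by
    have h1 : HasDerivAt (fun t => ∑ i, ∑ j, (A t)⁻¹ i j * A1 t j i)
        (∑ i, ∑ j, (B' i j * A1 0 j i + (A 0)⁻¹ i j * Q j i)) 0 :=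
      HasDerivAt.fun_sum fun i _ => HasDerivAt.fun_sum fun j _ => (hB i j).mul (hA1' j i)
    refine h1.congr_deriv ?_
    have h2 : ∑ i, ∑ j, (B' i j * A1 0 j i + (A 0)⁻¹ i j * Q j i)
      = (B' * P).trace + ((A 0)⁻¹ * Q).trace := by
      rw [hA10]
      simp [Matrix.trace, Matrix.mul_apply, Finset.sum_add_distrib]
    rw [h2, hBeq, neg_mul, Matrix.trace_neg]; ring
  have hT0 : T 0 = 0 := by rw [hT]; dsimp only; rw [hA10, h0]
  have hd : deriv ρ =ᶠ[nhds 0] fun t => ρ t * (1 / 2) * T t := hder.mono fun t ht => ht.deriv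
  rw [hd.deriv_eq]
  have h5 := ((hder.self_of_nhds.mul_const (1 / 2)).fun_mul hT').deriv
  rw [h5, hT0, hρ0]; ring

end Det

/-! ### The second variation of area in coordinates -/

section SecondVariation

variable {m : ℕ}

/-- The Laplacian `g^{ab}(∂_a ∂_b φ - Γ^c_{ab} ∂_c φ)`. -/
def lap (g : E m → Matrix (Fin m) (Fin m) ℝ) (φ : E m → ℝ) (y : E m) : ℝ :=
  ∑ a, ∑ b, (g y)⁻¹ a b * (pd a (pd b φ) y - ∑ c, christoffel g c a b y * pd c φ y)

/-- The squared norm of the gradient. -/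
def gradSq (g : E m → Matrix (Fin m) (Fin m) ℝ) (φ : E m → ℝ) (y : E m) : ℝ :=
  ∑ a, ∑ b, (g y)⁻¹ a b * (pd a φ y * pd b φ y)

theorem fderiv_slice {f : ℝ × E m → ℝ} {t : ℝ} {y : E m} (hf : DifferentiableAt ℝ f (t, y)) (v : E m) :
    dd v (fun y => f (t, y)) y = dd ((0 : ℝ), v) f (t, y) := by
  have h1 : HasFDerivAt (fun y : E m => (t, y)) (ContinuousLinearMap.inr ℝ ℝ (E m)) y :=
    hasFDerivAt_prodMk_right t y
  have h2 := (hf.hasFDerivAt.comp y h1).fderiv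
  simp only [dd]
  change fderiv ℝ (f ∘ fun y : E m => (t, y)) y v = _
  rw [h2]; simp

theorem deriv_slice {f : ℝ × E m → ℝ} {t : ℝ} {y : E m} (hf : DifferentiableAt ℝ f (t, y)) :
    deriv (fun s => f (s, y)) t = dd ((1 : ℝ), (0 : E m)) f (t, y) := by
  have h1 : HasFDerivAt (fun s : ℝ => (s, y)) (ContinuousLinearMap.inl ℝ ℝ (E m)) t :=
    hasFDerivAt_prodMk_left t y
  have h2 := (hf.hasFDerivAt.comp t h1)
  have h3 := h2.hasDerivAt.deriv
  change deriv (f ∘ fun s : ℝ => (s, y)) t = _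
  rw [h3]; simp [dd]

/-- The Gram matrix of the `t`-slice of a variation. -/
def varMetric {n : ℕ} (G : E n → Matrix (Fin n) (Fin n) ℝ) (F : ℝ × E m → E n) (z : ℝ × E m) :
    Matrix (Fin m) (Fin m) ℝ :=
  gramOf (G (F z)) fun a => dvec ((0 : ℝ), ev a) F z

variable {G : E (m + 1) → Matrix (Fin (m + 1)) (Fin (m + 1)) ℝ} {F : ℝ × E m → E (m + 1)}
  {N : E m → Fin (m + 1) → ℝ} {y : E m}

theorem dvec_slice {n : ℕ} {F : ℝ × E m → E n} {t : ℝ} {y : E m} (hF : ContDiffAt ℝ ∞ F (t, y)) (v : E m) :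
    dvec v (fun y => F (t, y)) y = dvec ((0 : ℝ), v) F (t, y) := by
  funext k
  exact fderiv_slice (f := fun z => F z k) (diffAt (coord_contDiffAt hF k)) v

theorem covD_slice {n : ℕ} {G : E n → Matrix (Fin n) (Fin n) ℝ} {F : ℝ × E m → E n} {t : ℝ} {y : E m}
    (hF : ContDiffAt ℝ ∞ F (t, y))
    {U : ℝ × E m → Fin n → ℝ} (hU : ∀ k, ContDiffAt ℝ ∞ (fun x => U x k) (t, y)) (v : E m) :
    covD G (fun y => F (t, y)) v (fun y => U (t, y)) y = covD G F ((0 : ℝ), v) U (t, y) := by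
  funext k
  rw [covD_apply, covD_apply, dvec_slice hF, fderiv_slice (f := fun z => U z k) (diffAt (hU k))]

theorem covD_smul {n : ℕ} {G : E n → Matrix (Fin n) (Fin n) ℝ} {F : E m → E n} {φ : E m → ℝ}
    {U : E m → Fin n → ℝ} (hφ : ContDiffAt ℝ ∞ φ y)
    (hU : ∀ k, ContDiffAt ℝ ∞ (fun x => U x k) y) (v : E m) :
    covD G F v (fun y => φ y • U y) y = dd v φ y • U y + φ y • covD G F v U y := by
  funext k
  simp only [covD_apply, Pi.add_apply, Pi.smul_apply, smul_eq_mul, chr_smul_right]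
  rw [dd_mul (diffAt hφ) (diffAt (hU k))]; ring

/-- Schur product theorem: the Hadamard product is positive semidefinite, and the sum is its value
at the all-ones vector. -/
theorem sum_posDef_nonneg {κ : Type*} [Fintype κ] [DecidableEq κ] {A B : Matrix κ κ ℝ} (hA : A.PosSemidef)
    (hB : B.PosSemidef) : 0 ≤ ∑ a, ∑ b, A a b * B a b := by
  have h := (hA.hadamard hB).dotProduct_mulVec_nonneg fun _ => 1
  simpa [dotProduct, Matrix.mulVec, Matrix.hadamard_apply] using h

theorem gramOf_posSemidef {n : ℕ} {κ : Type*} [Fintype κ] [DecidableEq κ] {A : Matrix (Fin n) (Fin n) ℝ}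
    (hA : A.PosSemidef) (T : κ → Fin n → ℝ) : (gramOf A T).PosSemidef := by
  rw [gramOf_eq]
  have := hA.mul_mul_conjTranspose_same (Matrix.of T)
  rwa [Matrix.conjTranspose_eq_transpose_of_trivial] at this

end SecondVariation

/-! ### The second derivative of the area density along a variation -/

section SecondVariation

variable {m : ℕ}
  {G : E (m + 1) → Matrix (Fin (m + 1)) (Fin (m + 1)) ℝ} {F : ℝ × E m → E (m + 1)}
  {N : E m → Fin (m + 1) → ℝ} {y : E m}

theorem eventually_slice_time {p : ℝ × E m → Prop} {t : ℝ} (h : ∀ᶠ z in nhds (t, y), p z) :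
    ∀ᶠ s in nhds t, p (s, y) :=
  (Continuous.prodMk_left y).continuousAt.eventually h

/-- First and second derivatives in time of the induced metrics. -/
theorem deriv_varMetric {n : ℕ} {G : E n → Matrix (Fin n) (Fin n) ℝ} {F : ℝ × E m → E n}
    (hG : ∀ᶠ q in nhds (F (0, y)), MetricAt G q)
    (hF : ∀ᶠ z in nhds ((0 : ℝ), y), ContDiffAt ℝ ∞ F z) (a b : Fin m) :
    let U := dvec ((1 : ℝ), (0 : E m)) F
    let D := fun (a : Fin m) z => covD G F ((0 : ℝ), ev a) U z
    let T := fun a : Fin m => dvec ((0 : ℝ), ev a) F ((0 : ℝ), y)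
    let g := G (F ((0 : ℝ), y))
    let z := ((0 : ℝ), y)
    deriv (fun t => varMetric G F (t, y) a b) 0 = ip g (D a z) (T b) + ip g (D b z) (T a) ∧
    deriv (deriv fun t => varMetric G F (t, y) a b) 0
      = (ip g (covD G F ((1 : ℝ), (0 : E m)) (D a) z) (T b) + ip g (D a z) (D b z))
        + (ip g (covD G F ((1 : ℝ), (0 : E m)) (D b) z) (T a) + ip g (D b z) (D a z)) := by
  intro U D T g z0
  have hF0 := hF.self_of_nhds
  have hGF : ∀ᶠ z in nhds z0, MetricAt G (F z) := hF0.continuousAt.eventually hG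
  have hU : ∀ z, ContDiffAt ℝ ∞ F z → ∀ k, ContDiffAt ℝ ∞ (fun x => U x k) z := fun z hz =>
    contDiffAt_dvec hz _
  have hT : ∀ z, ContDiffAt ℝ ∞ F z → ∀ c : Fin m, ∀ k,
    ContDiffAt ℝ ∞ (fun x => dvec ((0 : ℝ), ev c) F x k) z := fun z hz c => contDiffAt_dvec hz _
  have hD : ∀ z, MetricAt G (F z) → ContDiffAt ℝ ∞ F z → ∀ c : Fin m, ∀ k,
    ContDiffAt ℝ ∞ (fun x => D c x k) z := fun z hg hz c => contDiffAt_covD hg hz (hU z hz) _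
  set f : ℝ × E m → ℝ := fun z => varMetric G F z a b with hf
  set h : Fin m → Fin m → ℝ × E m → ℝ := fun a b z => ip (G (F z)) (D a z) (dvec ((0 : ℝ), ev b) F z)
    with hh
  have hfs : ∀ᶠ z in nhds z0, ContDiffAt ℝ ∞ f z := by
    filter_upwards [hGF, hF] with z hg hz
    exact contDiffAt_ip hg hz (hT z hz a) (hT z hz b)
  have hhs : ∀ a b, ContDiffAt ℝ ∞ (h a b) z0 := fun a b =>
    contDiffAt_ip hGF.self_of_nhds hF0 (hD z0 hGF.self_of_nhds hF0 a) (hT z0 hF0 b)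
  -- Torsion-freeness replaces the time derivative of the frame vector F_a by the derivative D_a U
  -- of the velocity; `e3` uses it again at second order.
  have e1 : ∀ᶠ z in nhds z0, dd ((1 : ℝ), (0 : E m)) f z = h a b z + h b a z := by
    filter_upwards [hGF, hF] with z hg hz
    have := dd_ip hg hz (hT z hz a) (hT z hz b) ((1 : ℝ), (0 : E m))
    rw [covD_dvec_comm hg.symm hz, covD_dvec_comm hg.symm hz _ ((0 : ℝ), ev b),
      ip_comm (hg.symm _) (dvec _ F z)] at this
    exact this
  have e2 : ∀ᶠ t in nhds (0 : ℝ), deriv (fun t => f (t, y)) t = h a b (t, y) + h b a (t, y) := by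
    filter_upwards [eventually_slice_time hfs, eventually_slice_time e1] with t ht ht1
    rw [deriv_slice (diffAt ht), ht1]
  have e3 : ∀ a b, dd ((1 : ℝ), (0 : E m)) (h a b) z0
      = ip g (covD G F ((1 : ℝ), (0 : E m)) (D a) z0) (T b) + ip g (D a z0) (D b z0) := by
    intro a b
    have hg := hGF.self_of_nhds
    have := dd_ip hg hF0 (hD z0 hg hF0 a) (hT z0 hF0 b) ((1 : ℝ), (0 : E m))
    rw [covD_dvec_comm hg.symm hF0 _ ((0 : ℝ), ev b)] at this
    exact this
  refine ⟨e2.self_of_nhds, ?_⟩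
  have e4 : deriv (fun t => f (t, y)) =ᶠ[nhds 0] fun t => h a b (t, y) + h b a (t, y) := e2
  rw [e4.deriv_eq, deriv_slice (f := fun z => h a b z + h b a z)
    ((diffAt (hhs a b)).add (diffAt (hhs b a))), dd_add (diffAt (hhs a b)) (diffAt (hhs b a)), e3, e3]

/-- The second variation of the area element. -/
theorem second_variation {φ : E m → ℝ} {α : ℝ}
    (hG : ∀ᶠ q in nhds (F (0, y)), MetricAt G q)
    (hF : ∀ᶠ z in nhds ((0 : ℝ), y), ContDiffAt ℝ ∞ F z)
    (hH : ∀ᶠ z in nhds y, HyperAt G (fun y => F (0, y)) N z)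
    (hφ : ContDiffAt ℝ ∞ φ y)
    (hvel : ∀ᶠ z in nhds y, dvec ((1 : ℝ), (0 : E m)) F (0, z) = φ z • N z)
    (hacc : ∀ᶠ z in nhds y, ∀ a, ip (G (F (0, z)))
      (covD G F ((1 : ℝ), (0 : E m)) (dvec ((1 : ℝ), (0 : E m)) F) (0, z))
      (dvec (ev a) (fun y => F (0, y)) z) = α * (φ z * pd a φ z))
    (hmin : meanCurv G (fun y => F (0, y)) N y = 0)
    (hdet : 0 < (varMetric G F (0, y)).det) :
    deriv (deriv fun t => Real.sqrt ((varMetric G F (t, y)).det / (varMetric G F (0, y)).det)) 0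
      = (1 + α) * gradSq (indMetric G fun y => F (0, y)) φ y
        + α * (φ y * lap (indMetric G fun y => F (0, y)) φ y)
        - φ y ^ 2 * (ric G (F (0, y)) (N y) (N y) + sffSq G (fun y => F (0, y)) N y) := by
  have hF0 := hF.self_of_nhds
  have hH0 := hH.self_of_nhds
  have hg0 := hG.self_of_nhds
  have hgI := hH0.induced
  have hGF : ∀ᶠ z in nhds ((0 : ℝ), y), MetricAt G (F z) := hF0.continuousAt.eventually hG
  set S : E m → E (m + 1) := fun y => F (0, y) with hS
  set g := indMetric G S with hg
  have hvar : varMetric G F (0, y) = g y := by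
    ext a b
    change ip (G (F (0, y))) (dvec ((0 : ℝ), ev a) F (0, y)) (dvec ((0 : ℝ), ev b) F (0, y))
      = ip (G (F (0, y))) (dvec (ev a) (fun y => F (0, y)) y) (dvec (ev b) (fun y => F (0, y)) y)
    rw [dvec_slice hF0, dvec_slice hF0]
  set U := dvec ((1 : ℝ), (0 : E m)) F with hU
  have hUs : ∀ k, ContDiffAt ℝ ∞ (fun x => U x k) (0, y) := contDiffAt_dvec hF0 _
  set D := fun (a : Fin m) z => covD G F ((0 : ℝ), ev a) U z with hD
  have hTs : ∀ a : Fin m, dvec ((0 : ℝ), ev a) F (0, y) = dvec (ev a) S y := fun a =>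
    (dvec_slice hF0 (ev a)).symm
  have hDs : ∀ a, D a (0, y) = pd a φ y • N y + φ y • covD G S (ev a) N y := by
    intro a
    rw [hD]; dsimp only
    rw [← covD_slice hF0 hUs, covD_congr (W := fun z => φ z • N z) hvel,
      covD_smul hφ hH0.normal_smooth]
    rfl
  have hDT : ∀ a b, ip (G (F (0, y))) (D a (0, y)) (dvec (ev b) S y) = φ y * sff G S N y a b := by
    intro a b
    rw [hDs, ip_add_left, ip_smul_left, ip_smul_left, hH0.normal b]
    simp [sff, hS]
  have hDD : ∀ a b, ip (G (F (0, y))) (D a (0, y)) (D b (0, y))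
      = pd a φ y * pd b φ y + φ y ^ 2 * ip (G (S y)) (covD G S (ev a) N y) (covD G S (ev b) N y) := by
    intro a b
    rw [hDs, hDs]
    simp only [ip_add_left, ip_add_right, ip_smul_left, ip_smul_right]
    have h1 := ip_covD_normal_normal hH (ev a)
    have h2 := ip_covD_normal_normal hH (ev b)
    rw [ip_comm (hH0.metric.symm _)] at h2
    have h3 := hH0.unit
    change ip (G (F (0, y))) _ _ = _ at h1 h2 h3
    rw [h1, h2, h3]; simp only [hS]; ring
  set Acc := covD G F ((1 : ℝ), (0 : E m)) U with hAcc
  have hAs : ∀ k, ContDiffAt ℝ ∞ (fun x => Acc x k) (0, y) := contDiffAt_covD hg0 hF0 hUs _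
  -- Interchanging the time derivative with D_a produces the curvature term R(φN, F_a)φN and turns
  -- D_t U into the acceleration.
  have hcomm : ∀ a, covD G F ((1 : ℝ), (0 : E m)) (D a) (0, y)
      = covD G S (ev a) (fun y => Acc (0, y)) y
        + φ y ^ 2 • riemV G (S y) (N y) (dvec (ev a) S y) (N y) := by
    intro a
    have h1 := covD_covD hg0 hF0 hUs ((1 : ℝ), (0 : E m)) ((0 : ℝ), ev a)
    rw [hTs, sub_eq_iff_eq_add'] at h1
    rw [← hAcc] at h1
    rw [covD_slice (F := F) hF0 hAs]
    refine h1.trans ?_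
    congr 1
    have h2 : U (0, y) = φ y • N y := hvel.self_of_nhds
    change riemV G (S y) (U (0, y)) (dvec (ev a) S y) (U (0, y)) = _
    rw [h2, riemV_smul, riemV_smul_right, smul_smul, pow_two]
  -- Only the tangential components of the acceleration are prescribed. Differentiating them gives
  -- the terms in α; the unknown normal component appears solely multiplied by the second
  -- fundamental form.
  have hdiv : ∀ a b, ip (G (S y)) (covD G S (ev a) (fun y => Acc (0, y)) y) (dvec (ev b) S y)
      = α * (pd a φ y * pd b φ y)
        + α * (φ y * (pd a (pd b φ) y - ∑ c, christoffel g c a b y * pd c φ y))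
        + sff G S N y a b * ip (G (S y)) (Acc (0, y)) (N y) := by
    intro a b
    have hA0 : ∀ k, ContDiffAt ℝ ∞ (fun x => Acc (0, x) k) y := fun k =>
      ContDiffAt.comp (g := fun z => Acc z k) y (hAs k) (contDiffAt_const.prodMk contDiffAt_id)
    have h1 := dd_ip hH0.metric hH0.map hA0 (contDiffAt_dvec hH0.map (ev b)) (ev a)
    have h2 : (fun x => ip (G (S x)) (Acc (0, x)) (dvec (ev b) S x)) =ᶠ[nhds y]
        fun x => α * (φ x * pd b φ x) := hacc.mono fun z hz => hz b
    have hpd : ContDiffAt ℝ ∞ (pd b φ) y := contDiffAt_dd hφ _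
    rw [dd_congr h2, dd_const_mul (diffAt (hφ.mul hpd)), dd_mul (diffAt hφ) (diffAt hpd),
      gauss_formula hH, sub_eq_add_neg, ip_add_right, ← neg_smul, ip_smul_right, ip_sum_right] at h1
    have h3 : ∀ c, ip (G (S y)) (Acc (0, y)) (christoffel g c a b y • dvec (ev c) S y)
        = α * (φ y * (christoffel g c a b y * pd c φ y)) := by
      intro c
      have := hacc.self_of_nhds c
      rw [ip_smul_right, this]; ring
    rw [← hg] at h1
    simp only [h3] at h1
    rw [← Finset.mul_sum, ← Finset.mul_sum, ← pd_eq_dd, ← pd_eq_dd] at h1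
    linarith
  have hder := fun a b => deriv_varMetric hG hF a b
  dsimp only at hder
  rw [← hU] at hder
  have hq : ∀ a b, ip (G (F (0, y))) (covD G F ((1 : ℝ), (0 : E m)) (D a) (0, y))
      (dvec ((0 : ℝ), ev b) F (0, y)) + ip (G (F (0, y))) (D a (0, y)) (D b (0, y))
      = (1 + α) * (pd a φ y * pd b φ y)
        + α * (φ y * (pd a (pd b φ) y - ∑ c, christoffel g c a b y * pd c φ y))
        + sff G S N y a b * ip (G (S y)) (Acc (0, y)) (N y)
        + φ y ^ 2 * ip (G (S y)) (riemV G (S y) (N y) (dvec (ev a) S y) (N y)) (dvec (ev b) S y)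
        + φ y ^ 2 * ip (G (S y)) (covD G S (ev a) N y) (covD G S (ev b) N y) := by
    intro a b
    rw [hcomm, hDD, hTs, ip_add_left, ip_smul_left]
    change ip (G (S y)) _ _ + _ + _ = _
    rw [hdiv]; ring
  set q : Matrix (Fin m) (Fin m) ℝ := Matrix.of fun a b =>
    ip (G (F (0, y))) (covD G F ((1 : ℝ), (0 : E m)) (D a) (0, y))
      (dvec ((0 : ℝ), ev b) F (0, y)) + ip (G (F (0, y))) (D a (0, y)) (D b (0, y)) with hqdef
  set B : Matrix (Fin m) (Fin m) ℝ := Matrix.of fun a b => sff G S N y a b with hB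
  have hBs : ∀ a b, B a b = B b a := fun a b => sff_symm hH a b
  have hsm : ∀ a b, ContDiffAt ℝ ∞ (fun t => varMetric G F (t, y) a b) 0 := by
    intro a b
    have h1 : ContDiffAt ℝ ∞ (fun z => varMetric G F z a b) (0, y) :=
      contDiffAt_ip hg0 hF0 (contDiffAt_dvec hF0 _) (contDiffAt_dvec hF0 _)
    exact ContDiffAt.comp (g := fun z => varMetric G F z a b) (0 : ℝ) h1
      (contDiffAt_id.prodMk contDiffAt_const)
  have htr : ∀ M : Matrix (Fin m) (Fin m) ℝ, ((g y)⁻¹ * M).trace = ∑ a, ∑ b, (g y)⁻¹ a b * M b a :=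
    fun M => by simp [Matrix.trace, Matrix.mul_apply]
  -- The first derivative of the metrics is 2φB, with trace 2φH = 0, as required. The second
  -- derivative is the symmetrization of q.
  have hmain := deriv_deriv_sqrt_det (A := fun t => varMetric G F (t, y)) hsm hdet
    (P := (2 * φ y) • B) (Q := q + q.transpose)
    (fun a b => by
      rw [(hder a b).1]
      change ip _ (D a (0, y)) _ + ip _ (D b (0, y)) _ = _
      rw [hTs, hTs, hDT, hDT, sff_symm hH b a]
      change _ = (2 * φ y) * sff G S N y a b
      ring)
    (fun a b => by rw [(hder a b).2]; rfl)
    (by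
      change (((varMetric G F (0, y))⁻¹) * _).trace = 0
      rw [hvar, Matrix.mul_smul, Matrix.trace_smul, htr]
      have : ∑ a, ∑ b, (g y)⁻¹ a b * B b a = meanCurv G S N y :=
        Finset.sum_congr rfl fun a _ => Finset.sum_congr rfl fun b _ => by rw [hBs b a]; rfl
      rw [this, hmin, smul_zero])
  rw [hmain, hvar]
  have ht1 : ((g y)⁻¹ * (q + q.transpose)).trace = 2 * ∑ a, ∑ b, (g y)⁻¹ a b * q a b := by
    have h1 : ∑ a, ∑ b, (g y)⁻¹ a b * q b a = ∑ a, ∑ b, (g y)⁻¹ a b * q a b := by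
      rw [Finset.sum_comm]
      exact Finset.sum_congr rfl fun a _ => Finset.sum_congr rfl fun b _ => by rw [hgI.inv_symm]
    rw [htr]
    simp only [Matrix.add_apply, Matrix.transpose_apply, mul_add, Finset.sum_add_distrib]
    rw [h1]; ring
  -- After the factor 1/2 this contributes -2φ²|B|². The trace of q below contains +φ²|B|², so
  -- -φ²|B|² remains.
  have ht2 : ((g y)⁻¹ * (2 * φ y) • B * (g y)⁻¹ * (2 * φ y) • B).trace
      = 4 * (φ y ^ 2 * sffSq G S N y) := by
    rw [Matrix.mul_smul, Matrix.mul_smul, Matrix.smul_mul, Matrix.smul_mul, smul_smul,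
      Matrix.trace_smul, Matrix.mul_assoc, Matrix.mul_assoc, htr]
    have : ∑ a, ∑ b, (g y)⁻¹ a b * (B * ((g y)⁻¹ * B)) b a = sffSq G S N y := by
      refine Finset.sum_congr rfl fun a _ => Finset.sum_congr rfl fun b _ => ?_
      rw [ip_covD_normal hH]
      congr 1
      rw [Matrix.mul_apply]
      simp only [Matrix.mul_apply, Finset.mul_sum]
      rw [Finset.sum_comm]
      refine Finset.sum_congr rfl fun c _ => Finset.sum_congr rfl fun d _ => ?_
      rw [hgI.inv_symm d c, hBs c a]
      change sff G S N y b d * (_ * sff G S N y a c) = _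
      ring
    rw [this, smul_eq_mul]; ring
  have ht3 : ∑ a, ∑ b, (g y)⁻¹ a b * q a b = (1 + α) * gradSq g φ y + α * (φ y * lap g φ y)
      - φ y ^ 2 * ric G (F (0, y)) (N y) (N y) + φ y ^ 2 * sffSq G S N y := by
    -- The normal component of the acceleration multiplies the mean curvature, so minimality removes
    -- it.
    have h1 : ∑ a, ∑ b, (g y)⁻¹ a b * q a b
        = (1 + α) * gradSq g φ y + α * (φ y * lap g φ y)
          + ip (G (S y)) (Acc (0, y)) (N y) * meanCurv G S N y
          + φ y ^ 2 * ∑ a, ∑ b, (g y)⁻¹ a b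
            * ip (G (S y)) (riemV G (S y) (N y) (dvec (ev a) S y) (N y)) (dvec (ev b) S y)
          + φ y ^ 2 * sffSq G S N y := by
      simp only [gradSq, lap, meanCurv, sffSq, Finset.mul_sum (s := Finset.univ),
        ← Finset.sum_add_distrib]
      refine Finset.sum_congr rfl fun a _ => Finset.sum_congr rfl fun b _ => ?_
      rw [show q a b = _ from hq a b, ← hg]
      simp only [mul_add, mul_sub, Finset.mul_sum]
      ring_nf
    have h2 := trace_riem_normal (G := G) (F := S) (N := N) (y := y) hG hH0
    rw [h1, hmin, h2]
    simp only [hS]; ring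
  rw [ht1, ht2, ht3]
  ring

/-- Upper bound for the second variation, by the Gauss equation. -/
theorem second_variation_le {φ : E m → ℝ} {c κ : ℝ} (hc : 2 ≤ c)
    (hG : ∀ᶠ q in nhds (F (0, y)), MetricAt G q)
    (hF : ∀ᶠ z in nhds ((0 : ℝ), y), ContDiffAt ℝ ∞ F z)
    (hH : ∀ᶠ z in nhds y, HyperAt G (fun y => F (0, y)) N z)
    (hφ : ContDiffAt ℝ ∞ φ y)
    (hvel : ∀ᶠ z in nhds y, dvec ((1 : ℝ), (0 : E m)) F (0, z) = φ z • N z)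
    (hacc : ∀ᶠ z in nhds y, ∀ a, ip (G (F (0, z)))
      (covD G F ((1 : ℝ), (0 : E m)) (dvec ((1 : ℝ), (0 : E m)) F) (0, z))
      (dvec (ev a) (fun y => F (0, y)) z) = (- (c / 2)) * (φ z * pd a φ z))
    (hmin : meanCurv G (fun y => F (0, y)) N y = 0)
    (hpos : (G (F (0, y))).PosSemidef) (hdet : 0 < (varMetric G F (0, y)).det)
    (hscal : -κ ≤ scalarCoord G (F (0, y))) :
    2 * deriv (deriv fun t => Real.sqrt ((varMetric G F (t, y)).det / (varMetric G F (0, y)).det)) 0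
      ≤ φ y ^ 2 * scalarCoord (indMetric G fun y => F (0, y)) y
        - c * (φ y * lap (indMetric G fun y => F (0, y)) φ y) + κ * φ y ^ 2 := by
  rw [second_variation hG hF hH hφ hvel hacc hmin hdet]
  have hgauss := gauss_traced (F := fun y => F (0, y)) hG hH
  rw [hmin] at hgauss
  have hinv : ((indMetric G fun y => F (0, y)) y)⁻¹.PosSemidef :=
    (gramOf_posSemidef hpos fun a => dvec (ev a) (fun y => F (0, y)) y).inv
  have h1 : 0 ≤ sffSq G (fun y => F (0, y)) N y :=
    sum_posDef_nonneg hinv (gramOf_posSemidef hpos fun a => covD G (fun y => F (0, y)) (ev a) N y)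
  have h2 : 0 ≤ gradSq (indMetric G fun y => F (0, y)) φ y := by
    refine sum_posDef_nonneg (B := Matrix.of fun a b => pd a φ y * pd b φ y) hinv ?_
    have := Matrix.posSemidef_vecMulVec_self_star (fun a => pd a φ y)
    convert this using 1
    ext a b
    simp [Matrix.vecMulVec_apply]
  have h3 := mul_nonneg (sub_nonneg.2 hc) h2
  have h4 := mul_nonneg (sq_nonneg (φ y)) h1
  -- With H = 0 the Gauss equation says 2 Ric(N,N) + |B|² = S_V - S_Σ. The second variation contains
  -- 2 Ric(N,N) + 2|B|²; the extra |B|² and the gradient term with factor 2 - c have the favourable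
  -- sign.
  have h5 : φ y ^ 2 * (2 * ric G (F (0, y)) (N y) (N y) + sffSq G (fun y => F (0, y)) N y)
      ≥ φ y ^ 2 * (-κ - scalarCoord (indMetric G fun y => F (0, y)) y) := by
    refine mul_le_mul_of_nonneg_left ?_ (sq_nonneg _)
    linarith
  nlinarith [h3, h4, h5]

end SecondVariation

/-! ### Conformal change of the scalar curvature -/

section Conformal

variable {m : ℕ} {g : E m → Matrix (Fin m) (Fin m) ℝ} {y : E m}

/-- The gradient `g^{kl} ∂_l f`. -/
def gradVec (g : E m → Matrix (Fin m) (Fin m) ℝ) (f : E m → ℝ) (k : Fin m) (y : E m) : ℝ :=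
  ∑ l, (g y)⁻¹ k l * pd l f y

theorem contDiffAt_pd {f : E m → ℝ} (hf : ContDiffAt ℝ ∞ f y) (i : Fin m) :
    ContDiffAt ℝ ∞ (pd i f) y := contDiffAt_dd hf _

theorem contDiffAt_gradVec (hg : MetricAt g y) {f : E m → ℝ} (hf : ContDiffAt ℝ ∞ f y) (k : Fin m) :
    ContDiffAt ℝ ∞ (gradVec g f k) y :=
  ContDiffAt.sum fun l _ => (contDiffAt_inv hg.smooth hg.det k l).mul (contDiffAt_pd hf l)

theorem lower_gradVec (hg : MetricAt g y) (f : E m → ℝ) (j : Fin m) :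
    ∑ k, g y j k * gradVec g f k y = pd j f y := by
  have h4 := congrFun (show (g y).mulVec ((g y)⁻¹.mulVec fun l => pd l f y) = _ by
    rw [Matrix.mulVec_mulVec, hg.mul_inv, Matrix.one_mulVec]) j
  exact h4

theorem gradSq_eq (g : E m → Matrix (Fin m) (Fin m) ℝ) (f : E m → ℝ) (y : E m) :
    gradSq g f y = ∑ k, pd k f y * gradVec g f k y := by
  simp only [gradSq, gradVec, Finset.mul_sum]
  exact Finset.sum_congr rfl fun a _ => Finset.sum_congr rfl fun b _ => by ring

/-- The Laplacian is the divergence of the gradient. -/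
theorem lap_eq_div (hg : ∀ᶠ z in nhds y, MetricAt g z) {f : E m → ℝ} (hf : ContDiffAt ℝ ∞ f y) :
    lap g f y = ∑ k, pd k (gradVec g f k) y
      + ∑ k, ∑ l, christoffel g k k l y * gradVec g f l y := by
  have hg0 := hg.self_of_nhds
  have hF := contDiffAt_gradVec hg0 hf
  -- The Hessian is the covariant derivative of the gradient with its index lowered, because the
  -- metric is parallel.
  have key : ∀ i j, pd i (pd j f) y - ∑ c, christoffel g c i j y * pd c f y
      = (g y).mulVec (fun s => pd i (gradVec g f s) y
        + ∑ l, christoffel g s i l y * gradVec g f l y) j := by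
    intro i j
    have h1 : pd i (pd j f) y
        = ∑ k, (pd i (fun z => g z j k) y * gradVec g f k y + g y j k * pd i (gradVec g f k) y) := by
      have h2 : pd j f =ᶠ[nhds y] fun z => ∑ k, g z j k * gradVec g f k z := by
        filter_upwards [hg] with z hz
        exact (lower_gradVec hz f j).symm
      rw [pd_eq_dd, dd_congr h2, dd_sum _ fun k _ => diffAt ((hg0.smooth j k).mul (hF k))]
      exact Finset.sum_congr rfl fun k _ => dd_mul (diffAt (hg0.smooth j k)) (diffAt (hF k)) _
    have h3 : ∑ c, christoffel g c i j y * pd c f y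
        = ∑ k, (∑ s, g y s k * christoffel g s i j y) * gradVec g f k y := by
      simp only [← lower_gradVec hg0 f, Finset.mul_sum, Finset.sum_mul]
      rw [Finset.sum_comm]
      exact Finset.sum_congr rfl fun k _ => Finset.sum_congr rfl fun s _ => by ring
    have h5 : ∑ k, (∑ s, g y j s * christoffel g s i k y) * gradVec g f k y
        = ∑ s, g y j s * ∑ l, christoffel g s i l y * gradVec g f l y := by
      simp only [Finset.mul_sum, Finset.sum_mul]
      rw [Finset.sum_comm]
      exact Finset.sum_congr rfl fun k _ => Finset.sum_congr rfl fun s _ => by ring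
    rw [h1, h3]
    simp only [Matrix.mulVec, dotProduct, mul_add, hg0.compat, add_mul, Finset.sum_add_distrib]
    rw [h5]; ring
  have h6 : ∀ i, ∑ j, (g y)⁻¹ i j * (pd i (pd j f) y - ∑ c, christoffel g c i j y * pd c f y)
      = pd i (gradVec g f i) y + ∑ l, christoffel g i i l y * gradVec g f l y := by
    intro i
    simp only [key]
    have h4 := congrFun (show (g y)⁻¹.mulVec ((g y).mulVec (fun s => pd i (gradVec g f s) y
        + ∑ l, christoffel g s i l y * gradVec g f l y)) = _ by
      rw [Matrix.mulVec_mulVec, hg0.inv_mul, Matrix.one_mulVec]) i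
    exact h4
  rw [lap, Finset.sum_congr rfl fun i _ => h6 i, Finset.sum_add_distrib]

/-- The difference of the Christoffel symbols of `e^{2f} g` and `g`. -/
def confC (g : E m → Matrix (Fin m) (Fin m) ℝ) (f : E m → ℝ) (k i j : Fin m) (y : E m) : ℝ :=
  (if k = j then pd i f y else 0) + (if k = i then pd j f y else 0) - g y i j * gradVec g f k y

/-- The inverse of e^{2f}g absorbs the exponential, and the Leibniz terms 2 ∂f · g contract with g⁻¹
to Kronecker deltas and a gradient. -/
theorem christoffel_conformal {g' : E m → Matrix (Fin m) (Fin m) ℝ} {f : E m → ℝ}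
    (hg : MetricAt g y) (hf : ContDiffAt ℝ ∞ f y)
    (hg' : ∀ᶠ z in nhds y, g' z = Real.exp (2 * f z) • g z) (k i j : Fin m) :
    christoffel g' k i j y = christoffel g k i j y + confC g f k i j y := by
  rw [christoffel_congr (G' := fun z => Real.exp (2 * f z) • g z) hg']
  have he : ContDiffAt ℝ ∞ (fun z => Real.exp (2 * f z)) y := (contDiffAt_const.mul hf).exp
  have hde : ∀ a, pd a (fun z => Real.exp (2 * f z)) y = 2 * Real.exp (2 * f y) * pd a f y := by
    intro a
    have h1 : HasFDerivAt (fun z => Real.exp (2 * f z)) _ y :=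
      ((hf.differentiableAt (by simp)).hasFDerivAt.const_mul 2).exp
    rw [pd, h1.fderiv]
    simp [pd]; ring
  have hd : ∀ a b c, pd a (fun z => (Real.exp (2 * f z) • g z) b c) y
      = Real.exp (2 * f y) * (2 * pd a f y * g y b c + pd a (fun z => g z b c) y) := by
    intro a b c
    have h2 : (fun z => (Real.exp (2 * f z) • g z) b c) = fun z => Real.exp (2 * f z) * g z b c := by
      funext z; simp
    rw [h2, pd_eq_dd, dd_mul (diffAt he) (diffAt (hg.smooth b c)), ← pd_eq_dd, ← pd_eq_dd, hde]
    ring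
  have hinv : ∀ a b, (Real.exp (2 * f y) • g y)⁻¹ a b = (Real.exp (2 * f y))⁻¹ * (g y)⁻¹ a b := by
    intro a b
    have : (Real.exp (2 * f y) • g y)⁻¹ = (Real.exp (2 * f y))⁻¹ • (g y)⁻¹ := by
      refine Matrix.inv_eq_left_inv ?_
      rw [Matrix.smul_mul, Matrix.mul_smul, smul_smul, hg.inv_mul,
        inv_mul_cancel₀ (Real.exp_pos _).ne', one_smul]
    rw [this]; simp
  have hδ : ∀ b, ∑ l, (g y)⁻¹ k l * g y b l = if k = b then 1 else 0 := by
    intro b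
    have := congrFun (congrFun hg.inv_mul k) b
    rw [Matrix.mul_apply, Matrix.one_apply] at this
    rw [← this]
    exact Finset.sum_congr rfl fun l _ => by rw [hg.symm y b l]
  have hfin : ∀ l, (Real.exp (2 * f y))⁻¹ * (g y)⁻¹ k l *
      (Real.exp (2 * f y) * (2 * pd i f y * g y j l + pd i (fun z => g z j l) y)
        + Real.exp (2 * f y) * (2 * pd j f y * g y i l + pd j (fun z => g z i l) y)
        - Real.exp (2 * f y) * (2 * pd l f y * g y i j + pd l (fun z => g z i j) y))
      = (g y)⁻¹ k l * (pd i (fun z => g z j l) y + pd j (fun z => g z i l) y - pd l (fun z => g z i j) y)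
        + (2 * pd i f y * ((g y)⁻¹ k l * g y j l) + 2 * pd j f y * ((g y)⁻¹ k l * g y i l)
          - 2 * g y i j * ((g y)⁻¹ k l * pd l f y)) := by
    intro l
    have := (Real.exp_pos (2 * f y)).ne'
    field_simp; ring
  simp only [christoffel, hinv, hd, hfin, Finset.sum_add_distrib, Finset.sum_sub_distrib,
    ← Finset.mul_sum, hδ, confC, gradVec]
  split_ifs <;> ring

/-! ### Index algebra of the conformal change at one point -/

section Algebra

variable (Γ : Fin m → Fin m → Fin m → ℝ) (a : Matrix (Fin m) (Fin m) ℝ) (p F : Fin m → ℝ)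

theorem sum_confC_trace (hF : ∀ j, ∑ k, a j k * F k = p j) (i : Fin m) :
    ∑ k, ((if k = k then p i else 0) + (if k = i then p k else 0) - a i k * F k) = m * p i := by
  simp [Finset.sum_add_distrib, hF]

theorem sum_confC_trace' (hF : ∀ j, ∑ k, a k j * F k = p j) (l : Fin m) :
    ∑ k, ((if k = l then p k else 0) + (if k = k then p l else 0) - a k l * F k) = m * p l := by
  simp [Finset.sum_add_distrib, hF]

/-- The algebra behind the conformal change of the Ricci tensor. -/
theorem ricci_conformal_algebra (ha : ∀ i j, a i j = a j i) (hF : ∀ j, ∑ k, a j k * F k = p j)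
    (hΓ : ∀ k i j, Γ k i j = Γ k j i) (i j : Fin m) :
    let C : Fin m → Fin m → Fin m → ℝ := fun k i j =>
      (if k = j then p i else 0) + (if k = i then p j else 0) - a i j * F k
    ∑ k, ∑ l, ((Γ k k l + C k k l) * (Γ l i j + C l i j) - (Γ k j l + C k j l) * (Γ l i k + C l i k))
      = ∑ k, ∑ l, (Γ k k l * Γ l i j - Γ k j l * Γ l i k)
        + (m - 2) * ∑ l, Γ l i j * p l - a i j * ∑ k, ∑ l, Γ k k l * F l
        + ∑ l, (∑ s, a s j * Γ s l i + ∑ s, a i s * Γ s l j) * F l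
        + (m - 2) * (p i * p j - a i j * ∑ l, p l * F l) := by
  intro C
  have hF' : ∀ j, ∑ k, a k j * F k = p j := fun j => by
    rw [← hF j]; exact Finset.sum_congr rfl fun k _ => by rw [ha]
  have hC1 : ∀ l, ∑ k, C k k l = m * p l := sum_confC_trace' a p F hF'
  -- The product splits into four sums linear in C and two quadratic ones. C consists of Kronecker
  -- deltas and of a ⊗ F, where a lowers F to p, so each sum collapses.
  have t1 : ∑ k, ∑ l, Γ k k l * C l i j = (∑ k, Γ k k j) * p i + (∑ k, Γ k k i) * p j
      - a i j * ∑ k, ∑ l, Γ k k l * F l := by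
    simp only [C, mul_sub, mul_add, Finset.sum_sub_distrib, Finset.sum_add_distrib, mul_ite, mul_zero,
      Finset.sum_ite_eq', Finset.mem_univ, if_true, Finset.sum_mul, Finset.mul_sum]
    congr 1
    exact Finset.sum_congr rfl fun k _ => Finset.sum_congr rfl fun l _ => by ring
  have t2 : ∑ k, ∑ l, C k k l * Γ l i j = m * ∑ l, Γ l i j * p l := by
    rw [Finset.sum_comm, Finset.mul_sum]
    exact Finset.sum_congr rfl fun l _ => by rw [← Finset.sum_mul, hC1]; ring
  have t3 : ∑ k, ∑ l, Γ k j l * C l i k = (∑ k, Γ k k j) * p i + ∑ k, Γ k i j * p k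
      - ∑ l, (∑ s, a i s * Γ s l j) * F l := by
    simp only [C, mul_sub, mul_add, Finset.sum_sub_distrib, Finset.sum_add_distrib, mul_ite, mul_zero,
      Finset.sum_ite_eq', Finset.mem_univ, if_true, Finset.sum_mul]
    congr 1
    · congr 1
      · exact Finset.sum_congr rfl fun k _ => by rw [hΓ k j k]
      · exact Finset.sum_congr rfl fun k _ => by rw [hΓ k j i]
    · rw [Finset.sum_comm]
      exact Finset.sum_congr rfl fun l _ => Finset.sum_congr rfl fun k _ => by rw [hΓ k j l]; ring
  have t4 : ∑ k, ∑ l, C k j l * Γ l i k = (∑ k, Γ k k i) * p j + ∑ k, Γ k i j * p k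
      - ∑ l, (∑ s, a s j * Γ s l i) * F l := by
    simp only [C, sub_mul, add_mul, Finset.sum_sub_distrib, Finset.sum_add_distrib, ite_mul, zero_mul,
      Finset.sum_ite_eq, Finset.mem_univ, if_true, Finset.sum_mul]
    congr 1
    · congr 1
      · exact Finset.sum_congr rfl fun k _ => by rw [hΓ k i k]; ring
      · rw [Finset.sum_comm]
        simp only [Finset.sum_ite_eq', Finset.mem_univ, if_true]
        exact Finset.sum_congr rfl fun k _ => by ring
    · exact Finset.sum_congr rfl fun k _ => Finset.sum_congr rfl fun l _ => by
        rw [hΓ l i k, ha j l]; ring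
  have t5 : ∑ k, ∑ l, C k k l * C l i j = m * (2 * p i * p j - a i j * ∑ l, p l * F l) := by
    rw [Finset.sum_comm]
    simp only [← Finset.sum_mul, hC1]
    simp only [C, mul_sub, mul_add, Finset.sum_sub_distrib, Finset.sum_add_distrib, mul_ite, mul_zero,
      Finset.sum_ite_eq', Finset.mem_univ, if_true, Finset.mul_sum]
    rw [show ∑ x, (m : ℝ) * p x * (a i j * F x) = ∑ x, (m : ℝ) * (a i j * (p x * F x)) from
      Finset.sum_congr rfl fun x _ => by ring]
    ring
  have t6 : ∑ k, ∑ l, C k j l * C l i k = (m + 2) * (p i * p j) - 2 * (a i j * ∑ l, p l * F l) := by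
    have e1 : ∀ k, ∑ l, C k j l * C l i k = p j * C k i k + (if k = j then ∑ l, p l * C l i k else 0)
        - F k * ∑ l, a j l * C l i k := by
      intro k
      simp only [C, sub_mul, add_mul, Finset.sum_sub_distrib, Finset.sum_add_distrib, ite_mul, zero_mul,
        Finset.sum_ite_eq, Finset.mem_univ, if_true, Finset.mul_sum]
      congr 1
      · split_ifs <;> simp
      · exact Finset.sum_congr rfl fun l _ => by ring
    have e2 : ∀ k, ∑ l, p l * C l i k = 2 * p i * p k - a i k * ∑ l, p l * F l := by
      intro k
      simp only [C, mul_sub, mul_add, Finset.sum_sub_distrib, Finset.sum_add_distrib, mul_ite, mul_zero,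
        Finset.sum_ite_eq', Finset.mem_univ, if_true, Finset.mul_sum]
      rw [show ∑ x, p x * (a i k * F x) = ∑ x, a i k * (p x * F x) from
        Finset.sum_congr rfl fun x _ => by ring]
      ring
    have e3 : ∀ k, ∑ l, a j l * C l i k = a j k * p i + a j i * p k - a i k * p j := by
      intro k
      simp only [C, mul_sub, mul_add, Finset.sum_sub_distrib, Finset.sum_add_distrib, mul_ite, mul_zero,
        Finset.sum_ite_eq', Finset.mem_univ, if_true]
      rw [show ∑ x, a j x * (a i k * F x) = a i k * ∑ x, a j x * F x from by
        rw [Finset.mul_sum]; exact Finset.sum_congr rfl fun x _ => by ring, hF]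
    have e4 : ∑ k, C k i k = m * p i := sum_confC_trace a p F hF i
    simp only [e1, e2, e3, Finset.sum_sub_distrib, Finset.sum_add_distrib, ← Finset.mul_sum, e4,
      Finset.sum_ite_eq', Finset.mem_univ, if_true]
    have e5 : ∑ k, F k * (a j k * p i + a j i * p k - a i k * p j)
        = p i * (∑ k, a j k * F k) + a i j * (∑ k, p k * F k) - p j * ∑ k, a i k * F k := by
      simp only [Finset.mul_sum, ← Finset.sum_add_distrib, ← Finset.sum_sub_distrib]
      exact Finset.sum_congr rfl fun k _ => by rw [ha j i]; ring
    rw [e5, hF, hF]; ring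
  have expand : ∀ k l, (Γ k k l + C k k l) * (Γ l i j + C l i j) - (Γ k j l + C k j l) * (Γ l i k + C l i k)
      = (Γ k k l * Γ l i j - Γ k j l * Γ l i k) + Γ k k l * C l i j + C k k l * Γ l i j
        - Γ k j l * C l i k - C k j l * Γ l i k + C k k l * C l i j - C k j l * C l i k := by
    intro k l; ring
  rw [Finset.sum_congr rfl fun k _ => Finset.sum_congr rfl fun l _ => expand k l]
  simp only [Finset.sum_add_distrib, Finset.sum_sub_distrib, t1, t2, t3, t4, t5, t6]
  have t7 : ∑ l, (∑ s, a s j * Γ s l i + ∑ s, a i s * Γ s l j) * F l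
      = ∑ l, (∑ s, a s j * Γ s l i) * F l + ∑ l, (∑ s, a i s * Γ s l j) * F l := by
    rw [← Finset.sum_add_distrib]
    exact Finset.sum_congr rfl fun l _ => add_mul _ _ _
  rw [t7]
  ring

end Algebra

/-- Conformal change of the Ricci tensor. -/
theorem ricci_conformal {g' : E m → Matrix (Fin m) (Fin m) ℝ} {f : E m → ℝ}
    (hg : ∀ᶠ z in nhds y, MetricAt g z) (hf : ∀ᶠ z in nhds y, ContDiffAt ℝ ∞ f z)
    (hg' : ∀ᶠ z in nhds y, g' z = Real.exp (2 * f z) • g z) (i j : Fin m) :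
    ricciCoord g' i j y = ricciCoord g i j y
      - (m - 2) * (pd i (pd j f) y - ∑ c, christoffel g c i j y * pd c f y - pd i f y * pd j f y)
      - (lap g f y + (m - 2) * gradSq g f y) * g y i j := by
  have hg0 := hg.self_of_nhds
  have hf0 := hf.self_of_nhds
  have hF := contDiffAt_gradVec hg0 hf0
  have hchr : ∀ k i j, ∀ᶠ z in nhds y, christoffel g' k i j z
      = christoffel g k i j z + confC g f k i j z := by
    intro k i j
    filter_upwards [hg, hf, hg'.eventually_nhds] with z h1 h2 h3
    exact christoffel_conformal h1 h2 h3 k i j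
  have hCs : ∀ k i j, ContDiffAt ℝ ∞ (confC g f k i j) y := by
    intro k i j
    refine ContDiffAt.sub (ContDiffAt.add ?_ ?_) ((hg0.smooth i j).mul (hF k))
    · split_ifs
      exacts [contDiffAt_pd hf0 i, contDiffAt_const]
    · split_ifs
      exacts [contDiffAt_pd hf0 j, contDiffAt_const]
  have hpdC : ∀ s k i j, pd s (christoffel g' k i j) y
      = pd s (christoffel g k i j) y + pd s (confC g f k i j) y := by
    intro s k i j
    rw [pd_eq_dd, dd_congr (hchr k i j),
      dd_add (diffAt (hg0.contDiffAt_christoffel k i j)) (diffAt (hCs k i j))]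
    rfl
  -- The contraction of the difference tensor is m ∂_i f near y, not only at y, so it may be
  -- differentiated.
  have hd1 : ∑ k, pd j (confC g f k i k) y = m * pd i (pd j f) y := by
    have h1 : (fun z => ∑ k, confC g f k i k z) =ᶠ[nhds y] fun z => m * pd i f z := by
      filter_upwards [hg] with z hz
      exact sum_confC_trace (g z) (fun l => pd l f z) (fun k => gradVec g f k z)
        (lower_gradVec hz f) i
    have h2 := dd_congr h1 (ev j)
    rw [dd_sum _ fun k _ => diffAt (hCs k i k), dd_const_mul (diffAt (contDiffAt_pd hf0 i))] at h2
    rw [show pd i (pd j f) y = dd (ev j) (pd i f) y from dd_comm hf0 _ _]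
    exact h2
  have hd2 : ∑ k, pd k (confC g f k i j) y = 2 * pd i (pd j f) y
      - ∑ k, pd k (fun z => g z i j) y * gradVec g f k y
      - g y i j * ∑ k, pd k (gradVec g f k) y := by
    have hcom : pd j (pd i f) y = pd i (pd j f) y := dd_comm hf0 _ _
    have h1 : ∀ k, pd k (confC g f k i j) y = (if k = j then pd k (pd i f) y else 0)
        + (if k = i then pd k (pd j f) y else 0)
        - (pd k (fun z => g z i j) y * gradVec g f k y + g y i j * pd k (gradVec g f k) y) := by
      intro k
      have e1 : ContDiffAt ℝ ∞ (fun z => if k = j then pd i f z else 0) y := by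
        split_ifs
        exacts [contDiffAt_pd hf0 i, contDiffAt_const]
      have e2 : ContDiffAt ℝ ∞ (fun z => if k = i then pd j f z else 0) y := by
        split_ifs
        exacts [contDiffAt_pd hf0 j, contDiffAt_const]
      have h3 : pd k (confC g f k i j) y = _ :=
        dd_sub (diffAt (e1.add e2)) (diffAt ((hg0.smooth i j).mul (hF k))) (ev k)
      rw [h3, dd_add (diffAt e1) (diffAt e2), dd_mul (diffAt (hg0.smooth i j)) (diffAt (hF k))]
      congr 1
      congr 1
      · split_ifs
        exacts [rfl, dd_const _ _ _]
      · split_ifs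
        exacts [rfl, dd_const _ _ _]
    simp only [h1, Finset.sum_sub_distrib, Finset.sum_add_distrib, Finset.sum_ite_eq', Finset.mem_univ,
      if_true, hcom, ← Finset.mul_sum]
    ring
  have halg := ricci_conformal_algebra (fun k i j => christoffel g k i j y) (g y) (fun l => pd l f y)
    (fun k => gradVec g f k y) (hg0.symm y) (lower_gradVec hg0 f)
    (fun k i j => christoffel_symm hg0.symm k i j y) i j
  -- Metric compatibility makes the terms in ∂g from `hd2` cancel against the mixed terms of `halg`.
  -- What remains of the gradient and its divergence is the Laplacian.
  have hcompat : ∀ l, pd l (fun z => g z i j) y = ∑ s, g y s j * christoffel g s l i y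
      + ∑ s, g y i s * christoffel g s l j y := fun l => hg0.compat l i j
  dsimp only at halg
  have hquad := (Finset.sum_congr rfl fun k _ => Finset.sum_congr rfl fun l _ => by
    rw [(hchr k k l).self_of_nhds, (hchr l i j).self_of_nhds, (hchr k j l).self_of_nhds,
      (hchr l i k).self_of_nhds]
    rfl :
    ∑ k, ∑ l, (christoffel g' k k l y * christoffel g' l i j y
        - christoffel g' k j l y * christoffel g' l i k y) = _).trans halg
  rw [lap_eq_div hg hf0, gradSq_eq, ricciCoord, hquad, ricciCoord]
  simp only [hpdC, Finset.sum_sub_distrib, Finset.sum_add_distrib, hd1, hd2, hcompat]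
  ring

/-- Conformal change of the scalar curvature. -/
theorem scalar_conformal {g' : E m → Matrix (Fin m) (Fin m) ℝ} {f : E m → ℝ}
    (hg : ∀ᶠ z in nhds y, MetricAt g z) (hf : ∀ᶠ z in nhds y, ContDiffAt ℝ ∞ f z)
    (hg' : ∀ᶠ z in nhds y, g' z = Real.exp (2 * f z) • g z) :
    Real.exp (2 * f y) * scalarCoord g' y = scalarCoord g y - 2 * (m - 1) * lap g f y
      - (m - 1) * (m - 2) * gradSq g f y := by
  have hg0 := hg.self_of_nhds
  have hinv : ∀ a b, Real.exp (2 * f y) * (g' y)⁻¹ a b = (g y)⁻¹ a b := by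
    intro a b
    have : (g' y)⁻¹ = (Real.exp (2 * f y))⁻¹ • (g y)⁻¹ := by
      rw [hg'.self_of_nhds]
      refine Matrix.inv_eq_left_inv ?_
      rw [Matrix.smul_mul, Matrix.mul_smul, smul_smul, hg0.inv_mul,
        inv_mul_cancel₀ (Real.exp_pos _).ne', one_smul]
    rw [this, Matrix.smul_apply, smul_eq_mul, ← mul_assoc, mul_inv_cancel₀ (Real.exp_pos _).ne',
      one_mul]
  have htr : ∑ i, ∑ j, (g y)⁻¹ i j * g y i j = m := by
    have h1 : ((g y)⁻¹ * g y).trace = m := by rw [hg0.inv_mul]; simp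
    rw [← h1, Matrix.trace]
    simp only [Matrix.diag_apply, Matrix.mul_apply]
    exact Finset.sum_congr rfl fun i _ => Finset.sum_congr rfl fun j _ => by rw [hg0.symm y i j]
  have h2 : Real.exp (2 * f y) * scalarCoord g' y
      = ∑ i, ∑ j, ((g y)⁻¹ i j * ricciCoord g i j y
        - (m - 2) * ((g y)⁻¹ i j * (pd i (pd j f) y - ∑ c, christoffel g c i j y * pd c f y))
        + (m - 2) * ((g y)⁻¹ i j * (pd i f y * pd j f y))
        - (lap g f y + (m - 2) * gradSq g f y) * ((g y)⁻¹ i j * g y i j)) := by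
    simp only [scalarCoord, Finset.mul_sum (s := Finset.univ) (a := Real.exp (2 * f y)), ← mul_assoc, hinv]
    refine Finset.sum_congr rfl fun i _ => Finset.sum_congr rfl fun j _ => ?_
    rw [ricci_conformal hg hf hg']; ring
  rw [h2]
  simp only [Finset.sum_sub_distrib, Finset.sum_add_distrib, ← Finset.mul_sum, htr]
  change scalarCoord g y - (m - 2) * lap g f y + (m - 2) * gradSq g f y - _ = _
  ring

/-- The conformal Laplacian. -/
theorem scalar_conformal_pow {g' : E m → Matrix (Fin m) (Fin m) ℝ} {φ : E m → ℝ} (hm : 2 < m)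
    (hg : ∀ᶠ z in nhds y, MetricAt g z) (hφ : ∀ᶠ z in nhds y, ContDiffAt ℝ ∞ φ z)
    (hpos : ∀ z, 0 < φ z)
    (hg' : ∀ᶠ z in nhds y, g' z = (φ z ^ (4 / ((m : ℝ) - 2))) • g z) :
    φ y ^ 2 * ((φ y ^ (4 / ((m : ℝ) - 2))) * scalarCoord g' y) = φ y ^ 2 * scalarCoord g y
      - 4 * (m - 1) / (m - 2) * (φ y * lap g φ y) := by
  have hm2 : (0 : ℝ) < (m : ℝ) - 2 := by
    have : (2 : ℝ) < m := by exact_mod_cast hm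
    linarith
  -- The value for which e^{2f} is the given power of φ. The coefficient (m-1)β(2 - (m-2)β) of
  -- |∇φ|²/φ² then vanishes, and only Δφ remains.
  set β : ℝ := 2 / ((m : ℝ) - 2) with hβ
  set f : E m → ℝ := fun z => β * Real.log (φ z) with hf
  have hexp : ∀ z, Real.exp (2 * f z) = φ z ^ (4 / ((m : ℝ) - 2)) := by
    intro z
    rw [Real.rpow_def_of_pos (hpos z), hf, hβ]
    congr 1; ring
  have hfs : ∀ᶠ z in nhds y, ContDiffAt ℝ ∞ f z := by
    filter_upwards [hφ] with z hz
    exact contDiffAt_const.mul (hz.log (hpos z).ne')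
  have hpd : ∀ i, ∀ᶠ z in nhds y, pd i f z = β * (pd i φ z * (φ z)⁻¹) := by
    intro i
    filter_upwards [hφ] with z hz
    have h1 : HasFDerivAt f _ z :=
      ((hz.differentiableAt (by simp)).hasFDerivAt.log (hpos z).ne').const_mul β
    rw [pd, h1.fderiv]
    change β * ((φ z)⁻¹ * pd i φ z) = _
    ring
  have hφ0 := hφ.self_of_nhds
  have hφy := (hpos y).ne'
  have hinvs : ContDiffAt ℝ ∞ (fun z => (φ z)⁻¹) y := hφ0.inv hφy
  have hdinv : ∀ i, dd (ev i) (fun z => (φ z)⁻¹) y = - pd i φ y * ((φ y)⁻¹) ^ 2 := by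
    intro i
    have h1 := (hasDerivAt_inv hφy).comp_hasFDerivAt y (hφ0.differentiableAt (by simp)).hasFDerivAt
    have h2 : HasFDerivAt (fun z => (φ z)⁻¹) _ y := h1
    rw [dd, h2.fderiv]
    simp [pd]; ring
  have hpd2 : ∀ i j, pd i (pd j f) y
      = β * (pd i (pd j φ) y * (φ y)⁻¹ - pd i φ y * pd j φ y * ((φ y)⁻¹) ^ 2) := by
    intro i j
    have hs := contDiffAt_pd hφ0 j
    rw [pd_eq_dd, dd_congr (hpd j), dd_const_mul (diffAt (hs.mul hinvs)),
      dd_mul (diffAt hs) (diffAt hinvs), hdinv, ← pd_eq_dd]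
    ring
  have hlap : lap g f y = β * (lap g φ y * (φ y)⁻¹ - gradSq g φ y * ((φ y)⁻¹) ^ 2) := by
    simp only [lap, gradSq, Finset.sum_mul, ← Finset.sum_sub_distrib, Finset.mul_sum (a := β)]
    refine Finset.sum_congr rfl fun i _ => Finset.sum_congr rfl fun j _ => ?_
    have h1 : ∑ c, christoffel g c i j y * pd c f y
        = β * (φ y)⁻¹ * ∑ c, christoffel g c i j y * pd c φ y := by
      rw [Finset.mul_sum]
      exact Finset.sum_congr rfl fun c _ => by rw [(hpd c).self_of_nhds]; ring
    rw [hpd2, h1]; ring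
  have hgrad : gradSq g f y = β ^ 2 * (gradSq g φ y * ((φ y)⁻¹) ^ 2) := by
    simp only [gradSq, Finset.sum_mul, Finset.mul_sum (a := β ^ 2)]
    refine Finset.sum_congr rfl fun i _ => Finset.sum_congr rfl fun j _ => ?_
    rw [(hpd i).self_of_nhds, (hpd j).self_of_nhds]; ring
  have hmain := scalar_conformal hg hfs (g' := g') (by
    filter_upwards [hg'] with z hz
    rw [hz, hexp])
  rw [hexp, hlap, hgrad] at hmain
  rw [hmain, hβ]
  have := hm2.ne'
  field_simp
  ring

end Conformal

/-! ### Charts -/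

section Charts

variable {d : ℕ} {M : Type*} [TopologicalSpace M] [ChartedSpace (E d) M] [IsManifold (𝓡 d) ∞ M]

/-- The coordinate representation of a tangent vector at `x` in the preferred chart at `p`. -/
def chartVec (p x : M) (v : TangentSpace (𝓡 d) x) : E d :=
  mfderiv (𝓡 d) (𝓡 d) (extChartAt (𝓡 d) p) x v

/-- The components of a tangent vector at `x` in the preferred chart at `p`. -/
def comps (p x : M) (v : TangentSpace (𝓡 d) x) : Fin d → ℝ :=
  fun k => chartVec p x v k

theorem comps_add (p x : M) (v w : TangentSpace (𝓡 d) x) :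
    comps p x (v + w) = comps p x v + comps p x w := by
  funext k; simp only [comps, chartVec, map_add]; rfl

theorem comps_smul (p x : M) (c : ℝ) (v : TangentSpace (𝓡 d) x) :
    comps p x (c • v) = c • comps p x v := by
  funext k; simp only [comps, chartVec, map_smul]; rfl

theorem isManifold_one : IsManifold (𝓡 d) 1 M := IsManifold.of_le (n := ∞) (by
  exact WithTop.coe_le_coe.2 le_top)

theorem mdifferentiableAt_chart {p x : M} (hx : x ∈ (extChartAt (𝓡 d) p).source) :
    MDifferentiableAt (𝓡 d) (𝓡 d) (extChartAt (𝓡 d) p) x := by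
  have : IsManifold (𝓡 d) 1 M := isManifold_one
  rw [extChartAt_source] at hx
  exact mdifferentiableAt_extChartAt hx

theorem contMDiffAt_chart_symm {p : M} {y : E d} (hy : y ∈ (extChartAt (𝓡 d) p).target) :
    ContMDiffAt (𝓡 d) (𝓡 d) ∞ (extChartAt (𝓡 d) p).symm y :=
  (contMDiffOn_extChartAt_symm p).contMDiffAt ((isOpen_extChartAt_target p).mem_nhds hy)

theorem contMDiffAt_chart {p x : M} (hx : x ∈ (extChartAt (𝓡 d) p).source) :
    ContMDiffAt (𝓡 d) (𝓡 d) ∞ (extChartAt (𝓡 d) p) x := by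
  rw [extChartAt_source] at hx
  exact contMDiffAt_extChartAt' hx

theorem mdifferentiableAt_chart_symm {p : M} {y : E d} (hy : y ∈ (extChartAt (𝓡 d) p).target) :
    MDifferentiableAt (𝓡 d) (𝓡 d) (extChartAt (𝓡 d) p).symm y :=
  (contMDiffAt_chart_symm hy).mdifferentiableAt (by simp)

/-- Components of the image of a tangent vector. -/
theorem comps_mfderiv {d' : ℕ} {M' : Type*} [TopologicalSpace M'] [ChartedSpace (E d') M']
    [IsManifold (𝓡 d') ∞ M'] {f : M → M'} {p : M} {q : M'} {y : E d}
    (hy : y ∈ (extChartAt (𝓡 d) p).target)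
    (hf : MDifferentiableAt (𝓡 d) (𝓡 d') f ((extChartAt (𝓡 d) p).symm y))
    (hq : f ((extChartAt (𝓡 d) p).symm y) ∈ (extChartAt (𝓡 d') q).source) (a : Fin d) :
    comps q (f ((extChartAt (𝓡 d) p).symm y)) (mfderiv (𝓡 d) (𝓡 d') f _ (coordVec p y a))
      = dvec (ev a) (fun y => extChartAt (𝓡 d') q (f ((extChartAt (𝓡 d) p).symm y))) y := by
  have h1 := mdifferentiableAt_chart_symm hy
  have h2 := mdifferentiableAt_chart hq
  have h3 := mfderiv_comp y (h2.comp _ hf) h1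
  have h4 := mfderiv_comp ((extChartAt (𝓡 d) p).symm y) h2 hf
  have hd : MDifferentiableAt (𝓡 d) (𝓡 d') (((extChartAt (𝓡 d') q) ∘ f) ∘ (extChartAt (𝓡 d) p).symm) y :=
    (h2.comp _ hf).comp y h1
  funext k
  have h5 : dvec (ev a) (fun y => extChartAt (𝓡 d') q (f ((extChartAt (𝓡 d) p).symm y))) y k
      = (fderiv ℝ (((extChartAt (𝓡 d') q) ∘ f) ∘ (extChartAt (𝓡 d) p).symm) y (ev a)) k :=
    dd_coord hd.differentiableAt _ _
  rw [h5, ← mfderiv_eq_fderiv, h3, h4]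
  rfl

theorem comps_coordVec {p q : M} {y : E d} (hy : y ∈ (extChartAt (𝓡 d) p).target)
    (hq : (extChartAt (𝓡 d) p).symm y ∈ (extChartAt (𝓡 d) q).source) (a : Fin d) :
    comps q ((extChartAt (𝓡 d) p).symm y) (coordVec p y a)
      = dvec (ev a) (fun y => extChartAt (𝓡 d) q ((extChartAt (𝓡 d) p).symm y)) y := by
  have h := comps_mfderiv (f := fun x : M => x) (q := q) hy
    (mdifferentiableAt_id : MDifferentiableAt (𝓡 d) (𝓡 d) (id : M → M) _) hq a
  rw [← h]
  congr 1
  have : mfderiv (𝓡 d) (𝓡 d) (fun x : M => x) ((extChartAt (𝓡 d) p).symm y) = _ := mfderiv_id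
  rw [this]; rfl

theorem comps_coordVec_self {p : M} {y : E d} (hy : y ∈ (extChartAt (𝓡 d) p).target) (a : Fin d) :
    comps p ((extChartAt (𝓡 d) p).symm y) (coordVec p y a) = Pi.single a 1 := by
  rw [comps_coordVec hy ((extChartAt (𝓡 d) p).map_target hy)]
  funext k
  have h : (fun z => extChartAt (𝓡 d) p ((extChartAt (𝓡 d) p).symm z) k) =ᶠ[nhds y] fun z => z k := by
    filter_upwards [(isOpen_extChartAt_target p).mem_nhds hy] with z hz
    rw [(extChartAt (𝓡 d) p).right_inv hz]
  rw [dvec, dd_congr h, dd_coord (F := fun z : E d => z) differentiableAt_id]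
  simp [Pi.single_apply]

theorem comps_injective {p x : M} (hx : x ∈ (extChartAt (𝓡 d) p).source) :
    Function.Injective (comps (d := d) p x) := by
  have : IsManifold (𝓡 d) 1 M := isManifold_one
  intro v w h
  obtain ⟨e, he⟩ := isInvertible_mfderiv_extChartAt (I := 𝓡 d) hx
  have h2 : chartVec p x v = chartVec p x w := PiLp.ext fun k => congrFun h k
  rw [chartVec, chartVec, ← he] at h2
  exact e.injective h2

theorem comps_sum_coordVec {p : M} {y : E d} (hy : y ∈ (extChartAt (𝓡 d) p).target)
    (w : Fin d → ℝ) :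
    comps p ((extChartAt (𝓡 d) p).symm y) (∑ a, w a • coordVec p y a) = w := by
  have h := map_sum (⟨⟨comps p _, comps_add p _⟩, comps_smul p _⟩ :
    TangentSpace (𝓡 d) ((extChartAt (𝓡 d) p).symm y) →ₗ[ℝ] (Fin d → ℝ))
    (fun a => w a • coordVec p y a) Finset.univ
  refine Eq.trans h ?_
  change ∑ a, comps p _ (w a • coordVec p y a) = _
  funext k
  simp only [comps_smul, comps_coordVec_self hy, Finset.sum_apply, Pi.smul_apply, smul_eq_mul,
    Pi.single_apply, mul_ite, mul_one, mul_zero, Finset.sum_ite_eq, Finset.mem_univ, if_true]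

/-- Expansion of a tangent vector in the coordinate basis. -/
theorem eq_sum_coordVec {p : M} {y : E d} (hy : y ∈ (extChartAt (𝓡 d) p).target)
    (v : TangentSpace (𝓡 d) ((extChartAt (𝓡 d) p).symm y)) :
    v = ∑ a, comps p ((extChartAt (𝓡 d) p).symm y) v a • coordVec p y a := by
  apply comps_injective ((extChartAt (𝓡 d) p).map_target hy)
  rw [comps_sum_coordVec hy]

/-- A field of forms that is bilinear at each point. -/
def IsBilin (h : ∀ x : M, TangentSpace (𝓡 d) x → TangentSpace (𝓡 d) x → ℝ) : Prop :=
  ∀ x, ∃ B : TangentSpace (𝓡 d) x →ₗ[ℝ] TangentSpace (𝓡 d) x →ₗ[ℝ] ℝ, ∀ u v, h x u v = B u v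

/-- The bridge from forms on the manifold to matrix calculus. Only bilinearity is required, since
the pull-back under an arbitrary map may be degenerate. -/
theorem eq_ip_gram {h : ∀ x : M, TangentSpace (𝓡 d) x → TangentSpace (𝓡 d) x → ℝ} (hh : IsBilin h)
    {q x : M} (hx : x ∈ (extChartAt (𝓡 d) q).source) (u v : TangentSpace (𝓡 d) x) :
    h x u v = ip (gram h q (extChartAt (𝓡 d) q x)) (comps q x u) (comps q x v) := by
  obtain ⟨z, hz, rfl⟩ : ∃ z ∈ (extChartAt (𝓡 d) q).target, (extChartAt (𝓡 d) q).symm z = x :=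
    ⟨_, (extChartAt (𝓡 d) q).map_source hx, (extChartAt (𝓡 d) q).left_inv hx⟩
  rw [(extChartAt (𝓡 d) q).right_inv hz]
  obtain ⟨B, hB⟩ := hh ((extChartAt (𝓡 d) q).symm z)
  conv_lhs => rw [eq_sum_coordVec hz u, eq_sum_coordVec hz v]
  rw [hB]
  simp only [map_sum, LinearMap.sum_apply, map_smul, LinearMap.smul_apply, smul_eq_mul, ip, gram,
    Matrix.of_apply, hB, Finset.mul_sum]
  rw [Finset.sum_comm]
  exact Finset.sum_congr rfl fun k _ => Finset.sum_congr rfl fun l _ => by ring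

/-- Transformation of the Gram matrix under a change of charts. -/
theorem gram_change {h : ∀ x : M, TangentSpace (𝓡 d) x → TangentSpace (𝓡 d) x → ℝ} (hh : IsBilin h)
    {p q : M} {y : E d} (hy : y ∈ (extChartAt (𝓡 d) p).target)
    (hq : (extChartAt (𝓡 d) p).symm y ∈ (extChartAt (𝓡 d) q).source) :
    gram h p y
      = indMetric (gram h q) (fun y => extChartAt (𝓡 d) q ((extChartAt (𝓡 d) p).symm y)) y := by
  ext a b
  change h _ _ _ = ip _ _ _
  rw [eq_ip_gram hh hq, comps_coordVec hy hq, comps_coordVec hy hq]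

theorem isBilin_form (g : RMetric d M) : IsBilin (form g) := fun x =>
  ⟨LinearMap.mk₂ ℝ (fun u v => g.inner x u v) (by simp) (by simp) (by simp) (by simp), fun _ _ => rfl⟩

theorem form_symm (g : RMetric d M) (x : M) (u v : TangentSpace (𝓡 d) x) :
    form g x u v = form g x v u := g.symm x u v

variable {n : ℕ} {V : Type*} [TopologicalSpace V] [ChartedSpace (E n) V] [IsManifold (𝓡 n) ∞ V]

theorem isBilin_pullback (g : RMetric n V) (f : M → V) : IsBilin (pullbackForm (m := d) g f) := fun x =>
  ⟨LinearMap.mk₂ ℝ (fun u v => g.inner (f x) (mfderiv (𝓡 d) (𝓡 n) f x u) (mfderiv (𝓡 d) (𝓡 n) f x v))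
    (by simp) (by simp) (by simp) (by simp), fun _ _ => rfl⟩

/-- The Gram matrix of a pull-back metric. -/
theorem gram_pullback (g : RMetric n V) {f : M → V} {p : M} {q : V} {y : E d}
    (hy : y ∈ (extChartAt (𝓡 d) p).target)
    (hf : MDifferentiableAt (𝓡 d) (𝓡 n) f ((extChartAt (𝓡 d) p).symm y))
    (hq : f ((extChartAt (𝓡 d) p).symm y) ∈ (extChartAt (𝓡 n) q).source) :
    gram (pullbackForm (m := d) g f) p y = indMetric (gram (form g) q)
      (fun y => extChartAt (𝓡 n) q (f ((extChartAt (𝓡 d) p).symm y))) y := by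
  ext a b
  change form g _ _ _ = ip _ _ _
  rw [eq_ip_gram (isBilin_form g) hq, comps_mfderiv hy hf hq, comps_mfderiv hy hf hq]

theorem contDiffAt_transition {p q : M} {y : E d} (hy : y ∈ (extChartAt (𝓡 d) p).target)
    (hq : (extChartAt (𝓡 d) p).symm y ∈ (extChartAt (𝓡 d) q).source) :
    ContDiffAt ℝ ∞ (fun y => extChartAt (𝓡 d) q ((extChartAt (𝓡 d) p).symm y)) y :=
  contMDiffAt_iff_contDiffAt.1 ((contMDiffAt_chart hq).comp y (contMDiffAt_chart_symm hy))

theorem chart_source_nhds {p : M} {y : E d} (hy : y ∈ (extChartAt (𝓡 d) p).target) {U : Set M}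
    (hU : IsOpen U) (hyU : (extChartAt (𝓡 d) p).symm y ∈ U) :
    ∀ᶠ z in nhds y, z ∈ (extChartAt (𝓡 d) p).target ∧ (extChartAt (𝓡 d) p).symm z ∈ U :=
  ((isOpen_extChartAt_target p).eventually_mem hy).and
    ((contMDiffAt_chart_symm hy).continuousAt.eventually (hU.mem_nhds hyU))

/-- Smoothness of a vector field along a map, in a chart. -/
theorem contMDiffAt_tangent_iff {d' : ℕ} {M' : Type*} [TopologicalSpace M'] [ChartedSpace (E d') M']
    {b : M' → M} {v : ∀ x, TangentSpace (𝓡 d) (b x)} {q : M} {x : M'}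
    (hb : ContMDiffAt (𝓡 d') (𝓡 d) ∞ b x) (hx : b x ∈ (extChartAt (𝓡 d) q).source) :
    ContMDiffAt (𝓡 d') (𝓡 d).tangent ∞ (fun x => (⟨b x, v x⟩ : TangentBundle (𝓡 d) M)) x ↔
      ContMDiffAt (𝓡 d') (𝓡 d) ∞
        (fun x => chartVec q (b x) (v x)) x := by
  have : IsManifold (𝓡 d) 1 M := isManifold_one
  have hsrc : b x ∈ (trivializationAt (E d) (TangentSpace (𝓡 d)) q).baseSet := by
    rw [extChartAt_source] at hx
    exact hx
  have he : (⟨b x, v x⟩ : TangentBundle (𝓡 d) M) ∈ (trivializationAt (E d) (TangentSpace (𝓡 d)) q).source := by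
    rw [Bundle.Trivialization.mem_source]; exact hsrc
  refine (Bundle.Trivialization.contMDiffAt_iff
    (f := fun x => (⟨b x, v x⟩ : TangentBundle (𝓡 d) M)) he).trans ?_
  have hev : (fun x => ((trivializationAt (E d) (TangentSpace (𝓡 d)) q) (⟨b x, v x⟩ : TangentBundle (𝓡 d) M)).2)
      =ᶠ[nhds x] fun x => chartVec q (b x) (v x) := by
    have hc := hb.continuousAt.eventually ((isOpen_extChartAt_source q).mem_nhds hx)
    filter_upwards [hc] with z hz
    rw [extChartAt_source] at hz
    have h := TangentBundle.continuousLinearMapAt_trivializationAt (I := 𝓡 d) hz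
    have h' : (trivializationAt (E d) (TangentSpace (𝓡 d)) q).continuousLinearMapAt ℝ (b z) (v z)
        = chartVec q (b z) (v z) := by rw [h]; rfl
    rw [← h', Bundle.Trivialization.continuousLinearMapAt_apply,
      Bundle.Trivialization.linearMapAt_apply, if_pos]
    exact hz
  constructor
  · rintro ⟨_, h2⟩
    exact h2.congr_of_eventuallyEq hev.symm
  · intro h
    exact ⟨hb, h.congr_of_eventuallyEq hev⟩

theorem contMDiffAt_coordVec {p : M} {y : E d} (hy : y ∈ (extChartAt (𝓡 d) p).target) (a : Fin d) :
    ContMDiffAt (𝓡 d) (𝓡 d).tangent ∞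
      (fun y => (⟨(extChartAt (𝓡 d) p).symm y, coordVec p y a⟩ : TangentBundle (𝓡 d) M)) y := by
  have hs := (extChartAt (𝓡 d) p).map_target hy
  rw [contMDiffAt_tangent_iff (contMDiffAt_chart_symm hy) hs]
  refine (contMDiffAt_const (c := (ev a : E d))).congr_of_eventuallyEq ?_
  filter_upwards [(isOpen_extChartAt_target p).mem_nhds hy] with z hz
  have h := comps_coordVec_self hz a
  refine PiLp.ext fun k => ?_
  have := congrFun h k
  rw [comps] at this
  rw [this]; simp [Pi.single_apply]

/-- Smoothness of the coefficients of a Riemannian metric. -/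
theorem contDiffAt_gram (g : RMetric d M) {p : M} {y : E d} (hy : y ∈ (extChartAt (𝓡 d) p).target)
    (a b : Fin d) : ContDiffAt ℝ ∞ (fun y => gram (form g) p y a b) y := by
  have h := ContMDiffAt.clm_bundle_apply₂ (E₃ := Bundle.Trivial M ℝ) (F₃ := ℝ)
    (g.contMDiff.contMDiffAt.comp y (contMDiffAt_chart_symm hy))
    (contMDiffAt_coordVec hy a) (contMDiffAt_coordVec hy b)
  rw [Bundle.contMDiffAt_totalSpace] at h
  exact contMDiffAt_iff_contDiffAt.1 h.2

theorem gram_form_posDef (g : RMetric d M) {p : M} {y : E d} (hy : y ∈ (extChartAt (𝓡 d) p).target) :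
    (gram (form g) p y).PosDef := by
  refine Matrix.PosDef.of_dotProduct_mulVec_pos ?_ fun w hw => ?_
  · ext a b
    exact form_symm g _ _ _
  · set v : TangentSpace (𝓡 d) ((extChartAt (𝓡 d) p).symm y) := ∑ a, w a • coordVec p y a with hv
    have hc : comps p _ v = w := comps_sum_coordVec hy w
    have hv0 : v ≠ 0 := by
      rintro h0
      apply hw
      rw [← hc, h0]
      have h := comps_smul p _ 0 (0 : TangentSpace (𝓡 d) ((extChartAt (𝓡 d) p).symm y))
      rwa [zero_smul, zero_smul] at h
    have := g.pos _ v hv0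
    change 0 < form g _ v v at this
    rw [eq_ip_gram (isBilin_form g) ((extChartAt (𝓡 d) p).map_target hy), hc,
      (extChartAt (𝓡 d) p).right_inv hy, ip_eq_mulVec] at this
    simpa using this

theorem metricAt_gram (g : RMetric d M) {p : M} {y : E d} (hy : y ∈ (extChartAt (𝓡 d) p).target) :
    MetricAt (gram (form g) p) y where
  smooth a b := contDiffAt_gram g hy a b
  symm _ _ _ := form_symm g _ _ _
  det := (gram_form_posDef g hy).det_pos.ne'

end Charts

/-! ### Volume -/

section Volume

/-- Each μ_j is carried by U_j and agrees there with μ_i on subsets of U_i. So the supremum is at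
most μ_i plus the largest measure on the complement of U_i, and the latter disappears on restriction
to U_i. -/
theorem restrict_iSup_of_compatible {α ι : Type*} [MeasurableSpace α] {μ : ι → Measure α}
    {U : ι → Set α} (hU : ∀ i, MeasurableSet (U i)) (h0 : ∀ i, μ i (U i)ᶜ = 0)
    (hc : ∀ i j, ∀ A, MeasurableSet A → A ⊆ U i → A ⊆ U j → μ i A = μ j A) (i : ι) :
    (⨆ j, μ j).restrict (U i) = μ i := by
  have hres : (μ i).restrict (U i) = μ i := Measure.restrict_eq_self_of_ae_mem (h0 i)
  apply le_antisymm
  · have hle : (⨆ j, μ j) ≤ μ i + (⊤ : Measure α).restrict (U i)ᶜ := by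
      refine iSup_le fun j => Measure.le_iff.2 fun A hA => ?_
      have h1 : μ j (A ∩ U i) ≤ μ i A := by
        calc μ j (A ∩ U i) ≤ μ j ((A ∩ U i) ∩ U j) + μ j (U j)ᶜ := by
              refine (measure_mono ?_).trans (measure_union_le _ _)
              intro x hx
              by_cases hj : x ∈ U j
              · exact Or.inl ⟨hx, hj⟩
              · exact Or.inr hj
          _ = μ i ((A ∩ U i) ∩ U j) := by
              rw [h0, add_zero, hc i j _ ((hA.inter (hU i)).inter (hU j))
                (fun x hx => hx.1.2) (fun x hx => hx.2)]
          _ ≤ μ i A := measure_mono fun x hx => hx.1.1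
      have h2 : μ j (A \ U i) ≤ (⊤ : Measure α).restrict (U i)ᶜ A := by
        rw [Measure.restrict_apply hA]
        exact (le_top : μ j ≤ ⊤) _
      rw [Measure.add_apply, ← measure_inter_add_sdiff A (hU i)]
      exact add_le_add h1 h2
    refine (Measure.restrict_mono_measure hle (U i)).trans ?_
    rw [Measure.restrict_add, hres, Measure.restrict_restrict (hU i)]
    simp
  · rw [← hres]
    exact Measure.restrict_mono_measure (le_iSup μ i) _

/-- The induced matrix is Jᵀ G J with J the Jacobian matrix of τ. -/
theorem det_indMetric {d : ℕ} (G : E d → Matrix (Fin d) (Fin d) ℝ) (τ : E d → E d) {y : E d}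
    (hτ : DifferentiableAt ℝ τ y) :
    (indMetric G τ y).det = (fderiv ℝ τ y).det ^ 2 * (G (τ y)).det := by
  set J : Matrix (Fin d) (Fin d) ℝ := Matrix.of fun i a => dvec (ev a) τ y i with hJ
  have h1 : indMetric G τ y = J.transpose * G (τ y) * J := by
    ext a b
    simp only [indMetric, gramOf, Matrix.of_apply, ip, Matrix.mul_apply, Matrix.transpose_apply, hJ,
      Finset.sum_mul]
    rw [Finset.sum_comm]
    exact Finset.sum_congr rfl fun k _ => Finset.sum_congr rfl fun l _ => by ring
  have h2 : (fderiv ℝ τ y).det = J.det := by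
    rw [ContinuousLinearMap.det, ← LinearMap.det_toMatrix (EuclideanSpace.basisFun (Fin d) ℝ).toBasis]
    congr 1
    ext i a
    rw [LinearMap.toMatrix_apply]
    simp only [hJ, Matrix.of_apply, dvec]
    rw [dd_coord hτ]
    simp [ev]
  rw [h1, h2, Matrix.det_mul, Matrix.det_mul, Matrix.det_transpose]
  ring

variable {d : ℕ} {M : Type*} [TopologicalSpace M] [ChartedSpace (E d) M]
  [MeasurableSpace M] [BorelSpace M]

theorem continuousOn_symm_measurableSet (p : M) {A : Set M} (hA : MeasurableSet A) :
    MeasurableSet ((extChartAt (𝓡 d) p).symm ⁻¹' A ∩ (extChartAt (𝓡 d) p).target) := by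
  have ht := (isOpen_extChartAt_target (I := 𝓡 d) p).measurableSet
  have hm : Measurable ((extChartAt (𝓡 d) p).target.domRestrict (extChartAt (𝓡 d) p).symm) :=
    (continuousOn_iff_continuous_domRestrict.1 (continuousOn_extChartAt_symm p)).measurable
  have := MeasurableSet.subtype_image ht (hm hA)
  convert this using 1
  ext y
  simp [Set.domRestrict, and_comm]

theorem aemeasurable_chart_symm (p : M) (f : E d → ℝ≥0∞) :
    AEMeasurable (extChartAt (𝓡 d) p).symm
      ((volume.restrict (extChartAt (𝓡 d) p).target).withDensity f) :=
  ((continuousOn_extChartAt_symm p).aemeasurable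
    (isOpen_extChartAt_target p).measurableSet).mono_ac (withDensity_absolutelyContinuous _ _)

theorem chartMeasure_apply (h : ∀ x : M, TangentSpace (𝓡 d) x → TangentSpace (𝓡 d) x → ℝ) (p : M)
    {A : Set M} (hA : MeasurableSet A) :
    chartMeasure h p A = ∫⁻ y in (extChartAt (𝓡 d) p).symm ⁻¹' A ∩ (extChartAt (𝓡 d) p).target,
      ENNReal.ofReal (Real.sqrt (gram h p y).det) := by
  rw [chartMeasure, Measure.map_apply_of_aemeasurable (aemeasurable_chart_symm p _) hA,
    withDensity_apply', Measure.restrict_restrict' (isOpen_extChartAt_target p).measurableSet]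

theorem chartMeasure_compl (h : ∀ x : M, TangentSpace (𝓡 d) x → TangentSpace (𝓡 d) x → ℝ) (p : M) :
    chartMeasure h p (extChartAt (𝓡 d) p).sourceᶜ = 0 := by
  rw [chartMeasure_apply h p (isOpen_extChartAt_source p).measurableSet.compl]
  have : (extChartAt (𝓡 d) p).symm ⁻¹' (extChartAt (𝓡 d) p).sourceᶜ ∩ (extChartAt (𝓡 d) p).target
      = ∅ := by
    ext y
    simp only [mem_inter_iff, mem_preimage, mem_compl_iff, mem_empty_iff_false, iff_false, not_and]
    exact fun h1 h2 => h1 ((extChartAt (𝓡 d) p).map_target h2)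
  rw [this]; simp

variable [IsManifold (𝓡 d) ∞ M]

/-- Change of variables along the transition map: √det of the Gram matrix picks up exactly the
absolute Jacobian determinant. -/
theorem chartMeasure_eq_of_subset {h : ∀ x : M, TangentSpace (𝓡 d) x → TangentSpace (𝓡 d) x → ℝ}
    (hh : IsBilin h) (p q : M) {A : Set M} (hA : MeasurableSet A)
    (hp : A ⊆ (extChartAt (𝓡 d) p).source) (hq : A ⊆ (extChartAt (𝓡 d) q).source) :
    chartMeasure h p A = chartMeasure h q A := by
  rw [chartMeasure_apply h p hA, chartMeasure_apply h q hA]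
  set P := extChartAt (𝓡 d) p
  set Q := extChartAt (𝓡 d) q
  set τ : E d → E d := fun y => Q (P.symm y)
  have himg : Q.symm ⁻¹' A ∩ Q.target = τ '' (P.symm ⁻¹' A ∩ P.target) := by
    ext z
    constructor
    · rintro ⟨hz, hz'⟩
      refine ⟨P (Q.symm z), ⟨?_, P.map_source (hp hz)⟩, ?_⟩
      · change P.symm (P (Q.symm z)) ∈ A
        rw [P.left_inv (hp hz)]; exact hz
      · change Q (P.symm (P (Q.symm z))) = z
        rw [P.left_inv (hp hz), Q.right_inv hz']
    · rintro ⟨y, ⟨hy, hy'⟩, rfl⟩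
      refine ⟨?_, Q.map_source (hq hy)⟩
      change Q.symm (Q (P.symm y)) ∈ A
      rw [Q.left_inv (hq hy)]; exact hy
  have hd : ∀ y ∈ P.symm ⁻¹' A ∩ P.target, DifferentiableAt ℝ τ y := fun y hy =>
    (contDiffAt_transition hy.2 (hq hy.1)).differentiableAt (by simp)
  have hinj : InjOn τ (P.symm ⁻¹' A ∩ P.target) := by
    rintro y ⟨hy, hy'⟩ z ⟨hz, hz'⟩ hyz
    exact P.symm.injOn hy' hz' (Q.injOn (hq hy) (hq hz) hyz)
  rw [himg, lintegral_image_eq_lintegral_abs_det_fderiv_mul volume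
    (continuousOn_symm_measurableSet p hA)
    (fun y hy => (hd y hy).hasFDerivAt.hasFDerivWithinAt) hinj]
  refine setLIntegral_congr_fun (continuousOn_symm_measurableSet p hA) fun y hy => ?_
  rw [gram_change hh hy.2 (hq hy.1), det_indMetric _ _ (hd y hy), ← ENNReal.ofReal_mul (abs_nonneg _),
    Real.sqrt_mul (sq_nonneg _), Real.sqrt_sq_eq_abs]

theorem volumeMeasure_restrict {h : ∀ x : M, TangentSpace (𝓡 d) x → TangentSpace (𝓡 d) x → ℝ}
    (hh : IsBilin h) (p : M) :
    (volumeMeasure h).restrict (extChartAt (𝓡 d) p).source = chartMeasure h p :=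
  restrict_iSup_of_compatible (fun q => (isOpen_extChartAt_source q).measurableSet)
    (chartMeasure_compl h) (fun i j _ hA => chartMeasure_eq_of_subset hh i j hA) p

theorem continuousOn_det_gram (g : RMetric d M) (p : M) :
    ContinuousOn (fun y => Real.sqrt (gram (form g) p y).det) (extChartAt (𝓡 d) p).target :=
  fun _ hy => ((contDiffAt_det fun a b => contDiffAt_gram g hy a b).continuousAt.sqrt).continuousWithinAt

theorem chartMeasure_withDensity (g : RMetric d M)
    {h : ∀ x : M, TangentSpace (𝓡 d) x → TangentSpace (𝓡 d) x → ℝ} {r : M → ℝ} (hr : Measurable r)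
    (hr0 : ∀ x, 0 ≤ r x) (p : M)
    (hrh : ∀ y ∈ (extChartAt (𝓡 d) p).target, Real.sqrt (gram h p y).det
      = r ((extChartAt (𝓡 d) p).symm y) * Real.sqrt (gram (form g) p y).det) :
    chartMeasure h p = (chartMeasure (form g) p).withDensity fun x => ENNReal.ofReal (r x) := by
  ext A hA
  have ht := (isOpen_extChartAt_target (I := 𝓡 d) p).measurableSet
  have hs := continuousOn_symm_measurableSet (d := d) p hA
  have hc : AEMeasurable (fun y => ENNReal.ofReal (Real.sqrt (gram (form g) p y).det))
      (volume.restrict (extChartAt (𝓡 d) p).target) :=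
    ((continuousOn_det_gram g p).aemeasurable ht).ennreal_ofReal
  have hrs : AEMeasurable (fun y => ENNReal.ofReal (r ((extChartAt (𝓡 d) p).symm y)))
      (volume.restrict (extChartAt (𝓡 d) p).target) :=
    (hr.comp_aemeasurable ((continuousOn_extChartAt_symm p).aemeasurable ht)).ennreal_ofReal
  rw [chartMeasure_apply h p hA, withDensity_apply _ hA, chartMeasure,
    ← lintegral_indicator hA, lintegral_map' ((hr.ennreal_ofReal.indicator hA).aemeasurable)
      (aemeasurable_chart_symm p _), lintegral_withDensity_eq_lintegral_mul₀ hc,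
    ← lintegral_indicator hs, ← lintegral_indicator ht]
  · congr 1
    funext y
    by_cases hy : y ∈ (extChartAt (𝓡 d) p).target
    · rw [indicator_of_mem hy]
      by_cases hA' : (extChartAt (𝓡 d) p).symm y ∈ A
      · rw [indicator_of_mem (show y ∈ _ ∩ _ from ⟨hA', hy⟩), hrh y hy, ENNReal.ofReal_mul (hr0 _), mul_comm]
        simp only [Pi.mul_apply]
        rw [indicator_of_mem hA']
      · rw [indicator_of_notMem (fun h => hA' h.1)]
        simp only [Pi.mul_apply]
        rw [indicator_of_notMem hA', mul_zero]
    · rw [indicator_of_notMem hy, indicator_of_notMem (fun h => hy h.2)]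
  · exact (hr.ennreal_ofReal.indicator hA).comp_aemeasurable
      ((continuousOn_extChartAt_symm p).aemeasurable ht)

theorem exists_finite_chart_cover [CompactSpace M] :
    ∃ s : Finset M, ⋃ p ∈ s, (extChartAt (𝓡 d) p).source = univ := by
  obtain ⟨s, hs⟩ := isCompact_univ.elim_nhds_subcover (fun p : M => (extChartAt (𝓡 d) p).source)
    (fun p _ => extChartAt_source_mem_nhds p)
  exact ⟨s, univ_subset_iff.1 hs.2⟩

/-- Comparison of volume measures. -/
theorem volumeMeasure_withDensity [CompactSpace M] (g : RMetric d M)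
    {h : ∀ x : M, TangentSpace (𝓡 d) x → TangentSpace (𝓡 d) x → ℝ} (hh : IsBilin h)
    {r : M → ℝ} (hr : Measurable r) (hr0 : ∀ x, 0 ≤ r x)
    (hrh : ∀ p : M, ∀ y ∈ (extChartAt (𝓡 d) p).target, Real.sqrt (gram h p y).det
      = r ((extChartAt (𝓡 d) p).symm y) * Real.sqrt (gram (form g) p y).det) :
    volumeMeasure h = (volumeMeasure (form g)).withDensity fun x => ENNReal.ofReal (r x) := by
  obtain ⟨s, hs⟩ := exists_finite_chart_cover (d := d) (M := M)
  refine Measure.ext_of_biUnion_eq_univ s.countable_toSet hs fun p _ => ?_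
  rw [volumeMeasure_restrict hh, restrict_withDensity (isOpen_extChartAt_source p).measurableSet,
    volumeMeasure_restrict (isBilin_form g), chartMeasure_withDensity g hr hr0 p (hrh p)]

/-- The density is continuous, hence bounded on a small coordinate ball around each point;
compactness passes from locally finite to finite. -/
instance isFiniteMeasure_volumeMeasure [CompactSpace M] (g : RMetric d M) :
    IsFiniteMeasure (volumeMeasure (form g)) := by
  refine ⟨isCompact_univ.measure_lt_top_of_nhdsWithin fun x _ => ?_⟩
  set P := extChartAt (𝓡 d) x with hP
  have hx := mem_extChartAt_target (I := 𝓡 d) x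
  have hc : ContinuousAt (fun y => Real.sqrt (gram (form g) x y).det) (P x) :=
    (continuousOn_det_gram g x).continuousAt ((isOpen_extChartAt_target x).mem_nhds hx)
  set C := Real.sqrt (gram (form g) x (P x)).det + 1
  have h1 : ∀ᶠ y in nhds (P x), Real.sqrt (gram (form g) x y).det < C :=
    hc.eventually_lt_const (lt_add_one _)
  obtain ⟨ε, hε, hb⟩ := Metric.eventually_nhds_iff_ball.1 h1
  have hA : IsOpen (P.source ∩ P ⁻¹' Metric.ball (P x) ε) :=
    (continuousOn_extChartAt x).isOpen_inter_preimage (isOpen_extChartAt_source x) Metric.isOpen_ball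
  refine ⟨_, mem_nhdsWithin_of_mem_nhds (hA.mem_nhds
    ⟨mem_extChartAt_source x, Metric.mem_ball_self hε⟩), ?_⟩
  have h2 : volumeMeasure (form g) (P.source ∩ P ⁻¹' Metric.ball (P x) ε)
      = chartMeasure (form g) x (P.source ∩ P ⁻¹' Metric.ball (P x) ε) := by
    rw [← volumeMeasure_restrict (isBilin_form g) x, Measure.restrict_apply hA.measurableSet]
    congr 1
    ext z; simp only [mem_inter_iff]; tauto
  rw [h2, chartMeasure_apply _ _ hA.measurableSet]
  calc _ ≤ ∫⁻ y in P.symm ⁻¹' (P.source ∩ P ⁻¹' Metric.ball (P x) ε) ∩ P.target, ENNReal.ofReal C := by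
        refine setLIntegral_mono' (continuousOn_symm_measurableSet x hA.measurableSet) fun y hy => ?_
        refine ENNReal.ofReal_le_ofReal (hb y ?_).le
        have := hy.1.2
        rwa [mem_preimage, P.right_inv hy.2] at this
    _ ≤ ∫⁻ y in Metric.ball (P x) ε, ENNReal.ofReal C := by
        refine lintegral_mono_set fun y hy => ?_
        have := hy.1.2
        rwa [mem_preimage, P.right_inv hy.2] at this
    _ < ⊤ := by
        rw [setLIntegral_const]
        exact ENNReal.mul_lt_top ENNReal.ofReal_lt_top measure_ball_lt_top

end Volume

/-! ### Curves with prescribed velocity and acceleration -/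

section Jets

variable {n : ℕ}

theorem dd_one_eq_deriv (f : ℝ → ℝ) (t : ℝ) : dd (1 : ℝ) f t = deriv f t :=
  fderiv_apply_one_eq_deriv

theorem eventually_differentiableAt {X Y : Type*} [NormedAddCommGroup X] [NormedSpace ℝ X]
    [NormedAddCommGroup Y] [NormedSpace ℝ Y] {f : X → Y} {x : X} (hf : ContDiffAt ℝ ∞ f x) :
    ∀ᶠ y in nhds x, DifferentiableAt ℝ f y :=
  ((hf.of_le (m := 1) (WithTop.coe_le_coe.2 le_top)).eventually (by simp)).mono
    fun _ h => h.differentiableAt (by simp)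

theorem dvec_comp {X : Type*} [NormedAddCommGroup X] [NormedSpace ℝ X] {n' : ℕ} {τ : E n → E n'}
    {F : X → E n} {x : X} (hτ : DifferentiableAt ℝ τ (F x)) (hF : DifferentiableAt ℝ F x) (v : X) :
    dvec v (fun x => τ (F x)) x = ∑ i, dvec v F x i • dvec (ev i) τ (F x) := by
  funext k
  have hk : DifferentiableAt ℝ (fun z => τ z k) (F x) := (differentiableAt_piLp 2).1 hτ k
  simp only [dvec, Finset.sum_apply, Pi.smul_apply, smul_eq_mul]
  rw [dd_comp (f := fun z => τ z k) hk hF]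
  exact Finset.sum_congr rfl fun i _ => mul_comm _ _

theorem dvec_congr {X : Type*} [NormedAddCommGroup X] [NormedSpace ℝ X] {F F' : X → E n} {x : X}
    (h : F =ᶠ[nhds x] F') (v : X) : dvec v F x = dvec v F' x :=
  funext fun k => dd_congr (h.fun_comp fun z : E n => z k) v

/-- The acceleration in the metric `G`. -/
def accel (G : E n → Matrix (Fin n) (Fin n) ℝ) (c : ℝ → E n) : Fin n → ℝ :=
  covD G c 1 (dvec 1 c) 0

theorem accel_congr {G : E n → Matrix (Fin n) (Fin n) ℝ} {c c' : ℝ → E n}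
    (h : c =ᶠ[nhds 0] c') : accel G c = accel G c' := by
  have h1 : dvec 1 c =ᶠ[nhds 0] dvec 1 c' := h.eventuallyEq_nhds.mono fun t ht => dvec_congr ht 1
  funext k
  rw [accel, accel, covD_congr h1, covD_apply, covD_apply, dvec_congr h, h.self_of_nhds]

theorem accel_metric_congr {G G' : E n → Matrix (Fin n) (Fin n) ℝ} {c : ℝ → E n}
    (h : G =ᶠ[nhds (c 0)] G') : accel G c = accel G' c := by
  funext k
  simp only [accel, covD_apply, chr, christoffel_congr h]

/-- The acceleration transforms as a vector. The chain rule for the velocity holds only near time 0,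
which is enough for one more differentiation there. -/
theorem accel_comp {G : E n → Matrix (Fin n) (Fin n) ℝ} {τ : E n → E n} {c : ℝ → E n}
    (hG : MetricAt G (τ (c 0))) (hτ : ContDiffAt ℝ ∞ τ (c 0)) (hc : ContDiffAt ℝ ∞ c 0)
    (hd : (indMetric G τ (c 0)).det ≠ 0) :
    accel G (fun t => τ (c t)) = ∑ i, accel (indMetric G τ) c i • dvec (ev i) τ (c 0) := by
  have h : dvec 1 (fun t => τ (c t)) =ᶠ[nhds 0] fun t => ∑ i, dvec 1 c t i • dvec (ev i) τ (c t) := by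
    have h1 := hc.continuousAt.eventually (eventually_differentiableAt hτ)
    filter_upwards [h1, eventually_differentiableAt hc] with t ht ht'
    exact dvec_comp ht ht' 1
  rw [accel, covD_congr h, covD_comp hG hτ hc hd (contDiffAt_dvec hc 1)]
  rfl

theorem dvec_push {c : ℝ → E n} {t : ℝ} (hc : DifferentiableAt ℝ c t) (χ : ℝ) (a b : E n) (k : Fin n) :
    dvec 1 (fun t => c t + χ • (t • a + t ^ 2 • b)) t k = dvec 1 c t k + χ * (a k + 2 * t * b k) := by
  have h1 : HasDerivAt (fun t : ℝ => χ * (t * a k + t ^ 2 * b k)) (χ * (1 * a k + (2 * t) * b k)) t := by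
    have := ((hasDerivAt_id t).mul_const (a k)).add (((hasDerivAt_id t).pow 2).mul_const (b k))
    simpa using this.const_mul χ
  have hck : DifferentiableAt ℝ (fun t => c t k) t := (differentiableAt_piLp 2).1 hc k
  change dd 1 (fun t => c t k + χ * (t * a k + t ^ 2 * b k)) t = _
  rw [dd_add hck h1.differentiableAt, dd_one_eq_deriv _ t, dd_one_eq_deriv _ t, h1.deriv]
  simp only [dvec, dd_one_eq_deriv]
  ring

/-- The correction t²b adds 2χb to the coordinate acceleration. The point at time 0 does not move,
so the Christoffel term changes only through the new velocity. -/
theorem accel_push {G : E n → Matrix (Fin n) (Fin n) ℝ} {c : ℝ → E n} (hc : ContDiffAt ℝ ∞ c 0)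
    (χ : ℝ) (a b : E n) (k : Fin n) :
    accel G (fun t => c t + χ • (t • a + t ^ 2 • b)) k
      = dd 1 (fun t => dvec 1 c t k) 0 + 2 * χ * b k
        + chr G (c 0) (dvec 1 c 0 + χ • a.ofLp) (dvec 1 c 0 + χ • a.ofLp) k := by
  have h1 : (fun t => dvec 1 (fun t => c t + χ • (t • a + t ^ 2 • b)) t k) =ᶠ[nhds 0]
      fun t => dvec 1 c t k + χ * (a k + 2 * t * b k) := by
    filter_upwards [eventually_differentiableAt hc] with t ht
    exact dvec_push ht χ a b k
  have h2 : HasDerivAt (fun t : ℝ => χ * (a k + 2 * t * b k)) (2 * χ * b k) 0 := by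
    have := ((((hasDerivAt_id (0 : ℝ)).const_mul 2).mul_const (b k)).const_add (a k)).const_mul χ
    exact this.congr_deriv (by ring)
  have h3 : dvec 1 (fun t => c t + χ • (t • a + t ^ 2 • b)) 0 = dvec 1 c 0 + χ • a.ofLp := by
    funext k
    rw [dvec_push (hc.differentiableAt (by simp))]
    simp
  rw [accel, covD_apply, dd_congr h1, dd_add (diffAt (contDiffAt_dvec hc 1 k)) h2.differentiableAt,
    dd_one_eq_deriv (fun t : ℝ => χ * (a k + 2 * t * b k)), h2.deriv, h3]
  simp

variable {V : Type*} [TopologicalSpace V] [ChartedSpace (E n) V] [IsManifold (𝓡 n) ∞ V]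

/-- A smooth curve through `p` with velocity `w` and covariant acceleration `z` at time `0`. -/
structure HasJet (g : RMetric n V) (γ : ℝ → V) (p : V) (w z : TangentSpace (𝓡 n) p) : Prop where
  smooth : ContMDiffAt 𝓘(ℝ, ℝ) (𝓡 n) ∞ γ 0
  zero : γ 0 = p
  velocity : ∀ q, p ∈ (extChartAt (𝓡 n) q).source →
    dvec 1 (fun t => extChartAt (𝓡 n) q (γ t)) 0 = comps q p w
  acceleration : ∀ q, p ∈ (extChartAt (𝓡 n) q).source →
    accel (gram (form g) q) (fun t => extChartAt (𝓡 n) q (γ t)) = comps q p z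

theorem comps_change {q r x : V} (hq : x ∈ (extChartAt (𝓡 n) q).source)
    (hr : x ∈ (extChartAt (𝓡 n) r).source) (v : TangentSpace (𝓡 n) x) :
    comps r x v = ∑ i, comps q x v i • dvec (ev i)
      (fun y => extChartAt (𝓡 n) r ((extChartAt (𝓡 n) q).symm y)) (extChartAt (𝓡 n) q x) := by
  obtain ⟨y, hy, rfl⟩ : ∃ y ∈ (extChartAt (𝓡 n) q).target, (extChartAt (𝓡 n) q).symm y = x :=
    ⟨_, (extChartAt (𝓡 n) q).map_source hq, (extChartAt (𝓡 n) q).left_inv hq⟩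
  rw [(extChartAt (𝓡 n) q).right_inv hy]
  have h := map_sum (⟨⟨comps r _, comps_add r _⟩, comps_smul r _⟩ :
    TangentSpace (𝓡 n) ((extChartAt (𝓡 n) q).symm y) →ₗ[ℝ] (Fin n → ℝ))
    (fun a => comps q _ v a • coordVec q y a) Finset.univ
  conv_lhs => rw [eq_sum_coordVec hy v]
  refine Eq.trans h (Finset.sum_congr rfl fun i _ => ?_)
  refine Eq.trans (comps_smul r _ _ _) ?_
  rw [comps_coordVec hy hr]

theorem contDiffAt_chart_curve {γ : ℝ → V} {t : ℝ} (hγ : ContMDiffAt 𝓘(ℝ, ℝ) (𝓡 n) ∞ γ t) {q : V}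
    (hq : γ t ∈ (extChartAt (𝓡 n) q).source) :
    ContDiffAt ℝ ∞ (fun t => extChartAt (𝓡 n) q (γ t)) t :=
  contMDiffAt_iff_contDiffAt.1 ((contMDiffAt_chart hq).comp t hγ)

/-- The conditions on the velocity and on the acceleration can be checked in one chart. -/
theorem HasJet.of_chart {g : RMetric n V} {γ : ℝ → V} {p : V} {w z : TangentSpace (𝓡 n) p}
    (hs : ContMDiffAt 𝓘(ℝ, ℝ) (𝓡 n) ∞ γ 0) (h0 : γ 0 = p) {q : V}
    (hq : p ∈ (extChartAt (𝓡 n) q).source)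
    (hv : dvec 1 (fun t => extChartAt (𝓡 n) q (γ t)) 0 = comps q p w)
    (ha : accel (gram (form g) q) (fun t => extChartAt (𝓡 n) q (γ t)) = comps q p z) :
    HasJet g γ p w z := by
  subst h0
  set Q := extChartAt (𝓡 n) q
  have hc := contDiffAt_chart_curve hs hq
  have key : ∀ r, γ 0 ∈ (extChartAt (𝓡 n) r).source →
      (fun t => extChartAt (𝓡 n) r (γ t)) =ᶠ[nhds 0]
        fun t => extChartAt (𝓡 n) r (Q.symm (Q (γ t))) := by
    intro r hr
    filter_upwards [hs.continuousAt.eventually ((isOpen_extChartAt_source q).mem_nhds hq)] with t ht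
    rw [Q.left_inv ht]
  have htr : ∀ r, γ 0 ∈ (extChartAt (𝓡 n) r).source →
      ContDiffAt ℝ ∞ (fun y => extChartAt (𝓡 n) r (Q.symm y)) (Q (γ 0)) := fun r hr =>
    contDiffAt_transition (Q.map_source hq) (by rwa [Q.left_inv hq])
  refine ⟨hs, rfl, fun r hr => ?_, fun r hr => ?_⟩
  · rw [dvec_congr (key r hr), dvec_comp (τ := fun y => extChartAt (𝓡 n) r (Q.symm y))
      (F := fun t => Q (γ t))
      ((htr r hr).differentiableAt (by simp)) (hc.differentiableAt (by simp)), hv, comps_change hq hr]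
  · have hmem := chart_source_nhds (Q.map_source hq) (isOpen_extChartAt_source r)
      (by rwa [Q.left_inv hq])
    -- In these terms the transition map is an isometry between coordinate metrics, so naturality of
    -- the covariant derivative applies.
    have hG : gram (form g) q =ᶠ[nhds (Q (γ 0))]
        indMetric (gram (form g) r) fun y => extChartAt (𝓡 n) r (Q.symm y) :=
      hmem.mono fun y hy => gram_change (isBilin_form g) hy.1 hy.2
    rw [accel_congr (key r hr), accel_comp (τ := fun y => extChartAt (𝓡 n) r (Q.symm y)) ?_
      (htr r hr) hc ?_, ← accel_metric_congr hG, ha, comps_change hq hr]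
    · refine metricAt_gram g ?_
      rw [Q.left_inv hq]; exact (extChartAt (𝓡 n) r).map_source hr
    · rw [← hG.self_of_nhds]
      exact (gram_form_posDef g (Q.map_source hq)).det_pos.ne'

/-- The zero vectors are written with a factor 0 so that this is the case σ = 0 of `IsJetVariation`,
the start of the induction. -/
theorem HasJet.const (g : RMetric n V) (p : V) (w z : TangentSpace (𝓡 n) p) :
    HasJet g (fun _ => p) p ((0 : ℝ) • w) ((0 : ℝ) • z) := by
  have h0 : ∀ (c : E n) (t : ℝ), dvec 1 (fun _ : ℝ => c) t = 0 := fun c t => funext fun k => dd_const _ _ _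
  refine HasJet.of_chart contMDiffAt_const rfl (mem_extChartAt_source p) ?_ ?_
  · rw [h0, comps_smul, zero_smul]
  · funext k
    rw [comps_smul, zero_smul, accel, covD_apply]
    simp only [h0, Pi.zero_apply, dd_const]
    simp [chr]

end Jets

/-! ### Variations with prescribed velocity and acceleration -/

section Variation

variable {n m : ℕ} {V : Type*} [TopologicalSpace V] [ChartedSpace (E n) V] [IsManifold (𝓡 n) ∞ V]
  {S : Type*} [TopologicalSpace S] [ChartedSpace (E m) S]

/-- Smoothness of a vector field along `ι`. -/
def SmoothAlong (ι : S → V) (w : ∀ x, TangentSpace (𝓡 n) (ι x)) : Prop :=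
  ∀ (q : V) (x : S), ι x ∈ (extChartAt (𝓡 n) q).source →
    ContMDiffAt (𝓡 m) (𝓡 n) ∞ (fun x => chartVec q (ι x) (w x)) x

/-- A variation with velocity `σ w` and acceleration `σ z`. -/
structure IsJetVariation (g : RMetric n V) (ι : S → V) (w z : ∀ x, TangentSpace (𝓡 n) (ι x))
    (σ : S → ℝ) (ε : ℝ) (F : ℝ → S → V) : Prop where
  var : IsVariation (n := n) (m := m) ι ε F
  jet : ∀ x, HasJet g (fun t => F t x) (ι x) (σ x • w x) (σ x • z x)

theorem IsVariation.contMDiffAt {ι : S → V} {ε : ℝ} {F : ℝ → S → V}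
    (hF : IsVariation (n := n) (m := m) ι ε F) {t : ℝ} (ht : t ∈ Ioo (-ε) ε) (x : S) :
    ContMDiffAt (𝓘(ℝ, ℝ).prod (𝓡 m)) (𝓡 n) ∞ (fun q : ℝ × S => F q.1 q.2) (t, x) :=
  hF.smooth.contMDiffAt ((isOpen_Ioo.prod isOpen_univ).mem_nhds ⟨ht, mem_univ _⟩)

/-- The second order correction in the chart at `q`. -/
def pushTerm (G : E n → Matrix (Fin n) (Fin n) ℝ) (r : (E n × E n × E n) × ℝ) : E n :=
  (1 / 2 : ℝ) • (r.1.2.2 - r.2 • WithLp.toLp 2 (chr G r.1.1 r.1.2.1.ofLp r.1.2.1.ofLp))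

theorem contDiffAt_pushTerm {G : E n → Matrix (Fin n) (Fin n) ℝ} {r : (E n × E n × E n) × ℝ}
    (hG : MetricAt G r.1.1) : ContDiffAt ℝ ∞ (pushTerm G) r := by
  have h1 : ContDiffAt ℝ ∞ (fun r : (E n × E n × E n) × ℝ => r.1.2.1) r :=
    contDiffAt_fst.snd.fst
  have h2 : ContDiffAt ℝ ∞ (fun r : (E n × E n × E n) × ℝ =>
      (WithLp.toLp 2 (chr G r.1.1 r.1.2.1.ofLp r.1.2.1.ofLp) : E n)) r :=
    (contDiffAt_piLp 2).2 fun k => contDiffAt_chr (F := fun r : (E n × E n × E n) × ℝ => r.1.1) hG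
      contDiffAt_fst.fst (coord_contDiffAt h1) (coord_contDiffAt h1) k
  exact (contDiffAt_const (c := (1 / 2 : ℝ))).smul (contDiffAt_fst.snd.snd.sub (contDiffAt_snd.smul h2))

/-- The inductive step of the construction. On the support of χ, which the chart at q covers, the
variation is corrected to second order in t in that chart; elsewhere it is left alone. -/
theorem exists_jetVariation_push [CompactSpace S] {g : RMetric n V} {ι : S → V}
    (hι : ContMDiff (𝓡 m) (𝓡 n) ∞ ι)
    {w z : ∀ x, TangentSpace (𝓡 n) (ι x)} (hw : SmoothAlong (m := m) ι w)
    (hz : SmoothAlong (m := m) ι z) {σ χ : S → ℝ} (hσ : ContMDiff (𝓡 m) 𝓘(ℝ, ℝ) ∞ σ)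
    (hχ : ContMDiff (𝓡 m) 𝓘(ℝ, ℝ) ∞ χ) {q : V}
    (hsupp : ∀ x ∈ tsupport χ, ι x ∈ (extChartAt (𝓡 n) q).source)
    {ε : ℝ} {F : ℝ → S → V} (hF : IsJetVariation (m := m) g ι w z σ ε F) :
    ∃ ε' F', IsJetVariation (m := m) g ι w z (fun x => σ x + χ x) ε' F' := by
  set Q := extChartAt (𝓡 n) q with hQ
  set K := tsupport χ
  set a : S → E n := fun x => chartVec q (ι x) (w x) with ha_def
  set b : S → E n := fun x => pushTerm (gram (form g) q)
    ((Q (ι x), a x, chartVec q (ι x) (z x)), 2 * σ x + χ x) with hb_def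
  set A : ℝ × S → E n := fun p => Q (F p.1 p.2) + χ p.2 • (p.1 • a p.2 + p.1 ^ 2 • b p.2) with hA_def
  have ha : ∀ x, ι x ∈ Q.source → ContMDiffAt (𝓡 m) (𝓡 n) ∞ a x := fun x hx => hw q x hx
  have hb : ∀ x, ι x ∈ Q.source → ContMDiffAt (𝓡 m) (𝓡 n) ∞ b x := by
    intro x hx
    have h1 : ContDiffAt ℝ ∞ (pushTerm (gram (form g) q))
        ((Q (ι x), a x, chartVec q (ι x) (z x)), 2 * σ x + χ x) :=
      contDiffAt_pushTerm (metricAt_gram g (Q.map_source hx))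
    have h2 : ContMDiffAt (𝓡 m) 𝓘(ℝ, (E n × E n × E n) × ℝ) ∞
        (fun x => ((Q (ι x), a x, chartVec q (ι x) (z x)), 2 * σ x + χ x)) x :=
      (((contMDiffAt_chart hx).comp x (hι x)).prodMk_space
        ((ha x hx).prodMk_space (hz q x hx))).prodMk_space
        ((contMDiffAt_const.mul (hσ x)).add (hχ x))
    exact ContMDiffAt.comp (g := pushTerm (gram (form g) q)) x h1.contMDiffAt h2
  have hA : ∀ (t : ℝ) (x : S), t ∈ Ioo (-ε) ε → F t x ∈ Q.source → ι x ∈ Q.source →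
      ContMDiffAt (𝓘(ℝ, ℝ).prod (𝓡 m)) (𝓡 n) ∞ A (t, x) := by
    intro t x ht hx hx'
    have h1 := hF.var.contMDiffAt ht x
    have h2 : ContMDiffAt (𝓘(ℝ, ℝ).prod (𝓡 m)) (𝓡 n) ∞ (fun p : ℝ × S => Q (F p.1 p.2)) (t, x) :=
      ContMDiffAt.comp (g := Q) (t, x) (contMDiffAt_chart hx) h1
    have h3 : ContMDiffAt (𝓘(ℝ, ℝ).prod (𝓡 m)) 𝓘(ℝ, ℝ) ∞ (fun p : ℝ × S => p.1) (t, x) := contMDiffAt_fst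
    have h4 := (hχ x).comp (t, x) (contMDiffAt_snd (I := 𝓘(ℝ, ℝ)) (J := 𝓡 m) (n := ∞))
    have h5 := (ha x hx').comp (t, x) (contMDiffAt_snd (I := 𝓘(ℝ, ℝ)) (J := 𝓡 m) (n := ∞))
    have h6 := (hb x hx').comp (t, x) (contMDiffAt_snd (I := 𝓘(ℝ, ℝ)) (J := 𝓡 m) (n := ∞))
    exact h2.add (h4.smul ((h3.smul h5).add ((h3.pow 2).smul h6)))
  have h0 : ∀ x, F 0 x = ι x := fun x => congrFun hF.var.zero x
  have hε : (0 : ℝ) ∈ Ioo (-ε) ε := ⟨neg_lt_zero.2 hF.var.pos, hF.var.pos⟩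
  have hA0 : ∀ x, A (0, x) = Q (ι x) := fun x => by simp [hA_def, h0]
  -- The support of χ is compact, so one time interval keeps all its points, before and after the
  -- correction, inside the chart.
  have htube : ∀ᶠ t in nhds (0 : ℝ), ∀ x ∈ K, F t x ∈ Q.source ∧ A (t, x) ∈ Q.target := by
    refine (isClosed_tsupport χ).isCompact.eventually_forall_of_forall_eventually fun x hx => ?_
    have hs := hsupp x hx
    have h1 : F 0 x ∈ Q.source := by rw [h0]; exact hs
    have h2 := (hF.var.contMDiffAt hε x).continuousAt.eventually
      ((isOpen_extChartAt_source q).mem_nhds h1)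
    have h3 := (hA 0 x hε h1 hs).continuousAt.eventually ((isOpen_extChartAt_target q).mem_nhds
      (show A (0, x) ∈ Q.target by rw [hA0]; exact Q.map_source hs))
    exact h2.and h3
  obtain ⟨δ, hδ, hball⟩ := Metric.eventually_nhds_iff.1 htube
  classical
  -- The two branches fit smoothly: off the support χ = 0 and the first formula reproduces F
  -- wherever F stays in the chart.
  set F' : ℝ → S → V := fun t x => if x ∈ K then Q.symm (A (t, x)) else F t x with hF'_def
  have hmem : ∀ t ∈ Ioo (-(min ε δ)) (min ε δ), t ∈ Ioo (-ε) ε ∧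
      ∀ x ∈ K, F t x ∈ Q.source ∧ A (t, x) ∈ Q.target := by
    intro t ht
    have h1 : |t| < min ε δ := abs_lt.2 ht
    refine ⟨abs_lt.1 (h1.trans_le (min_le_left _ _)), hball ?_⟩
    rw [Real.dist_eq, sub_zero]
    exact h1.trans_le (min_le_right _ _)
  have hpos : 0 < min ε δ := lt_min hF.var.pos hδ
  have hsmooth : ∀ t ∈ Ioo (-(min ε δ)) (min ε δ), ∀ x,
      ContMDiffAt (𝓘(ℝ, ℝ).prod (𝓡 m)) (𝓡 n) ∞ (fun p : ℝ × S => F' p.1 p.2) (t, x) := by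
    intro t ht x
    obtain ⟨ht1, ht2⟩ := hmem t ht
    by_cases hx : x ∈ K
    · have h1 := hA t x ht1 (ht2 x hx).1 (hsupp x hx)
      have h2 : ContMDiffAt (𝓘(ℝ, ℝ).prod (𝓡 m)) (𝓡 n) ∞ (fun p => Q.symm (A p)) (t, x) :=
        ContMDiffAt.comp (g := Q.symm) (t, x) (contMDiffAt_chart_symm (ht2 x hx).2) h1
      refine h2.congr_of_eventuallyEq ?_
      filter_upwards [(hF.var.contMDiffAt ht1 x).continuousAt.eventually
        ((isOpen_extChartAt_source q).mem_nhds (ht2 x hx).1)] with p hp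
      by_cases hpK : p.2 ∈ K
      · simp only [hF'_def, if_pos hpK]
      · simp only [hF'_def, if_neg hpK, hA_def, image_eq_zero_of_notMem_tsupport hpK, zero_smul,
          add_zero]
        exact (Q.left_inv hp).symm
    · refine (hF.var.contMDiffAt ht1 x).congr_of_eventuallyEq ?_
      have h1 : ∀ᶠ y in nhds x, y ∉ K := (isClosed_tsupport χ).isOpen_compl.eventually_mem hx
      have : ∀ᶠ p in nhds (t, x), p.2 ∉ K := (continuousAt_snd (p := (t, x))).eventually h1
      filter_upwards [this] with p hp
      simp only [hF'_def, if_neg hp]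
  have hF'0 : ∀ x, F' 0 x = ι x := by
    intro x
    by_cases hx : x ∈ K
    · simp only [hF'_def, if_pos hx, hA0]
      exact Q.left_inv (hsupp x hx)
    · simp only [hF'_def, if_neg hx, h0]
  refine ⟨min ε δ, F', ⟨hpos, fun p hp => (hsmooth p.1 hp.1 p.2).contMDiffWithinAt, funext hF'0⟩,
    fun x => ?_⟩
  have hj := hF.jet x
  by_cases hx : x ∈ K
  · have hs := hsupp x hx
    have hcs : ContMDiffAt 𝓘(ℝ, ℝ) (𝓡 n) ∞ (fun t => F' t x) 0 :=
      ContMDiffAt.comp (g := fun p : ℝ × S => F' p.1 p.2) (0 : ℝ) (hsmooth 0 ⟨neg_lt_zero.2 hpos, hpos⟩ x)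
        (contMDiffAt_id.prodMk contMDiffAt_const)
    have hc : ContDiffAt ℝ ∞ (fun t => Q (F t x)) 0 :=
      contDiffAt_chart_curve hj.smooth (by rw [hj.zero]; exact hs)
    have hcurve : (fun t => Q (F' t x)) =ᶠ[nhds 0]
        fun t => Q (F t x) + χ x • (t • a x + t ^ 2 • b x) := by
      filter_upwards [htube] with t ht
      simp only [hF'_def, if_pos hx]
      exact Q.right_inv (ht x hx).2
    have hv : dvec 1 (fun t => Q (F t x)) 0 = σ x • comps q (ι x) (w x) := by
      rw [hj.velocity q hs, comps_smul]
    refine HasJet.of_chart hcs (hF'0 x) hs ?_ ?_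
    · rw [dvec_congr hcurve]
      funext k
      rw [dvec_push (hc.differentiableAt (by simp)), hv, comps_smul]
      simp only [Pi.smul_apply, smul_eq_mul, ha_def, comps]
      ring
    · rw [accel_congr hcurve]
      funext k
      have hac := congrFun (hj.acceleration q hs) k
      have haw : (a x).ofLp = comps q (ι x) (w x) := rfl
      rw [accel, covD_apply, comps_smul, hv, h0] at hac
      rw [accel_push hc, hv, comps_smul, h0, haw, ← add_smul, chr_smul_left, chr_smul_right]
      rw [chr_smul_left, chr_smul_right] at hac
      simp only [Pi.smul_apply, smul_eq_mul] at hac ⊢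
      -- With Γ = Γ(w, w), the old acceleration is c'' + σ²Γ = σz and the new one is c'' + 2χb + (σ
      -- + χ)²Γ. The choice 2b = z - (2σ + χ)Γ makes the latter (σ + χ)z.
      have hbk : b x k = 1 / 2 * (comps q (ι x) (z x) k - (2 * σ x + χ x) *
        chr (gram (form g) q) (Q (ι x)) (comps q (ι x) (w x)) (comps q (ι x) (w x)) k) := rfl
      rw [hbk]
      linear_combination hac
  · have h1 : (fun t => F' t x) = fun t => F t x := by
      funext t; simp only [hF'_def, if_neg hx]
    rw [h1]
    simpa only [image_eq_zero_of_notMem_tsupport hx, add_zero] using hj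

/-- Existence of variations with prescribed velocity and acceleration. -/
theorem exists_jetVariation [CompactSpace S] [T2Space S] [IsManifold (𝓡 m) ∞ S] (g : RMetric n V)
    {ι : S → V} (hι : ContMDiff (𝓡 m) (𝓡 n) ∞ ι)
    {w z : ∀ x, TangentSpace (𝓡 n) (ι x)} (hw : SmoothAlong (m := m) ι w)
    (hz : SmoothAlong (m := m) ι z) :
    ∃ ε F, IsJetVariation (m := m) g ι w z (fun _ => 1) ε F := by
  obtain ⟨s, hs⟩ := isCompact_univ.elim_nhds_subcover
    (fun x : S => ι ⁻¹' (extChartAt (𝓡 n) (ι x)).source)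
    (fun x _ => hι.continuous.continuousAt.preimage_mem_nhds (extChartAt_source_mem_nhds (ι x)))
  obtain ⟨f, hf⟩ := SmoothPartitionOfUnity.exists_isSubordinate (𝓡 m) (isClosed_univ (X := S))
    (fun x : s => ι ⁻¹' (extChartAt (𝓡 n) (ι x)).source)
    (fun x => (isOpen_extChartAt_source (ι x)).preimage hι.continuous)
    (by
      intro x hx
      obtain ⟨i, hi, hxi⟩ := mem_iUnion₂.1 (hs.2 hx)
      exact mem_iUnion.2 ⟨⟨i, hi⟩, hxi⟩)
  -- Members of the partition of unity are added one at a time, beginning with the constant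
  -- variation; over the full index set the factors sum to 1.
  have key : ∀ u : Finset s, ∃ ε F, IsJetVariation (m := m) g ι w z (fun x => ∑ i ∈ u, f i x) ε F := by
    classical
    intro u
    induction u using Finset.induction_on with
    | empty =>
      refine ⟨1, fun _ => ι, ⟨one_pos, (hι.comp contMDiff_snd).contMDiffOn, rfl⟩, fun x => ?_⟩
      simpa only [Finset.sum_empty] using HasJet.const g (ι x) (w x) (z x)
    | insert i u hi ih =>
      obtain ⟨ε, F, hF⟩ := ih
      have h := exists_jetVariation_push hι hw hz
        (contMDiff_finsetSum fun i _ => (f i).contMDiff) (f i).contMDiff (q := ι i)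
        (fun x hx => hf i hx) hF
      simpa only [Finset.sum_insert hi, add_comm] using h
  have h1 : (fun x => ∑ i, f i x) = fun _ => (1 : ℝ) := by
    funext x
    rw [← finsum_eq_sum_of_fintype]
    exact f.sum_eq_one (mem_univ x)
  simpa only [h1] using key Finset.univ

end Variation

/-! ### Gradients -/

section Gradient

variable {m : ℕ} {S : Type*} [TopologicalSpace S] [ChartedSpace (E m) S] [IsManifold (𝓡 m) ∞ S]

theorem comps_eq_of_form (gS : RMetric m S) {p : S} {y : E m} (hy : y ∈ (extChartAt (𝓡 m) p).target)
    {u : TangentSpace (𝓡 m) ((extChartAt (𝓡 m) p).symm y)} {ℓ : Fin m → ℝ}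
    (h : ∀ b, form gS _ u (coordVec p y b) = ℓ b) :
    comps p ((extChartAt (𝓡 m) p).symm y) u = (gram (form gS) p y)⁻¹.mulVec ℓ := by
  have hdet := (gram_form_posDef gS hy).det_pos.ne'
  have h1 : (gram (form gS) p y).mulVec (comps p ((extChartAt (𝓡 m) p).symm y) u) = ℓ := by
    funext b
    rw [← h b, eq_ip_gram (isBilin_form gS) ((extChartAt (𝓡 m) p).map_target hy),
      (extChartAt (𝓡 m) p).right_inv hy, comps_coordVec_self hy, ip_single_right]
    simp only [Matrix.mulVec, dotProduct]
    exact Finset.sum_congr rfl fun k _ => by rw [(metricAt_gram gS hy).symm]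
  rw [← h1, Matrix.mulVec_mulVec, Matrix.nonsing_inv_mul _ (isUnit_iff_ne_zero.2 hdet),
    Matrix.one_mulVec]

/-- The metric identifies vectors with covectors; the components of u solve the linear system given
by the Gram matrix. -/
theorem exists_form_eq (gS : RMetric m S) (x : S) (L : TangentSpace (𝓡 m) x →L[ℝ] ℝ) :
    ∃ u, ∀ v, form gS x u v = L v := by
  obtain ⟨p, y, hy, rfl⟩ : ∃ p : S, ∃ y ∈ (extChartAt (𝓡 m) p).target,
      (extChartAt (𝓡 m) p).symm y = x := ⟨x, _, mem_extChartAt_target x, extChartAt_to_inv x⟩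
  have hdet := (gram_form_posDef gS hy).det_pos.ne'
  set ℓ : Fin m → ℝ := fun b => L (coordVec p y b)
  refine ⟨∑ a, ((gram (form gS) p y)⁻¹.mulVec ℓ) a • coordVec p y a, fun v => ?_⟩
  rw [eq_ip_gram (isBilin_form gS) ((extChartAt (𝓡 m) p).map_target hy),
    (extChartAt (𝓡 m) p).right_inv hy, comps_sum_coordVec hy,
    ip_comm ((metricAt_gram gS hy).symm y), ip_eq_mulVec, Matrix.mulVec_mulVec,
    Matrix.mul_nonsing_inv _ (isUnit_iff_ne_zero.2 hdet), Matrix.one_mulVec]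
  conv_rhs => rw [eq_sum_coordVec hy v]
  rw [map_sum]
  simp only [map_smul, dotProduct, smul_eq_mul, ℓ]

/-- The differential of a function. -/
def differential (φ : S → ℝ) (x : S) : TangentSpace (𝓡 m) x →L[ℝ] ℝ := mfderiv (𝓡 m) 𝓘(ℝ, ℝ) φ x

theorem differential_coordVec {φ : S → ℝ} (hφ : ContMDiff (𝓡 m) 𝓘(ℝ, ℝ) ∞ φ) {p : S} {y : E m}
    (hy : y ∈ (extChartAt (𝓡 m) p).target) (b : Fin m) :
    differential φ ((extChartAt (𝓡 m) p).symm y) (coordVec p y b)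
      = pd b (fun y => φ ((extChartAt (𝓡 m) p).symm y)) y := by
  have h := mfderiv_comp y ((hφ ((extChartAt (𝓡 m) p).symm y)).mdifferentiableAt (by simp))
    (mdifferentiableAt_chart_symm hy)
  change _ = fderiv ℝ (φ ∘ (extChartAt (𝓡 m) p).symm) y (ev b)
  rw [← mfderiv_eq_fderiv, h]
  rfl

variable {n : ℕ} {V : Type*} [TopologicalSpace V] [ChartedSpace (E n) V] [IsManifold (𝓡 n) ∞ V]

theorem contDiffAt_local {ι : S → V} (hι : ContMDiff (𝓡 m) (𝓡 n) ∞ ι) {p : S} {q : V} {y : E m}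
    (hy : y ∈ (extChartAt (𝓡 m) p).target)
    (hq : ι ((extChartAt (𝓡 m) p).symm y) ∈ (extChartAt (𝓡 n) q).source) :
    ContDiffAt ℝ ∞ (fun y => extChartAt (𝓡 n) q (ι ((extChartAt (𝓡 m) p).symm y))) y :=
  contMDiffAt_iff_contDiffAt.1
    ((contMDiffAt_chart hq).comp y ((hι _).comp y (contMDiffAt_chart_symm hy)))

theorem contDiffAt_scalar_local {φ : S → ℝ} (hφ : ContMDiff (𝓡 m) 𝓘(ℝ, ℝ) ∞ φ) {p : S} {y : E m}
    (hy : y ∈ (extChartAt (𝓡 m) p).target) :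
    ContDiffAt ℝ ∞ (fun y => φ ((extChartAt (𝓡 m) p).symm y)) y :=
  contMDiffAt_iff_contDiffAt.1 ((hφ _).comp y (contMDiffAt_chart_symm hy))

theorem comps_mfderiv_sum {ι : S → V} (hι : ContMDiff (𝓡 m) (𝓡 n) ∞ ι) {p : S} {q : V} {y : E m}
    (hy : y ∈ (extChartAt (𝓡 m) p).target)
    (hq : ι ((extChartAt (𝓡 m) p).symm y) ∈ (extChartAt (𝓡 n) q).source)
    (u : TangentSpace (𝓡 m) ((extChartAt (𝓡 m) p).symm y)) :
    comps q (ι ((extChartAt (𝓡 m) p).symm y)) (mfderiv (𝓡 m) (𝓡 n) ι _ u)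
      = ∑ a, comps p _ u a • dvec (ev a)
        (fun y => extChartAt (𝓡 n) q (ι ((extChartAt (𝓡 m) p).symm y))) y := by
  conv_lhs => rw [eq_sum_coordVec hy u]
  generalize comps p _ u = c
  clear u
  set x := (extChartAt (𝓡 m) p).symm y
  have h := map_sum (⟨⟨fun u => comps q (ι x) (mfderiv (𝓡 m) (𝓡 n) ι x u),
    fun u v => by simp only [map_add, comps_add]⟩, fun c u => by simp only [map_smul, comps_smul]; rfl⟩ :
    TangentSpace (𝓡 m) x →ₗ[ℝ] (Fin n → ℝ)) (fun a => c a • coordVec p y a) Finset.univ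
  refine Eq.trans h (Finset.sum_congr rfl fun a _ => ?_)
  change comps q (ι x) (mfderiv (𝓡 m) (𝓡 n) ι x (c a • coordVec p y a)) = _
  rw [map_smul, comps_smul, comps_mfderiv hy ((hι _).mdifferentiableAt (by simp)) hq]

/-- The tangential vector field along `ι` that is dual to the form `α φ dφ`. -/
theorem exists_gradientAlong (gS : RMetric m S) {ι : S → V} (hι : ContMDiff (𝓡 m) (𝓡 n) ∞ ι)
    {φ : S → ℝ} (hφ : ContMDiff (𝓡 m) 𝓘(ℝ, ℝ) ∞ φ) (α : ℝ) :
    ∃ u : ∀ x, TangentSpace (𝓡 m) x, (∀ x v, form gS x (u x) v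
        = α * (φ x * differential φ x v)) ∧
      SmoothAlong (m := m) ι fun x => mfderiv (𝓡 m) (𝓡 n) ι x (u x) := by
  have hex : ∀ x, ∃ u, ∀ v, form gS x u v = α * (φ x * differential φ x v) := by
    intro x
    obtain ⟨u, hu⟩ := exists_form_eq gS x
      ((α * φ x) • differential φ x)
    refine ⟨u, fun v => ?_⟩
    rw [hu v, ← mul_assoc]
    rfl
  choose u hu using hex
  refine ⟨u, hu, fun q x hx => ?_⟩
  set P := extChartAt (𝓡 m) x
  have hy : P x ∈ P.target := mem_extChartAt_target x
  have hPx : P.symm (P x) = x := extChartAt_to_inv x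
  set φ' : E m → ℝ := fun y => φ (P.symm y)
  set F : E m → E n := fun y => extChartAt (𝓡 n) q (ι (P.symm y))
  -- The field chosen point by point has no visible smoothness. Z is its expression in fixed charts
  -- through the inverse Gram matrix, with smooth ingredients only.
  set Z : E m → E n := fun y => WithLp.toLp 2 (∑ a, ((gram (form gS) x y)⁻¹.mulVec
    fun b => α * (φ' y * pd b φ' y)) a • dvec (ev a) F y)
  have hZ : ContDiffAt ℝ ∞ Z (P x) := by
    have hφ' : ContDiffAt ℝ ∞ φ' (P x) := contDiffAt_scalar_local hφ hy
    have hF : ContDiffAt ℝ ∞ F (P x) := contDiffAt_local hι hy (by rwa [hPx])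
    refine (contDiffAt_piLp 2).2 fun k => ?_
    have : (fun y => Z y k) = fun y => ∑ a, (∑ b, (gram (form gS) x y)⁻¹ a b *
        (α * (φ' y * pd b φ' y))) * dvec (ev a) F y k := by
      funext y
      simp only [Z, Finset.sum_apply, Pi.smul_apply, smul_eq_mul, Matrix.mulVec, dotProduct]
    change ContDiffAt ℝ ∞ (fun y => Z y k) (P x)
    rw [this]
    refine ContDiffAt.sum fun a _ => (ContDiffAt.sum fun b _ => ?_).mul (contDiffAt_dvec hF (ev a) k)
    exact (contDiffAt_inv (fun i j => contDiffAt_gram gS hy i j)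
      (gram_form_posDef gS hy).det_pos.ne' a b).mul
      (contDiffAt_const.mul (hφ'.mul (contDiffAt_dd hφ' _)))
  have h1 : ContMDiffAt (𝓡 m) (𝓡 n) ∞ (fun x' => Z (P x')) x :=
    ContMDiffAt.comp (g := Z) x hZ.contMDiffAt (contMDiffAt_chart (mem_extChartAt_source x))
  refine h1.congr_of_eventuallyEq ?_
  filter_upwards [(isOpen_extChartAt_source (I := 𝓡 m) x).eventually_mem (mem_extChartAt_source x),
    hι.continuous.continuousAt.eventually ((isOpen_extChartAt_source q).eventually_mem hx)] with x' hx' hq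
  obtain ⟨y, hy', rfl⟩ : ∃ y ∈ P.target, P.symm y = x' := ⟨_, P.map_source hx', P.left_inv hx'⟩
  rw [P.right_inv hy']
  have h2 := comps_mfderiv_sum hι hy' hq (u (P.symm y))
  have h3 := comps_eq_of_form gS hy' (u := u (P.symm y)) (ℓ := fun b => α * (φ' y * pd b φ' y))
    fun b => by rw [hu, differential_coordVec hφ hy']
  rw [h3] at h2
  exact PiLp.ext fun k => congrFun h2 k

end Gradient

/-! ### The second derivative of the area -/

section TimeDerivative

theorem slab_mem_nhds {X : Type*} [TopologicalSpace X] {t ε : ℝ} (ht : t ∈ Ioo (-ε) ε) (x : X) :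
    Ioo (-ε) ε ×ˢ (univ : Set X) ∈ nhds (t, x) :=
  (isOpen_Ioo.prod isOpen_univ).mem_nhds ⟨ht, mem_univ x⟩

theorem contDiffAt_of_contMDiffAt_prod {m : ℕ} {Y : Type*} [NormedAddCommGroup Y] [NormedSpace ℝ Y]
    {f : ℝ × E m → Y} {z : ℝ × E m} (h : ContMDiffAt (𝓘(ℝ, ℝ).prod (𝓡 m)) 𝓘(ℝ, Y) ∞ f z) :
    ContDiffAt ℝ ∞ f z := by
  rw [← contMDiffAt_iff_contDiffAt, modelWithCornersSelf_prod, ← chartedSpaceSelf_prod]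
  exact h

variable {m : ℕ} {S : Type*} [TopologicalSpace S] [ChartedSpace (E m) S] [IsManifold (𝓡 m) ∞ S]

/-- In a chart the time derivative is a directional derivative of a smooth function. The result has
the same shape as the hypothesis, so the lemma can be iterated. -/
theorem contMDiffOn_deriv {f : ℝ × S → ℝ} {ε : ℝ}
    (hf : ContMDiffOn (𝓘(ℝ, ℝ).prod (𝓡 m)) 𝓘(ℝ, ℝ) ∞ f (Ioo (-ε) ε ×ˢ univ)) :
    ContMDiffOn (𝓘(ℝ, ℝ).prod (𝓡 m)) 𝓘(ℝ, ℝ) ∞ (fun q => deriv (fun s => f (s, q.2)) q.1)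
      (Ioo (-ε) ε ×ˢ univ) := by
  rintro ⟨t, x⟩ hq
  set P := extChartAt (𝓡 m) x
  set f' : ℝ × E m → ℝ := fun z => f (z.1, P.symm z.2)
  have hPx : P.symm (P x) = x := extChartAt_to_inv x
  have h1 : ContMDiffAt (𝓘(ℝ, ℝ).prod (𝓡 m)) (𝓘(ℝ, ℝ).prod (𝓡 m)) ∞
      (fun z : ℝ × E m => (z.1, P.symm z.2)) (t, P x) :=
    contMDiffAt_fst.prodMk ((contMDiffAt_chart_symm (mem_extChartAt_target x)).comp (t, P x)
      contMDiffAt_snd)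
  have hf' : ContDiffAt ℝ ∞ f' (t, P x) := by
    have h2 := hf.contMDiffAt (slab_mem_nhds hq.1 x)
    have h3 : ContMDiffAt (𝓘(ℝ, ℝ).prod (𝓡 m)) 𝓘(ℝ, ℝ) ∞ f' (t, P x) :=
      ContMDiffAt.comp (g := f) (t, P x) (by rw [hPx]; exact h2) h1
    exact contDiffAt_of_contMDiffAt_prod h3
  have h4 : ContMDiffAt (𝓘(ℝ, ℝ).prod (𝓡 m)) 𝓘(ℝ, ℝ × E m) ∞ (fun q : ℝ × S => (q.1, P q.2)) (t, x) :=
    contMDiffAt_fst.prodMk_space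
      ((contMDiffAt_chart (mem_extChartAt_source x)).comp (t, x) contMDiffAt_snd)
  have h5 : ContMDiffAt (𝓘(ℝ, ℝ).prod (𝓡 m)) 𝓘(ℝ, ℝ) ∞
      (fun q : ℝ × S => dd ((1 : ℝ), (0 : E m)) f' (q.1, P q.2)) (t, x) :=
    ContMDiffAt.comp (g := dd ((1 : ℝ), (0 : E m)) f') (t, x) (contDiffAt_dd hf' _).contMDiffAt h4
  refine (h5.congr_of_eventuallyEq ?_).contMDiffWithinAt
  have h6 : ∀ᶠ q : ℝ × S in nhds (t, x), q.2 ∈ P.source :=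
    (continuousAt_snd (p := (t, x))).eventually
      ((isOpen_extChartAt_source (I := 𝓡 m) x).eventually_mem (mem_extChartAt_source x))
  filter_upwards [h6, h4.continuousAt.eventually (eventually_differentiableAt hf')] with q hq1 hq2
  rw [← deriv_slice hq2]
  simp only [f', P.left_inv hq1]

theorem hasDerivAt_slice {f : ℝ × S → ℝ} {ε : ℝ}
    (hf : ContMDiffOn (𝓘(ℝ, ℝ).prod (𝓡 m)) 𝓘(ℝ, ℝ) ∞ f (Ioo (-ε) ε ×ˢ univ)) {t : ℝ}
    (ht : t ∈ Ioo (-ε) ε) (x : S) :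
    HasDerivAt (fun s => f (s, x)) (deriv (fun s => f (s, x)) t) t := by
  have h2 := hf.contMDiffAt (slab_mem_nhds ht x)
  have h3 : ContMDiffAt 𝓘(ℝ, ℝ) 𝓘(ℝ, ℝ) ∞ (fun s => f (s, x)) t :=
    ContMDiffAt.comp (g := f) t h2 (contMDiffAt_id.prodMk contMDiffAt_const)
  exact (h3.contDiffAt.differentiableAt (by simp)).hasDerivAt

theorem continuous_slice {f : ℝ × S → ℝ} {ε : ℝ}
    (hf : ContMDiffOn (𝓘(ℝ, ℝ).prod (𝓡 m)) 𝓘(ℝ, ℝ) ∞ f (Ioo (-ε) ε ×ˢ univ)) {t : ℝ}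
    (ht : t ∈ Ioo (-ε) ε) : Continuous fun x => f (t, x) :=
  hf.continuousOn.comp_continuous (by fun_prop) fun x => ⟨ht, mem_univ x⟩

variable [CompactSpace S] [MeasurableSpace S] [BorelSpace S]

theorem integrable_of_continuous {μ : Measure S} [IsFiniteMeasure μ] {f : S → ℝ}
    (hf : Continuous f) : Integrable f μ := by
  obtain ⟨C, hC⟩ := isCompact_univ.exists_bound_of_continuousOn hf.continuousOn
  exact Integrable.of_bound hf.aestronglyMeasurable C (ae_of_all _ fun x => hC x (mem_univ x))

/-- Dominated convergence with a constant bound: the time derivative is bounded on the compact set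
formed by a closed time interval and S. -/
theorem hasDerivAt_integral_of_contMDiffOn (μ : Measure S) [IsFiniteMeasure μ] {f : ℝ × S → ℝ} {ε : ℝ}
    (hf : ContMDiffOn (𝓘(ℝ, ℝ).prod (𝓡 m)) 𝓘(ℝ, ℝ) ∞ f (Ioo (-ε) ε ×ˢ univ)) {t : ℝ}
    (ht : t ∈ Ioo (-ε) ε) :
    HasDerivAt (fun t => ∫ x, f (t, x) ∂μ) (∫ x, deriv (fun s => f (s, x)) t ∂μ) t := by
  obtain ⟨δ, hδ, hb⟩ := Metric.nhds_basis_closedBall.mem_iff.1 (isOpen_Ioo.mem_nhds ht)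
  have hf' := contMDiffOn_deriv hf
  obtain ⟨C, hC⟩ := ((isCompact_closedBall t δ).prod (isCompact_univ (X := S))).exists_bound_of_continuousOn
    (hf'.continuousOn.mono (prod_mono_left hb))
  have hs : Metric.closedBall t δ ∈ nhds t := Metric.closedBall_mem_nhds t hδ
  exact (hasDerivAt_integral_of_dominated_loc_of_deriv_le (bound := fun _ => C) hs
    (Filter.eventually_of_mem hs fun s h => (continuous_slice hf (hb h)).aestronglyMeasurable)
    (integrable_of_continuous (continuous_slice hf ht))
    (continuous_slice hf' ht).aestronglyMeasurable
    (ae_of_all _ fun x s h => hC (s, x) ⟨h, mem_univ x⟩) (integrable_const C)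
    (ae_of_all _ fun x s h => hasDerivAt_slice hf (hb h) x)).2

theorem iteratedDeriv_two_integral (μ : Measure S) [IsFiniteMeasure μ] {f : ℝ × S → ℝ} {ε : ℝ}
    (hε : 0 < ε)
    (hf : ContMDiffOn (𝓘(ℝ, ℝ).prod (𝓡 m)) 𝓘(ℝ, ℝ) ∞ f (Ioo (-ε) ε ×ˢ univ)) :
    Integrable (fun x => deriv (deriv fun s => f (s, x)) 0) μ ∧
      iteratedDeriv 2 (fun t => ∫ x, f (t, x) ∂μ) 0 = ∫ x, deriv (deriv fun s => f (s, x)) 0 ∂μ := by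
  have h0 : (0 : ℝ) ∈ Ioo (-ε) ε := ⟨neg_lt_zero.2 hε, hε⟩
  have hf' := contMDiffOn_deriv hf
  refine ⟨integrable_of_continuous (continuous_slice (contMDiffOn_deriv hf') h0), ?_⟩
  rw [iteratedDeriv_succ, iteratedDeriv_one]
  have h1 : deriv (fun t => ∫ x, f (t, x) ∂μ) =ᶠ[nhds 0]
      fun t => ∫ x, deriv (fun s => f (s, x)) t ∂μ := by
    filter_upwards [isOpen_Ioo.mem_nhds h0] with t ht
    exact (hasDerivAt_integral_of_contMDiffOn μ hf ht).deriv
  rw [h1.deriv_eq]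
  exact (hasDerivAt_integral_of_contMDiffOn μ hf' h0).deriv

end TimeDerivative

/-! ### The area density of a variation relative to the induced metric -/

section AreaRatio

variable {n m : ℕ} {V : Type*} [TopologicalSpace V] [ChartedSpace (E n) V] [IsManifold (𝓡 n) ∞ V]
  {S : Type*} [TopologicalSpace S] [ChartedSpace (E m) S] [IsManifold (𝓡 m) ∞ S]

/-- The squared ratio of the volume densities of `h` and `gS`. -/
def areaRatio (gS : RMetric m S) (h : ∀ x : S, TangentSpace (𝓡 m) x → TangentSpace (𝓡 m) x → ℝ)
    (x : S) : ℝ :=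
  (gram h x (extChartAt (𝓡 m) x x)).det / (gram (form gS) x (extChartAt (𝓡 m) x x)).det

/-- A change of chart multiplies both determinants by the same squared Jacobian, so the ratio,
defined with a different chart at each point, does not depend on charts. -/
theorem det_gram_eq (gS : RMetric m S)
    {h : ∀ x : S, TangentSpace (𝓡 m) x → TangentSpace (𝓡 m) x → ℝ} (hh : IsBilin h) {p : S} {y : E m}
    (hy : y ∈ (extChartAt (𝓡 m) p).target) :
    (gram h p y).det
      = areaRatio gS h ((extChartAt (𝓡 m) p).symm y) * (gram (form gS) p y).det := by
  have hs := mem_extChartAt_source (I := 𝓡 m) ((extChartAt (𝓡 m) p).symm y)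
  have hd := (contDiffAt_transition hy hs).differentiableAt (by simp)
  have h0 := (gram_form_posDef gS (mem_extChartAt_target ((extChartAt (𝓡 m) p).symm y))).det_pos.ne'
  rw [gram_change hh hy hs, gram_change (isBilin_form gS) hy hs, det_indMetric _ _ hd,
    det_indMetric _ _ hd, areaRatio]
  field_simp

theorem volumeMeasure_eq_withDensity_areaRatio [CompactSpace S] [MeasurableSpace S] [BorelSpace S]
    (gS : RMetric m S)
    {h : ∀ x : S, TangentSpace (𝓡 m) x → TangentSpace (𝓡 m) x → ℝ} (hh : IsBilin h)
    (hm : Measurable fun x => Real.sqrt (areaRatio gS h x)) :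
    volumeMeasure h = (volumeMeasure (form gS)).withDensity fun x =>
      ENNReal.ofReal (Real.sqrt (areaRatio gS h x)) :=
  volumeMeasure_withDensity gS hh hm (fun _ => Real.sqrt_nonneg _) fun p y hy => by
    rw [det_gram_eq gS hh hy, Real.sqrt_mul' _ (gram_form_posDef gS hy).det_pos.le]

/-- A variation in local coordinates. -/
def localVar (F : ℝ → S → V) (p : S) (q : V) (z : ℝ × E m) : E n :=
  extChartAt (𝓡 n) q (F z.1 ((extChartAt (𝓡 m) p).symm z.2))

variable {ι : S → V} {ε : ℝ} {F : ℝ → S → V}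

theorem contDiffAt_localVar (hF : IsVariation (n := n) (m := m) ι ε F) {t : ℝ} (ht : t ∈ Ioo (-ε) ε)
    {p : S} {q : V} {y : E m} (hy : y ∈ (extChartAt (𝓡 m) p).target)
    (hq : F t ((extChartAt (𝓡 m) p).symm y) ∈ (extChartAt (𝓡 n) q).source) :
    ContDiffAt ℝ ∞ (localVar (n := n) (m := m) F p q) (t, y) := by
  have h1 : ContMDiffAt (𝓘(ℝ, ℝ).prod (𝓡 m)) (𝓘(ℝ, ℝ).prod (𝓡 m)) ∞
      (fun z : ℝ × E m => (z.1, (extChartAt (𝓡 m) p).symm z.2)) (t, y) :=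
    contMDiffAt_fst.prodMk ((contMDiffAt_chart_symm hy).comp (t, y) contMDiffAt_snd)
  have h2 := hF.contMDiffAt ht ((extChartAt (𝓡 m) p).symm y)
  have h3 : ContMDiffAt (𝓘(ℝ, ℝ).prod (𝓡 m)) (𝓡 n) ∞ (localVar (n := n) (m := m) F p q) (t, y) :=
    ContMDiffAt.comp (g := extChartAt (𝓡 n) q) (t, y) (contMDiffAt_chart hq)
      (ContMDiffAt.comp (g := fun q : ℝ × S => F q.1 q.2) (t, y) h2 h1)
  exact contDiffAt_of_contMDiffAt_prod h3

theorem gram_variation (g : RMetric n V) (hF : IsVariation (n := n) (m := m) ι ε F) {t : ℝ}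
    (ht : t ∈ Ioo (-ε) ε) {p : S} {q : V} {y : E m} (hy : y ∈ (extChartAt (𝓡 m) p).target)
    (hq : F t ((extChartAt (𝓡 m) p).symm y) ∈ (extChartAt (𝓡 n) q).source) :
    gram (pullbackForm (m := m) g (F t)) p y
      = varMetric (gram (form g) q) (localVar (n := n) (m := m) F p q) (t, y) := by
  have h1 : ContMDiffAt (𝓡 m) (𝓡 n) ∞ (F t) ((extChartAt (𝓡 m) p).symm y) :=
    ContMDiffAt.comp (g := fun q : ℝ × S => F q.1 q.2) _ (hF.contMDiffAt ht _)
      (contMDiffAt_const.prodMk contMDiffAt_id)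
  rw [gram_pullback g hy (h1.mdifferentiableAt (by simp)) hq]
  simp only [indMetric, varMetric]
  congr 1
  funext a
  exact dvec_slice (F := localVar (n := n) (m := m) F p q) (contDiffAt_localVar hF ht hy hq) (ev a)

/-- By chart independence the ratio near (t, x) can be computed in fixed charts at x and at F t x,
where it is a quotient of smooth determinants. -/
theorem contMDiffOn_areaRatio (g : RMetric n V) (gS : RMetric m S)
    (hF : IsVariation (n := n) (m := m) ι ε F) :
    ContMDiffOn (𝓘(ℝ, ℝ).prod (𝓡 m)) 𝓘(ℝ, ℝ) ∞
      (fun z : ℝ × S => areaRatio gS (pullbackForm (m := m) g (F z.1)) z.2) (Ioo (-ε) ε ×ˢ univ) := by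
  rintro ⟨t, x⟩ hq
  set P := extChartAt (𝓡 m) x with hP
  set q := F t x with hq_def
  have hPx : P.symm (P x) = x := extChartAt_to_inv x
  have hy : P x ∈ P.target := mem_extChartAt_target x
  have hsrc : F t (P.symm (P x)) ∈ (extChartAt (𝓡 n) q).source := by
    rw [hPx]; exact mem_extChartAt_source q
  have hloc := contDiffAt_localVar hF hq.1 hy hsrc
  have hG : MetricAt (gram (form g) q) (localVar (n := n) (m := m) F x q (t, P x)) :=
    metricAt_gram g ((extChartAt (𝓡 n) q).map_source hsrc)
  have h1 : ContDiffAt ℝ ∞ (fun z : ℝ × E m => (varMetric (gram (form g) q) (localVar (n := n) (m := m) F x q) z).det /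
      (gram (form gS) x z.2).det) (t, P x) := by
    refine ContDiffAt.div (contDiffAt_det fun a b => contDiffAt_ip hG hloc (contDiffAt_dvec hloc _)
      (contDiffAt_dvec hloc _)) ?_ (gram_form_posDef gS hy).det_pos.ne'
    exact ContDiffAt.comp (g := fun y => (gram (form gS) x y).det) (t, P x)
      (contDiffAt_det fun a b => contDiffAt_gram gS hy a b) contDiffAt_snd
  have h4 : ContMDiffAt (𝓘(ℝ, ℝ).prod (𝓡 m)) 𝓘(ℝ, ℝ × E m) ∞ (fun q : ℝ × S => (q.1, P q.2)) (t, x) :=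
    contMDiffAt_fst.prodMk_space
      ((contMDiffAt_chart (mem_extChartAt_source x)).comp (t, x) contMDiffAt_snd)
  have h5 := ContMDiffAt.comp (t, x) h1.contMDiffAt h4
  refine (h5.congr_of_eventuallyEq ?_).contMDiffWithinAt
  have h6 : ∀ᶠ z : ℝ × S in nhds (t, x), z.2 ∈ P.source :=
    (continuousAt_snd (p := (t, x))).eventually
      ((isOpen_extChartAt_source (I := 𝓡 m) x).eventually_mem (mem_extChartAt_source x))
  have h7 : ∀ᶠ z : ℝ × S in nhds (t, x), z.1 ∈ Ioo (-ε) ε :=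
    (continuousAt_fst (p := (t, x))).eventually (isOpen_Ioo.eventually_mem hq.1)
  have h8 : ∀ᶠ z : ℝ × S in nhds (t, x), F z.1 z.2 ∈ (extChartAt (𝓡 n) q).source :=
    (hF.contMDiffAt hq.1 x).continuousAt.eventually
      ((isOpen_extChartAt_source q).eventually_mem (mem_extChartAt_source q))
  filter_upwards [h6, h7, h8] with z hz1 hz2 hz3
  have h9 := det_gram_eq gS (isBilin_pullback (d := m) g (F z.1)) (P.map_source hz1)
  rw [gram_variation g hF hz2 (P.map_source hz1) (q := q) (by rwa [P.left_inv hz1]),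
    P.left_inv hz1] at h9
  simp only [Function.comp]
  rw [h9, mul_div_cancel_right₀ _ (gram_form_posDef gS (P.map_source hz1)).det_pos.ne']

variable [CompactSpace S] [MeasurableSpace S] [BorelSpace S]

/-- The second derivative of the area is the integral of the second derivative of the density. -/
theorem iteratedDeriv_two_area (g : RMetric n V) (gS : RMetric m S)
    (hι : IsIsometricImmersion g gS ι) (hF : IsVariation (n := n) (m := m) ι ε F) :
    Integrable (fun x => deriv (deriv fun t =>
        Real.sqrt (areaRatio gS (pullbackForm (m := m) g (F t)) x)) 0) (volumeMeasure (form gS)) ∧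
      iteratedDeriv 2 (fun t => area (m := m) g (F t)) 0
        = ∫ x, deriv (deriv fun t => Real.sqrt (areaRatio gS (pullbackForm (m := m) g (F t)) x)) 0
          ∂(volumeMeasure (form gS)) := by
  have hD := contMDiffOn_areaRatio g gS hF
  set D : ℝ × S → ℝ := fun z => areaRatio gS (pullbackForm (m := m) g (F z.1)) z.2
  have h0 : (0 : ℝ) ∈ Ioo (-ε) ε := ⟨neg_lt_zero.2 hF.pos, hF.pos⟩
  have hD0 : ∀ x, D (0, x) = 1 := by
    intro x
    have h1 : gram (pullbackForm (m := m) g (F 0)) x (extChartAt (𝓡 m) x x)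
        = gram (form gS) x (extChartAt (𝓡 m) x x) := by
      ext a b
      change pullbackForm g (F 0) _ _ _ = form gS _ _ _
      rw [hF.zero, hι.isometric]
    simp only [D, areaRatio, h1]
    exact div_self (gram_form_posDef gS (mem_extChartAt_target x)).det_pos.ne'
  -- The ratio is 1 at time 0; by compactness it stays positive for a uniform time, so that its
  -- square root is smooth there.
  have hev : ∀ᶠ t in nhds (0 : ℝ), ∀ x ∈ (univ : Set S), t ∈ Ioo (-ε) ε ∧ 0 < D (t, x) := by
    refine isCompact_univ.eventually_forall_of_forall_eventually fun x _ => ?_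
    have hc := (hD.contMDiffAt (slab_mem_nhds h0 x)).continuousAt
    exact ((continuousAt_fst (p := ((0 : ℝ), x))).eventually (isOpen_Ioo.eventually_mem h0)).and
      (hc.eventually_const_lt (by rw [hD0]; exact one_pos))
  obtain ⟨δ, hδ, hball⟩ := Metric.eventually_nhds_iff.1 (hev.and (isOpen_Ioo.eventually_mem h0))
  have hmem : ∀ t ∈ Ioo (-δ) δ, t ∈ Ioo (-ε) ε ∧ ∀ x, 0 < D (t, x) := fun t ht => by
    have := hball (show dist t 0 < δ by rw [Real.dist_eq, sub_zero]; exact abs_lt.2 ht)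
    exact ⟨this.2, fun x => (this.1 x (mem_univ x)).2⟩
  have hs : ContMDiffOn (𝓘(ℝ, ℝ).prod (𝓡 m)) 𝓘(ℝ, ℝ) ∞ (fun z => Real.sqrt (D z)) (Ioo (-δ) δ ×ˢ univ) := by
    rintro ⟨t, x⟩ hz
    obtain ⟨h1, h2⟩ := hmem t hz.1
    have h3 := hD.contMDiffAt (slab_mem_nhds h1 x)
    exact (ContMDiffAt.comp (g := Real.sqrt) (t, x)
      (Real.contDiffAt_sqrt (h2 x).ne').contMDiffAt h3).contMDiffWithinAt
  obtain ⟨hI, hA⟩ := iteratedDeriv_two_integral (volumeMeasure (form gS)) hδ hs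
  refine ⟨hI, ?_⟩
  rw [← hA]
  refine Filter.EventuallyEq.iteratedDeriv_eq 2 ?_
  filter_upwards [isOpen_Ioo.mem_nhds (show (0 : ℝ) ∈ Ioo (-δ) δ from ⟨neg_lt_zero.2 hδ, hδ⟩)] with t ht
  have hc := continuous_slice hs ht
  rw [area, volumeMeasure_eq_withDensity_areaRatio gS (isBilin_pullback g (F t)) hc.measurable,
    measureReal_def, withDensity_apply _ MeasurableSet.univ, Measure.restrict_univ,
    integral_eq_lintegral_of_nonneg_ae (ae_of_all _ fun x => Real.sqrt_nonneg _) hc.aestronglyMeasurable]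

end AreaRatio

/-! ### The second variation inequality on the hypersurface -/

section Pointwise

theorem dvec_slice_time {n m : ℕ} {F : ℝ × E m → E n} {t : ℝ} {y : E m}
    (hF : DifferentiableAt ℝ F (t, y)) :
    dvec 1 (fun s => F (s, y)) t = dvec ((1 : ℝ), (0 : E m)) F (t, y) := by
  funext k
  rw [dvec, dd_one_eq_deriv (fun s => F (s, y) k)]
  exact deriv_slice (f := fun z => F z k) ((differentiableAt_piLp 2).1 hF k)

theorem accel_slice {n m : ℕ} (G : E n → Matrix (Fin n) (Fin n) ℝ) {F : ℝ × E m → E n} {y : E m}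
    (hF : ContDiffAt ℝ ∞ F (0, y)) :
    accel G (fun t => F (t, y))
      = covD G F ((1 : ℝ), (0 : E m)) (dvec ((1 : ℝ), (0 : E m)) F) (0, y) := by
  have h0 := eventually_differentiableAt hF
  have h1 : dvec 1 (fun s => F (s, y)) =ᶠ[nhds 0] fun t => dvec ((1 : ℝ), (0 : E m)) F (t, y) := by
    have hc : ContinuousAt (fun t : ℝ => (t, y)) 0 := by fun_prop
    exact (hc.eventually h0).mono fun t ht => dvec_slice_time ht
  funext k
  rw [accel, covD_congr h1, covD_apply, covD_apply, dvec_slice_time h0.self_of_nhds,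
    dd_one_eq_deriv (fun t => dvec ((1 : ℝ), (0 : E m)) F (t, y) k)]
  congr 1
  exact deriv_slice (f := fun z => dvec ((1 : ℝ), (0 : E m)) F z k) (diffAt (contDiffAt_dvec hF _ k))

variable {m : ℕ} {V : Type*} [TopologicalSpace V] [ChartedSpace (E (m + 1)) V]
  [IsManifold (𝓡 (m + 1)) ∞ V]
  {S : Type*} [TopologicalSpace S] [ChartedSpace (E m) S] [IsManifold (𝓡 m) ∞ S]
  {g : RMetric (m + 1) V} {gS : RMetric m S} {ι : S → V}
  {N : ∀ x : S, TangentSpace (𝓡 (m + 1)) (ι x)}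

theorem gram_eq_indMetric (hι : IsIsometricImmersion g gS ι) {p : S} {q : V} {y : E m}
    (hy : y ∈ (extChartAt (𝓡 m) p).target)
    (hq : ι ((extChartAt (𝓡 m) p).symm y) ∈ (extChartAt (𝓡 (m + 1)) q).source) :
    gram (form gS) p y = indMetric (gram (form g) q)
      (fun y => extChartAt (𝓡 (m + 1)) q (ι ((extChartAt (𝓡 m) p).symm y))) y := by
  rw [← gram_pullback g hy ((hι.smooth _).mdifferentiableAt (by simp)) hq]
  ext a b
  exact hι.isometric _ _ _

theorem smoothAlong_normal (hι : ContMDiff (𝓡 m) (𝓡 (m + 1)) ∞ ι)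
    (hN : IsUnitNormal (m := m) g ι N) : SmoothAlong (m := m) ι N := fun _ x hx =>
  (contMDiffAt_tangent_iff (hι x) hx).1 (hN.smooth x)

theorem hyperAt_local (hι : IsIsometricImmersion g gS ι) (hN : IsUnitNormal (m := m) g ι N)
    {p : S} {q : V} {y : E m} (hy : y ∈ (extChartAt (𝓡 m) p).target)
    (hq : ι ((extChartAt (𝓡 m) p).symm y) ∈ (extChartAt (𝓡 (m + 1)) q).source) :
    HyperAt (gram (form g) q)
      (fun y => extChartAt (𝓡 (m + 1)) q (ι ((extChartAt (𝓡 m) p).symm y)))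
      (fun y => comps q (ι ((extChartAt (𝓡 m) p).symm y)) (N ((extChartAt (𝓡 m) p).symm y))) y where
  metric := metricAt_gram g ((extChartAt (𝓡 (m + 1)) q).map_source hq)
  map := contDiffAt_local hι.smooth hy hq
  normal_smooth k := by
    have h := (smoothAlong_normal hι.smooth hN q _ hq).comp y (contMDiffAt_chart_symm hy)
    exact coord_contDiffAt (contMDiffAt_iff_contDiffAt.1 h) k
  unit := by rw [← eq_ip_gram (isBilin_form g) hq, hN.unit]
  normal a := by
    rw [← comps_mfderiv hy ((hι.smooth _).mdifferentiableAt (by simp)) hq,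
      ← eq_ip_gram (isBilin_form g) hq, form_symm, hN.normal]
  det := by
    rw [← gram_eq_indMetric hι hy hq]
    exact (gram_form_posDef gS hy).det_pos.ne'

/-- The mean curvature of the statement at x uses the preferred charts at x and ι x. Agreement at
the centre of these charts suffices, since the second variation is evaluated only there. -/
theorem meanCurv_local (hι : IsIsometricImmersion g gS ι) (x : S) :
    meanCurv (gram (form g) (ι x))
      (fun y => extChartAt (𝓡 (m + 1)) (ι x) (ι ((extChartAt (𝓡 m) x).symm y)))
      (fun y => comps (ι x) (ι ((extChartAt (𝓡 m) x).symm y)) (N ((extChartAt (𝓡 m) x).symm y)))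
      (extChartAt (𝓡 m) x x) = meanCurvature (m := m) g ι N x := by
  have hx := extChartAt_to_inv (I := 𝓡 m) x
  have hq : ι ((extChartAt (𝓡 m) x).symm (extChartAt (𝓡 m) x x)) ∈
      (extChartAt (𝓡 (m + 1)) (ι x)).source := by rw [hx]; exact mem_extChartAt_source (ι x)
  have hsff : ∀ a b, sff (gram (form g) (ι x))
      (fun y => extChartAt (𝓡 (m + 1)) (ι x) (ι ((extChartAt (𝓡 m) x).symm y)))
      (fun y => comps (ι x) (ι ((extChartAt (𝓡 m) x).symm y)) (N ((extChartAt (𝓡 m) x).symm y)))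
      (extChartAt (𝓡 m) x x) a b = secondFundForm g ι N x a b := by
    intro a b
    simp only [sff, hx]
    simp only [ip, secondFundForm]
    refine Finset.sum_congr rfl fun k _ => Finset.sum_congr rfl fun l _ => ?_
    congr 2
    have hx' : extChartAt (𝓡 (m + 1)) (ι x) (ι ((extChartAt (𝓡 m) x).symm (extChartAt (𝓡 m) x x)))
      = extChartAt (𝓡 (m + 1)) (ι x) (ι x) := by rw [hx]
    simp only [covD_apply, chr, hx']
    rfl
  simp only [meanCurv, meanCurvature, hsff]
  rw [gram_pullback g (mem_extChartAt_target x) ((hι.smooth _).mdifferentiableAt (by simp)) hq]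

/-- The pointwise second variation inequality, in terms of the scalar curvature of the conformal
metric `φ^{4/(m-2)} gS`. -/
theorem second_deriv_density_le (hm : 2 < m) {κ : ℝ} (hscal : ∀ p : V, -κ ≤ scalarCurvature g p)
    (hι : IsIsometricImmersion g gS ι) (hN : IsUnitNormal (m := m) g ι N)
    (hmin : ∀ x : S, meanCurvature (m := m) g ι N x = 0)
    {φ : S → ℝ} (hφ : ContMDiff (𝓡 m) 𝓘(ℝ, ℝ) ∞ φ) (hφpos : ∀ x, 0 < φ x)
    {u : ∀ x, TangentSpace (𝓡 m) x}
    (hu : ∀ x v, form gS x (u x) v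
      = -(4 * ((m : ℝ) - 1) / (m - 2) / 2) * (φ x * differential φ x v))
    {ε : ℝ} {F : ℝ → S → V} (hF : IsJetVariation (m := m) g ι (fun x => φ x • N x)
      (fun x => mfderiv (𝓡 m) (𝓡 (m + 1)) ι x (u x)) (fun _ => 1) ε F)
    {g' : RMetric m S} (hg' : ∀ x, g'.inner x = (φ x ^ (4 / ((m : ℝ) - 2))) • gS.inner x) (x : S) :
    2 * deriv (deriv fun t => Real.sqrt (areaRatio gS (pullbackForm (m := m) g (F t)) x)) 0
      ≤ φ x ^ 2 * (φ x ^ (4 / ((m : ℝ) - 2)) * scalarCurvature g' x) + κ * φ x ^ 2 := by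
  set P := extChartAt (𝓡 m) x with hP
  set q := ι x
  set Q := extChartAt (𝓡 (m + 1)) q with hQ
  set y := P x with hy_def
  set G := gram (form g) q with hG_def
  set L := localVar (n := m + 1) (m := m) F x q with hL
  set ψ : E m → ℝ := fun z => φ (P.symm z) with hψ
  have hx : P.symm y = x := extChartAt_to_inv x
  have hyT : y ∈ P.target := mem_extChartAt_target x
  have h0 : (0 : ℝ) ∈ Ioo (-ε) ε := ⟨neg_lt_zero.2 hF.var.pos, hF.var.pos⟩
  have hL0 : (fun z => L (0, z)) = fun z => Q (ι (P.symm z)) := by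
    funext z; simp only [hL, localVar, hF.var.zero]; rfl
  have hL0y : L (0, y) = Q q := by rw [congrFun hL0 y, hx]
  have hnear : ∀ᶠ z in nhds y, z ∈ P.target ∧ ι (P.symm z) ∈ Q.source :=
    chart_source_nhds hyT ((isOpen_extChartAt_source q).preimage hι.smooth.continuous)
      (by rw [mem_preimage, hx]; exact mem_extChartAt_source q)
  have hsmooth : ∀ z, z ∈ P.target → ι (P.symm z) ∈ Q.source → ContDiffAt ℝ ∞ L (0, z) :=
    fun z hz hzq => contDiffAt_localVar hF.var h0 hz (by rw [hF.var.zero]; exact hzq)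
  have hvarnear : ∀ᶠ z : ℝ × E m in nhds (0, y), z.1 ∈ Ioo (-ε) ε ∧ z.2 ∈ P.target ∧
      F z.1 (P.symm z.2) ∈ Q.source := by
    have h1 : ContMDiffAt (𝓘(ℝ, ℝ).prod (𝓡 m)) (𝓘(ℝ, ℝ).prod (𝓡 m)) ∞
        (fun z : ℝ × E m => (z.1, P.symm z.2)) (0, y) :=
      contMDiffAt_fst.prodMk ((contMDiffAt_chart_symm hyT).comp (0, y) contMDiffAt_snd)
    have h2 : ContinuousAt (fun z : ℝ × E m => F z.1 (P.symm z.2)) (0, y) :=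
      ContinuousAt.comp (g := fun q : ℝ × S => F q.1 q.2)
        (f := fun z : ℝ × E m => (z.1, P.symm z.2)) (x := ((0 : ℝ), y))
        (hF.var.contMDiffAt h0 (P.symm y)).continuousAt h1.continuousAt
    refine ((continuousAt_fst (p := ((0 : ℝ), y))).eventually (isOpen_Ioo.eventually_mem h0)).and
      (((continuousAt_snd (p := ((0 : ℝ), y))).eventually
        ((isOpen_extChartAt_target x).eventually_mem hyT)).and
      (h2.eventually ((isOpen_extChartAt_source q).eventually_mem ?_)))
    change F 0 (P.symm y) ∈ _
    rw [hF.var.zero, hx]; exact mem_extChartAt_source q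
  have hH : ∀ᶠ z in nhds y, HyperAt G (fun z => L (0, z))
      (fun z => comps q (ι (P.symm z)) (N (P.symm z))) z := by
    rw [hL0]
    exact hnear.mono fun z hz => hyperAt_local hι hN hz.1 hz.2
  have hψs : ∀ᶠ z in nhds y, ContDiffAt ℝ ∞ ψ z :=
    hnear.mono fun z hz => contDiffAt_scalar_local hφ hz.1
  have hgram : ∀ᶠ z in nhds y, gram (form gS) x z = indMetric G (fun z => L (0, z)) z := by
    rw [hL0]
    exact hnear.mono fun z hz => gram_eq_indMetric hι hz.1 hz.2
  have hc : 2 ≤ 4 * ((m : ℝ) - 1) / (m - 2) := by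
    have : (2 : ℝ) < m := by exact_mod_cast hm
    rw [le_div_iff₀ (by linarith)]; linarith
  have hG : ∀ᶠ p in nhds (L (0, y)), MetricAt G p := by
    rw [hL0y]
    exact ((isOpen_extChartAt_target q).eventually_mem (mem_extChartAt_target q)).mono fun p hp =>
      metricAt_gram g hp
  have hvar0 : ∀ᶠ t in nhds (0 : ℝ), gram (pullbackForm (m := m) g (F t)) x y = varMetric G L (t, y) := by
    have hcont : ContinuousAt (fun t : ℝ => (t, y)) 0 := by fun_prop
    exact (hcont.eventually hvarnear).mono fun t ht => gram_variation g hF.var ht.1 ht.2.1 ht.2.2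
  have hgS : gram (form gS) x y = varMetric G L (0, y) := by
    rw [← hvar0.self_of_nhds]
    ext a b
    change form gS _ _ _ = pullbackForm g (F 0) _ _ _
    rw [hF.var.zero, hι.isometric]
  have hpos := gram_form_posDef gS hyT
  have hvel : ∀ᶠ z in nhds y, dvec ((1 : ℝ), (0 : E m)) L (0, z)
      = ψ z • comps q (ι (P.symm z)) (N (P.symm z)) := by
    filter_upwards [hnear] with z hz
    rw [← dvec_slice_time ((hsmooth z hz.1 hz.2).differentiableAt (by simp))]
    refine ((hF.jet (P.symm z)).velocity q hz.2).trans ?_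
    rw [one_smul, comps_smul]
  -- The acceleration is the image of the tangential field u. The isometry property turns its
  -- product with a coordinate vector into the prescribed multiple of φ dφ.
  have hacc : ∀ᶠ z in nhds y, ∀ a, ip (G (L (0, z)))
      (covD G L ((1 : ℝ), (0 : E m)) (dvec ((1 : ℝ), (0 : E m)) L) (0, z))
      (dvec (ev a) (fun z => L (0, z)) z)
        = (-(4 * ((m : ℝ) - 1) / (m - 2) / 2)) * (ψ z * pd a ψ z) := by
    filter_upwards [hnear] with z hz a
    have h1 : accel G (fun t => L (t, z)) = _ := (hF.jet (P.symm z)).acceleration q hz.2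
    rw [← accel_slice G (hsmooth z hz.1 hz.2), h1, one_smul, hL0, congrFun hL0 z,
      ← comps_mfderiv hz.1 ((hι.smooth _).mdifferentiableAt (by simp)) hz.2,
      ← eq_ip_gram (isBilin_form g) hz.2]
    change pullbackForm g ι _ _ _ = _
    rw [← hι.isometric, hu, differential_coordVec hφ hz.1]
  have key := second_variation_le (G := G) (F := L) (κ := κ) hc hG
    (hvarnear.mono fun z hz => contDiffAt_localVar hF.var hz.1 hz.2.1 hz.2.2) hH hψs.self_of_nhds hvel
    hacc (by rw [hL0, meanCurv_local hι, hmin])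
    (by rw [hL0y]; exact (gram_form_posDef g (mem_extChartAt_target q)).posSemidef)
    (by rw [← hgS]; exact hpos.det_pos) (by rw [hL0y]; exact hscal q)
  -- The right-hand side of `key` without its κ term is the conformal Laplacian paired with φ, that
  -- is, the scalar curvature of g' up to a power of φ.
  have hconf := scalar_conformal_pow (g := indMetric G fun z => L (0, z)) (g' := gram (form g') x)
    (φ := ψ) (y := y) hm (hH.mono fun z hz => hz.induced) hψs (fun z => hφpos _) (by
      filter_upwards [hgram] with z hz
      rw [← hz]
      ext a b
      change g'.inner _ _ _ = _ * gS.inner _ _ _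
      rw [hg']
      rfl)
  have hdens : (fun t => Real.sqrt (areaRatio gS (pullbackForm (m := m) g (F t)) x)) =ᶠ[nhds 0]
      fun t => Real.sqrt ((varMetric G L (t, y)).det / (varMetric G L (0, y)).det) := by
    filter_upwards [hvar0] with t ht
    rw [← hgS, ← ht]
    rfl
  have hψy : ψ y = φ x := by rw [hψ]; simp only [hx]
  rw [hdens.deriv.deriv_eq]
  rw [hψy] at key hconf
  refine key.trans (le_of_eq ?_)
  rw [show scalarCurvature g' x = scalarCoord (gram (form g') x) y from rfl, hconf]

end Pointwise

/-! ### The Yamabe constant of a stable minimal hypersurface -/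

section Conformal

variable {m : ℕ} {S : Type*} [TopologicalSpace S] [ChartedSpace (E m) S] [IsManifold (𝓡 m) ∞ S]

theorem contMDiff_rpow {u : S → ℝ} (hu : ContMDiff (𝓡 m) 𝓘(ℝ, ℝ) ∞ u) (hpos : ∀ x, 0 < u x) (r : ℝ) :
    ContMDiff (𝓡 m) 𝓘(ℝ, ℝ) ∞ fun x => u x ^ r := fun x =>
  ContMDiffAt.comp (g := fun t : ℝ => t ^ r) x
    (Real.contDiffAt_rpow_const_of_ne (hpos x).ne').contMDiffAt (hu x)

variable [CompactSpace S] [MeasurableSpace S] [BorelSpace S]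

/-- The volume measure of a conformal metric. -/
theorem volumeMeasure_conformal {gS g' : RMetric m S} {u : S → ℝ}
    (hu : ContMDiff (𝓡 m) 𝓘(ℝ, ℝ) ∞ u) (hpos : ∀ x, 0 < u x)
    (hg' : ∀ x, g'.inner x = u x • gS.inner x) :
    volumeMeasure (form g') = (volumeMeasure (form gS)).withDensity fun x =>
      ENNReal.ofReal (u x ^ ((m : ℝ) / 2)) := by
  refine volumeMeasure_withDensity gS (isBilin_form g')
    (contMDiff_rpow hu hpos _).continuous.measurable (fun x => (Real.rpow_pos_of_pos (hpos x) _).le)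
    fun p y hy => ?_
  have h1 : gram (form g') p y = u ((extChartAt (𝓡 m) p).symm y) • gram (form gS) p y := by
    ext a b
    change g'.inner _ _ _ = _ * gS.inner _ _ _
    rw [hg']
    rfl
  rw [h1, Matrix.det_smul, Fintype.card_fin, Real.sqrt_mul (pow_nonneg (hpos _).le _),
    Real.sqrt_eq_rpow, ← Real.rpow_natCast, ← Real.rpow_mul (hpos _).le]
  congr 2
  ring

/-- Hölder's inequality for the powers of a conformal factor. -/
theorem integral_rpow_le {μ : Measure S} [IsFiniteMeasure μ] (hm : 2 < m) {u : S → ℝ}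
    (hu : ContMDiff (𝓡 m) 𝓘(ℝ, ℝ) ∞ u) (hpos : ∀ x, 0 < u x) :
    ∫ x, u x ^ (((m : ℝ) - 2) / 2) ∂μ
      ≤ (∫ x, u x ^ ((m : ℝ) / 2) ∂μ) ^ (((m : ℝ) - 2) / m) * μ.real univ ^ (2 / (m : ℝ)) := by
  have hm' : (2 : ℝ) < m := by exact_mod_cast hm
  have hm0 : (0 : ℝ) < (m : ℝ) - 2 := by linarith
  -- Conjugate exponents, since (m-2)/m + 2/m = 1; the second factor in Hölder is the constant 1.
  have hpq : ((m : ℝ) / (m - 2)).HolderConjugate ((m : ℝ) / 2) := by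
    rw [Real.holderConjugate_iff]
    refine ⟨by rw [one_lt_div hm0]; linarith, ?_⟩
    field_simp
    ring
  have hc := (contMDiff_rpow hu hpos (((m : ℝ) - 2) / 2)).continuous
  obtain ⟨C, hC⟩ := isCompact_univ.exists_bound_of_continuousOn hc.continuousOn
  have h := integral_mul_le_Lp_mul_Lq_of_nonneg (μ := μ) hpq
    (f := fun x => u x ^ (((m : ℝ) - 2) / 2)) (g := fun _ => 1)
    (ae_of_all _ fun x => (Real.rpow_pos_of_pos (hpos x) _).le) (ae_of_all _ fun _ => zero_le_one)
    (MemLp.of_bound hc.aestronglyMeasurable C (ae_of_all _ fun x => hC x (mem_univ x)))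
    (memLp_const 1)
  have h1 : ∀ x, (u x ^ (((m : ℝ) - 2) / 2)) ^ ((m : ℝ) / (m - 2)) = u x ^ ((m : ℝ) / 2) := by
    intro x
    rw [← Real.rpow_mul (hpos x).le]
    congr 1
    field_simp
  simpa only [mul_one, h1, Real.one_rpow, integral_const, smul_eq_mul, one_div_div] using h

end Conformal

/-! ### Stability, the Yamabe constant and the volume bound -/

section Stable

variable {m : ℕ} {V : Type*} [TopologicalSpace V] [ChartedSpace (E (m + 1)) V]
  [IsManifold (𝓡 (m + 1)) ∞ V]
  {S : Type*} [TopologicalSpace S] [T2Space S] [CompactSpace S] [MeasurableSpace S] [BorelSpace S]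
  [ChartedSpace (E m) S] [IsManifold (𝓡 m) ∞ S]
  {g : RMetric (m + 1) V} {gS : RMetric m S} {ι : S → V}
  {N : ∀ x : S, TangentSpace (𝓡 (m + 1)) (ι x)}

/-- The inequality for `second_deriv_density_le` is integrated: stability makes the left side
nonnegative, and the right side is the total scalar curvature of the conformal metric plus κ ∫ φ².
-/
theorem integral_scalarCurvature_ge (hm : 2 < m) {κ : ℝ} (hκ : 0 < κ)
    (hscal : ∀ p : V, -κ ≤ scalarCurvature g p)
    (hι : IsIsometricImmersion g gS ι) (hN : IsUnitNormal (m := m) g ι N)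
    (hmin : ∀ x : S, meanCurvature (m := m) g ι N x = 0) (hstable : IsStable (m := m) g ι)
    {g' : RMetric m S} {u : S → ℝ} (hu : ContMDiff (𝓡 m) 𝓘(ℝ, ℝ) ∞ u) (hpos : ∀ x, 0 < u x)
    (hg' : ∀ x, g'.inner x = u x • gS.inner x) :
    -(κ * ∫ x, u x ^ (((m : ℝ) - 2) / 2) ∂(volumeMeasure (form gS)))
      ≤ ∫ x, scalarCurvature g' x ∂(volumeMeasure (form g')) := by
  have hm' : (2 : ℝ) < m := by exact_mod_cast hm
  have hm0 : (0 : ℝ) < (m : ℝ) - 2 := by linarith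
  set μ := volumeMeasure (form gS)
  have hint : ∀ r : ℝ, Integrable (fun x => u x ^ r) μ := fun r =>
    integrable_of_continuous (contMDiff_rpow hu hpos r).continuous
  have hnonneg : 0 ≤ ∫ x, u x ^ (((m : ℝ) - 2) / 2) ∂μ :=
    integral_nonneg fun x => (Real.rpow_pos_of_pos (hpos x) _).le
  -- Without integrability the integral is 0 by convention and the lower bound is nonpositive, so
  -- continuity of the scalar curvature is not needed.
  by_cases hS : Integrable (scalarCurvature g') (volumeMeasure (form g'))
  swap
  · rw [integral_undef hS]
    exact neg_nonpos.2 (mul_nonneg hκ.le hnonneg)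
  -- The exponent for which u = φ^{4/(m-2)}; then φ² = u^{(m-2)/2}.
  set φ : S → ℝ := fun x => u x ^ (((m : ℝ) - 2) / 4) with hφ_def
  have hφ : ContMDiff (𝓡 m) 𝓘(ℝ, ℝ) ∞ φ := contMDiff_rpow hu hpos _
  have hφpos : ∀ x, 0 < φ x := fun x => Real.rpow_pos_of_pos (hpos x) _
  have hφu : ∀ x, φ x ^ (4 / ((m : ℝ) - 2)) = u x := by
    intro x
    rw [hφ_def, ← Real.rpow_mul (hpos x).le,
      show ((m : ℝ) - 2) / 4 * (4 / ((m : ℝ) - 2)) = 1 by field_simp, Real.rpow_one]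
  have hφ2 : ∀ x, φ x ^ 2 = u x ^ (((m : ℝ) - 2) / 2) := by
    intro x
    rw [hφ_def, ← Real.rpow_natCast, ← Real.rpow_mul (hpos x).le]
    congr 1
    push_cast
    ring
  obtain ⟨w, hw, hws⟩ := exists_gradientAlong gS hι.smooth hφ (-(4 * ((m : ℝ) - 1) / (m - 2) / 2))
  have hNs : SmoothAlong (m := m) ι fun x => φ x • N x := by
    intro q x hx
    have h1 := (hφ x).smul (smoothAlong_normal hι.smooth hN q x hx)
    refine h1.congr_of_eventuallyEq (Filter.Eventually.of_forall fun x' => ?_)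
    exact map_smul (mfderiv (𝓡 (m + 1)) (𝓡 (m + 1)) (extChartAt (𝓡 (m + 1)) q) (ι x')) (φ x') (N x')
  obtain ⟨ε, F, hF⟩ := exists_jetVariation g hι.smooth hNs hws
  have hpt := second_deriv_density_le hm hscal hι hN hmin hφ hφpos hw hF (g' := g')
    (fun x => by rw [hφu, hg'])
  obtain ⟨hI, hA⟩ := iteratedDeriv_two_area g gS hι hF.var
  have hst := hstable ε F hF.var
  rw [hA] at hst
  rw [volumeMeasure_conformal hu hpos hg'] at hS ⊢
  have hmeas : Measurable fun x => ENNReal.ofReal (u x ^ ((m : ℝ) / 2)) :=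
    (contMDiff_rpow hu hpos _).continuous.measurable.ennreal_ofReal
  have htop : ∀ᵐ x ∂μ, ENNReal.ofReal (u x ^ ((m : ℝ) / 2)) < ⊤ :=
    ae_of_all _ fun _ => ENNReal.ofReal_lt_top
  rw [integrable_withDensity_iff_integrable_smul' hmeas htop] at hS
  rw [integral_withDensity_eq_integral_toReal_smul hmeas htop]
  -- The volume density u^{m/2} of the conformal metric equals φ² u, so the curvature term of the
  -- pointwise bound is the integrand of the total scalar curvature.
  have hsm : ∀ x, (ENNReal.ofReal (u x ^ ((m : ℝ) / 2))).toReal • scalarCurvature g' x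
      = φ x ^ 2 * (φ x ^ (4 / ((m : ℝ) - 2)) * scalarCurvature g' x) := by
    intro x
    rw [ENNReal.toReal_ofReal (Real.rpow_pos_of_pos (hpos x) _).le, hφu, hφ2, smul_eq_mul, ← mul_assoc]
    congr 1
    conv_rhs => rw [← Real.rpow_one (u x)]
    rw [Real.rpow_one, ← Real.rpow_add_one (hpos x).ne']
    congr 1
    ring
  have hle := integral_mono (hI.const_mul 2) (hS.add ((hint (((m : ℝ) - 2) / 2)).const_mul κ))
    fun x => by
      have := hpt x
      rw [← hsm, hφ2 x] at this
      exact this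
  rw [integral_const_mul] at hle
  have hsum := integral_add hS ((hint (((m : ℝ) - 2) / 2)).const_mul κ)
  rw [integral_const_mul] at hsum
  simp only [Pi.add_apply] at hle
  rw [hsum] at hle
  linarith

/-- Hölder bounds ∫ φ² by the normalizing power of the conformal volume times a power of vol(Σ);
dividing by the former leaves a bound independent of the conformal factor. -/
theorem yamabeConstant_ge (hm : 2 < m) {κ : ℝ} (hκ : 0 < κ)
    (hscal : ∀ p : V, -κ ≤ scalarCurvature g p)
    (hι : IsIsometricImmersion g gS ι) (hN : IsUnitNormal (m := m) g ι N)
    (hmin : ∀ x : S, meanCurvature (m := m) g ι N x = 0) (hstable : IsStable (m := m) g ι) :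
    ((-(κ * (volumeMeasure (form gS)).real univ ^ (2 / (m : ℝ))) : ℝ) : EReal)
      ≤ yamabeConstant gS := by
  refine le_iInf fun g' => ?_
  obtain ⟨g', u, hu, hpos, hg'⟩ := g'
  refine EReal.coe_le_coe_iff.2 ?_
  have h1 := integral_scalarCurvature_ge hm hκ hscal hι hN hmin hstable hu hpos hg'
  have h2 := integral_rpow_le (μ := volumeMeasure (form gS)) hm hu hpos
  have hnn : ∀ x, 0 ≤ u x ^ ((m : ℝ) / 2) := fun x => (Real.rpow_pos_of_pos (hpos x) _).le
  have hvol : ∫ _x, (1 : ℝ) ∂(volumeMeasure (form g'))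
      = ∫ x, u x ^ ((m : ℝ) / 2) ∂(volumeMeasure (form gS)) := by
    rw [volumeMeasure_conformal hu hpos hg', integral_withDensity_eq_integral_toReal_smul
      (contMDiff_rpow hu hpos _).continuous.measurable.ennreal_ofReal
      (ae_of_all _ fun _ => ENNReal.ofReal_lt_top)]
    simp only [smul_eq_mul, mul_one, ENNReal.toReal_ofReal (hnn _)]
  rw [normalizedTotalScalar, hvol]
  set A := (∫ x, u x ^ ((m : ℝ) / 2) ∂(volumeMeasure (form gS))) ^ (((m : ℝ) - 2) / m)
  set B := (volumeMeasure (form gS)).real univ ^ (2 / (m : ℝ))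
  have hA : 0 ≤ A := Real.rpow_nonneg (integral_nonneg hnn) _
  have hB : 0 ≤ B := Real.rpow_nonneg measureReal_nonneg _
  -- If the conformal volume is zero, for instance when S is empty, the quotient is 0 by the
  -- convention for division by zero.
  rcases hA.eq_or_lt with hA0 | hA0
  · rw [← hA0, div_zero]
    exact neg_nonpos.2 (mul_nonneg hκ.le hB)
  · rw [le_div_iff₀ hA0]
    refine le_trans ?_ h1
    have := mul_le_mul_of_nonneg_left h2 hκ.le
    linarith

/-- The two bounds make x finite, so the absolute value can be computed in the reals. -/
theorem abs_le_of_between {a : ℝ} {x : EReal} (ha : (a : EReal) ≤ x) (hx : x ≤ 0) :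
    x.abs ≤ ENNReal.ofReal (-a) := by
  induction x with
  | bot => simp at ha
  | top => simp at hx
  | coe r =>
    have h1 : a ≤ r := EReal.coe_le_coe_iff.1 ha
    have h2 : r ≤ 0 := EReal.coe_le_coe_iff.1 hx
    rw [EReal.abs_def, abs_of_nonpos h2]
    exact ENNReal.ofReal_le_ofReal (neg_le_neg h1)

/-- The value ⊥ for x is harmless because its absolute value is ⊤. -/
theorem abs_le_abs_of_nonpos {x y : EReal} (hxy : x ≤ y) (hy : y ≤ 0) : y.abs ≤ x.abs := by
  induction x with
  | bot => simp
  | top => simp [top_le_iff.1 hxy] at hy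
  | coe r =>
    have hr : r ≤ 0 := EReal.coe_le_coe_iff.1 (hxy.trans hy)
    refine (abs_le_of_between hxy hy).trans ?_
    rw [EReal.abs_def, abs_of_nonpos hr]

end Stable

/-- The volume bound, for a hypersurface of dimension `m` in a manifold of dimension `n = m + 1`. -/
theorem volume_ge_yamabe_sigma {n m : ℕ} {V : Type*} [TopologicalSpace V] [ChartedSpace (E n) V]
    [IsManifold (𝓡 n) ∞ V] {S : Type*} [TopologicalSpace S] [T2Space S] [CompactSpace S]
    [MeasurableSpace S] [BorelSpace S] [ChartedSpace (E m) S] [IsManifold (𝓡 m) ∞ S]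
    {g : RMetric n V} {gS : RMetric m S} {ι : S → V} {N : ∀ x : S, TangentSpace (𝓡 n) (ι x)}
    (hn : n = m + 1) (hm : 2 < m) {κ : ℝ} (hκ : 0 < κ)
    (hscal : ∀ p : V, -κ ≤ scalarCurvature g p)
    (hι : IsIsometricImmersion g gS ι) (hN : IsUnitNormal (m := m) g ι N)
    (hmin : ∀ x : S, meanCurvature (m := m) g ι N x = 0) (hstable : IsStable (m := m) g ι)
    (hσ : sigmaConstant m S ≤ 0) {r : ℝ} (hr : r = (m : ℝ) / 2) :
    ((yamabeConstant gS).abs / ENNReal.ofReal κ) ^ r ≤ volumeMeasure (form gS) univ ∧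
      ((sigmaConstant m S).abs / ENNReal.ofReal κ) ^ r
        ≤ ((yamabeConstant gS).abs / ENNReal.ofReal κ) ^ r := by
  -- The dimensions n and m are separate variables up to here, so that a truncated n - 1 in the
  -- types can be matched with the m + 1 of the local theory.
  subst hn
  have hm0 : (0 : ℝ) < m := by exact_mod_cast (by omega : 0 < m)
  have hr0 : 0 ≤ r := by rw [hr]; positivity
  have hle : yamabeConstant gS ≤ sigmaConstant m S := le_iSup (fun g : RMetric m S => yamabeConstant g) gS
  constructor
  · have h1 := abs_le_of_between (yamabeConstant_ge hm hκ hscal hι hN hmin hstable) (hle.trans hσ)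
    rw [neg_neg] at h1
    have h2 : (yamabeConstant gS).abs / ENNReal.ofReal κ
        ≤ ENNReal.ofReal ((volumeMeasure (form gS)).real univ ^ (2 / (m : ℝ))) := by
      refine (ENNReal.div_le_div_right h1 _).trans (le_of_eq ?_)
      rw [← ENNReal.ofReal_div_of_pos hκ, mul_div_cancel_left₀ _ hκ.ne']
    refine (ENNReal.rpow_le_rpow h2 hr0).trans (le_of_eq ?_)
    rw [ENNReal.ofReal_rpow_of_nonneg (Real.rpow_nonneg measureReal_nonneg _) hr0,
      ← Real.rpow_mul measureReal_nonneg, hr, show 2 / (m : ℝ) * (m / 2) = 1 by field_simp,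
      Real.rpow_one, ofReal_measureReal]
  · exact ENNReal.rpow_le_rpow (ENNReal.div_le_div_right (abs_le_abs_of_nonpos hle hσ) _) hr0

end YamabeArea

end

open YamabeArea in
theorem mainTheorem3 (n : ℕ) (hn : 4 ≤ n)
    {V : Type*} [TopologicalSpace V] [T2Space V] [SecondCountableTopology V]
    [ChartedSpace (EuclideanSpace ℝ (Fin n)) V] [IsManifold (𝓡 n) ∞ V]
    (g : RMetric n V) (κ : ℝ) (hκ : 0 < κ)
    (hscal : ∀ p : V, -κ ≤ scalarCurvature g p)
    {S : Type*} [TopologicalSpace S] [T2Space S] [CompactSpace S]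
    [MeasurableSpace S] [BorelSpace S]
    [ChartedSpace (EuclideanSpace ℝ (Fin (n - 1))) S] [IsManifold (𝓡 (n - 1)) ∞ S]
    (gS : RMetric (n - 1) S) (ι : S → V) (hι : IsIsometricImmersion g gS ι)
    (N : ∀ x : S, TangentSpace (𝓡 n) (ι x)) (hN : IsUnitNormal (m := n - 1) g ι N)
    (hmin : ∀ x : S, meanCurvature (m := n - 1) g ι N x = 0)
    (hstable : IsStable (m := n - 1) g ι)
    (hσ : sigmaConstant (n - 1) S ≤ 0) :
    ((yamabeConstant gS).abs / ENNReal.ofReal κ) ^ (((n : ℝ) - 1) / 2)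
        ≤ volumeMeasure (form gS) univ ∧
      ((sigmaConstant (n - 1) S).abs / ENNReal.ofReal κ) ^ (((n : ℝ) - 1) / 2)
        ≤ ((yamabeConstant gS).abs / ENNReal.ofReal κ) ^ (((n : ℝ) - 1) / 2) := by
  refine volume_ge_yamabe_sigma (by omega) (by omega) hκ hscal hι hN hmin hstable hσ ?_
  -- As 4 ≤ n, the truncated difference n - 1 is the real one in the exponent.
  rw [Nat.cast_sub (by omega), Nat.cast_one]
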